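/- **Setting.** Let $\mathbb F_q$ be a finite field of characteristic $\neq 2,3$ and $E: y^2=f(x)=x^3+Ax+B$ an elliptic curve over $\mathbb F_q$, with Frobenius $\varphi(x,y)=(x^q,y^q)$ on $E(\mathbb F_{q^3})$ and trace-zero subgroup $T_3=\{P\in E(\mathbb F_{q^3}) : P+\varphi(P)+\varphi^2(P)=P_\infty\}$. Assume that $T_3=\langle P\rangle$ has prime order $p>10^6$ and that $\varphi(P)=sP$, $s\in\mathbb Z/p$. For $P_\infty\ne Q\in T_3$ let $h_Q=y-(\alpha_1x+\alpha_0)$, $\alpha_i\in\mathbb F_q$, be the line through $Q,\varphi(Q),\varphi^2(Q)$. For a line $h$ put $\bar h(x,y)=-h(x,-y)$, so that $h_{-Q}=\overline{h_Q}$. There are explicit formulas (fixed rational functions of $A,B$ and the coefficients of the lines) for $D(h_Q)=h_{2Q}$, for $h_{3Q}$, and, from $h_Q,h_R$, for $S_{Q,R}=S_1(x)+yS_2(x)$, $\deg S_1\le4$, $\deg S_2\le3$, with divisor $\sum_{0\le i,j\le2}(\varphi^i(Q)+\varphi^j(R))-9P_\infty$; it is scaled so that the $x^3y$-coefficient is $1$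 if that coefficient is nonzero. All of these formulas are part of the algorithms. **Subalgorithm** $\mathrm{Sub}(g_1,g_2,g_3,g_4)$ for lines $g_1=h_{aP},\ g_2=h_{bP},\ g_3=h_{cP},\ g_4=h_{dP}$. For a monic cubic $W$ and $S=S_1+yS_2$ let $\mathrm{Solve}(W,S)$ be the line $y-(\gamma_1x+\gamma_0)$ given by the unique solution of the explicit $3\times2$ linear system that expresses $W\mid(\gamma_1x+\gamma_0)S_2+S_1$. If $g_1=g_2$, return $\overline{g_1}$; if $g_3=g_4$, return $\overline{g_3}$. Compute $S=S_{aP,bP}$ from $g_1,g_2$ and $S'=S_{cP,dP}$ from $g_3,g_4$. If $g_1=\overline{g_2}$, return $\mathrm{Solve}(\mathrm{monic}(S_1),S')$; if $g_3=\overline{g_4}$, return $\mathrm{Solve}(\mathrm{monic}(S'_1),S)$. Otherwise, for each distinct monic irreducible cubic factor $W\in\mathbb F_q[x]$ of $\gcd(fS_2^2-S_1^2,\ fS_2'^2-S_1'^2)$: if $W\ne S_2$, let $y-(\gamma_1x+\gamma_0)=\mathrm{Solve}(W,S)$ and return it if $W\mid(\gamma_1x+\gamma_0)S'_2+S'_1$;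 if $W=S_2$, return $\mathrm{Solve}(W,S')$. **Algorithm 1** (input $h=h_Q$ and $n\ge1$; output the pair $\mathrm{Alg}_1(h,n)$, meant to be $(h_{nQ},h_{(n+1)Q})$). Let $n=\sum_{i<\ell}n_i2^i$ with $n_{\ell-1}=1$, $k_i=\lfloor n/2^i\rfloor$, and let $\mathcal M$ be the set of odd integers in $[0,p)$ whose residues are in $\left\{\frac{\pm3}{2s+1},\frac{s-4}{3s},\frac{4s-1}{2s+1},\frac{s+5}{3(s+1)},\frac{4s+5}{2s+1}\right\}$. Put $(u_{\ell-1},v_{\ell-1})=(h,h_{2Q})$, and $(u_{\ell-2},v_{\ell-2})=(h_{2Q},h_{3Q})$ or $(h_{3Q},h_{4Q})$ according to $n_{\ell-2}=0$ or $1$. For $i=\ell-3,\dots,0$ let $w=\mathrm{Sub}(h,D(u_{i+1}),u_{i+1},v_{i+1})$ if $k_i,k_i+1\notin\mathcal M$; otherwise let $w$ be $\mathrm{Sub}(h_{3Q},D^2(u_{i+2}),h_{7Q},D^3(u_{i+3}))$, $\mathrm{Sub}(h_{3Q},D^3(u_{i+3}),h_{-5Q},D^3(v_{i+3}))$, $\mathrm{Sub}(h_{-3Q},D^3(v_{i+3}),h_{5Q},D^3(u_{i+3}))$,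 $\mathrm{Sub}(h_{-3Q},D^2(v_{i+2}),h_{-7Q},D^3(v_{i+3}))$ for $(n_{i+1},n_{i+2})=(1,1),(1,0),(0,1),(0,0)$ respectively. Put $(u_i,v_i)=(D(u_{i+1}),w)$ if $n_i=0$ and $(w,D(v_{i+1}))$ if $n_i=1$. Return $(u_0,v_0)$. (Here $h_{5Q}=\mathrm{Sub}(h,h_{4Q},h_{2Q},h_{3Q})$, $h_{7Q}=\mathrm{Sub}(h,h_{6Q},h_{3Q},h_{4Q})$. A residue mod $p$ is passed to Algorithm 1 as its representative in $[0,p)$.) **Exceptional sets.** $\mathcal A=\mathcal A_1\cup\mathcal A_2$, $\mathcal A_1=\left\{-2,s,\frac{-3(1+s)}{2+s},\frac{-3}{2+s},\frac{s+2}{s-1},\frac{-3}{2s+1}\right\}$, $\mathcal A_2=\left\{1,s,\frac{s+2}{s-1},\frac{2s+1}{-3},\frac{1-s}{3s}\right\}$. For $m_0,m_1\in\mathbb Z/p$, omitting fractions with zero denominator, $\mathcal B_1=\left\{\left(\frac{3m_0+m_1}{m_1}\right)^{\pm1},\left(\frac{m_1-m_0}{2m_0+m_1}\right)^{\pm1},\frac{m_0+2m_1}{-(2m_0+m_1)},\frac{3m_0+2m_1}{-(3m_0+m_1)},\frac{2m_1}{-(3m_0+m_1)}\right\}$,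 $\mathcal B_2=\left\{\left(\frac{m_0+3m_1}{-(2m_0+3m_1)}\right)^{\pm1},\left(\frac{m_0-m_1}{m_0+2m_1}\right)^{\pm1},\frac{2m_0+3m_1}{-m_0},\frac{m_0+3m_1}{-2m_0}\right\}$. $\mathcal R\subseteq\mathbb F_p$ is the set of roots of $t+1$, $t-1$, $t+2$, $t+3$, $3t+1$, $t^2+1$, $t^2+t+1$, $t^2+4t+2$, $2t^2+t+1$, $t^2-t-1$, $2t^2+4t+1$, $t^2+4t+1$, $t^2+2t+2$, $t^2+3t+1$, $t^2+t-1$, $2t^2+2t+1$, $t^2-2t-1$, $t^2+2t-1$, $2t^2+3t-1$, $2t^2+3t+1$. The set of precomputed lines is $\mathcal L=\{h_{x(1-s)P}:x\in\mathcal A\}\cup\{h_{(s+\alpha)P}:\alpha\in\mathcal R\}$, obtained with Algorithm 1: $h_{x(1-s)P}=\mathrm{Alg}_1(h_{(1-s)P},x)[1]$, where $h_{(s-1)P}=\mathrm{Alg}_1(h_P,s-1)[1]$, and $h_{(s+\alpha)P}=\mathrm{Alg}_1(h_P,s+\alpha)[1]$. **Algorithm 2** (input $h_P$ and $m\in\mathbb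 Z/p$, $m\ne0$). Let $\overline m=-m$ if the representative of $m$ in $[0,p)$ is $>\frac{p-1}2$, and $\overline m=m$ otherwise. Write $\overline m=m_0+sm_1$. 1. If $m_0=0$, let $h=\mathrm{Alg}_1(h_P,m_1)[1]$; else if $m_1=0$, let $h=\mathrm{Alg}_1(h_P,m_0)[1]$. 2. Else, if $s\in\mathcal B_1\cap\mathcal B_2$, take $h_{(s+\alpha)P}$ from $\mathcal L$ for $\alpha=m_0/m_1$, and let $h=\mathrm{Alg}_1(h_{(s+\alpha)P},m_1)[1]$. 3. Else compute $h_{m_0P},h_{m_1P},h_{(m_0+m_1)P}$ with Algorithm 1. If $s\notin\mathcal B_1$ and $2m_0+m_1\ne0$, let $h=\mathrm{Sub}(h_{m_0P},h_{m_1P},h_{(m_0+m_1)P},h_{m_0(1-s)P})$; otherwise let $h=\mathrm{Sub}(h_{m_0P},h_{m_1P},h_{(m_0+m_1)P},\overline{h_{m_1(1-s)P}})$. Here $h_{x(1-s)P}$ is taken from $\mathcal L$ if $x\in\mathcal A$; for $x\notin\mathcal A$ it is $\mathrm{Sub}(h_{xP},h_{-xP},h_{-(x+1)P},h_{(x+s)P})$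 with $h_{(x+s)P}=\mathrm{Sub}(h_P,h_{xP},h_{(x+1)P},h_{(s-1)P})$, where $h_{xP},h_{(x+1)P}$ are the two entries of $\mathrm{Alg}_1(h_P,x)$. Return $\bar h$ if $m>\frac{p-1}2$, and $h$ otherwise. **Allowed decompositions.** Call a pair $(m_0,m_1)$ *allowed* if every call of the subalgorithm made in step 3 computes the line of a sum $aP+bP=cP+dP$ with $aP,bP,cP,dP\neq P_\infty$, $aP\ne bP$ and $cP\ne dP$. The relevant $(a,b,c,d)$ are $(m_0,\,sm_1,\,s(m_0+m_1),\,(1-s)m_0)$ and $(m_0,\,sm_1,\,m_0+m_1,\,(s-1)m_1)$ for the two cases of the last call, and $(s,\,x,\,x+1,\,s-1)$, $(x,\,-sx,\,-s(x+1),\,x+s)$ for the two auxiliary calls when $x\notin\mathcal A$ ($x=m_0$ or $x=m_1$). Pairs treated in steps 1 and 2 are allowed. **Theorem (Algorithm 2 is correct).** Let $m\in\mathbb Z/p$, $m\neq0$. Then: (i) There are integers $0\le m_0,m_1\le16\sqrt p$ with $\overline m\equiv m_0+sm_1\pmod p$ whose residues form an allowed pair. (ii) At most $10$ of the $p$ pairs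 $(m_0,m_1)\in(\mathbb Z/p)^2$ with $\overline m=m_0+sm_1$ are not allowed. (iii) For every allowed pair $(m_0,m_1)$ with $\overline m=m_0+sm_1$, there is exactly one line $h_{mP}$ through $mP,\varphi(mP),\varphi^2(mP)$ of the form $y-(\alpha_1x+\alpha_0)$ with $\alpha_i\in\mathbb F_q$, and Algorithm 2 with input $h_P$, $m$ and this decomposition outputs $h_{mP}$. -/

import Mathlib

open Polynomial

/-! ### The curve, the trace-zero subgroup and the lines `h_P` -/

/-- The Weierstrass curve `y² = x³ + A x + B`. -/
def shortCurve {F : Type*} [Field F] (A B : F) : WeierstrassCurve F := ⟨0, 0, 0, A, B⟩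

/-- The group `E(K)` of `K`-rational points of `y² = x³ + A x + B`. -/
abbrev CurvePoint {F : Type*} [Field F] (K : Type*) [Field K] [Algebra F K] (A B : F) : Type _ :=
  ((shortCurve A B).baseChange K).toAffine.Point

/-- The Frobenius endomorphism `(x, y) ↦ (x^q, y^q)` of `E(K)`, where `q = #F`. -/
noncomputable def frobPoint {F K : Type*} [Field F] [Fintype F] [Field K] [DecidableEq K]
    [Algebra F K] (A B : F) : CurvePoint K A B →+ CurvePoint K A B :=
  WeierstrassCurve.Affine.Point.map (W' := shortCurve A B) (FiniteField.frobeniusAlgHom F K)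

/-- The subgroup `T₃` of all `P ∈ E(K)` with `P + φ(P) + φ²(P) = 0` (here `[K : F] = 3`). -/
noncomputable def traceZero {F : Type*} [Field F] [Fintype F] (K : Type*) [Field K]
    [DecidableEq K] [Algebra F K] (A B : F) : AddSubgroup (CurvePoint K A B) :=
  AddMonoidHom.ker (AddMonoidHom.id (CurvePoint K A B) + frobPoint A B +
    (frobPoint A B).comp (frobPoint A B))

/-- The polynomial `y - (α₁ x + α₀)` with `α₁ = slope` and `α₀ = icept`. -/
@[ext] structure TLine (F : Type*) where
  slope : F
  icept : F

/-- The line `-h(x, -y)`, that is `y + (α₁ x + α₀)`. -/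
def TLine.flip {F : Type*} [Ring F] (h : TLine F) : TLine F := ⟨-h.slope, -h.icept⟩

/-- The affine point `P` lies on the line `h = 0`. -/
def TLine.Passes {F K : Type*} [Field F] [Field K] [Algebra F K] {A B : F} (h : TLine F) :
    CurvePoint K A B → Prop
  | .zero => False
  | .some x y _ => y = algebraMap F K h.slope * x + algebraMap F K h.icept

/-- `h` is an equation over `F` of a line through `P`, `φ(P)` and `φ²(P)`.  (For `P` of prime
order greater than `3` in `T₃` the three points are distinct, and there is exactly one such `h`.) -/
def IsTraceLine {F K : Type*} [Field F] [Fintype F] [Field K] [DecidableEq K] [Algebra F K]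
    {A B : F} (h : TLine F) (P : CurvePoint K A B) : Prop :=
  h.Passes P ∧ h.Passes (frobPoint A B P) ∧ h.Passes (frobPoint A B (frobPoint A B P))

/-! ### Explicit formulas -/

/-- Coefficient of `x^4` in the part of `S_(P,Q)` without `y`, up to a common factor. -/
def sumA4 {F : Type*} [CommRing F] (A B α₁ α₀ β₁ β₀ : F) : F :=
  -α₁ ^ 3 * β₁ * β₀ ^ 2 - 3 * B * α₁ ^ 3 * β₁ + 2 * A * α₁ ^ 3 * β₀ + 2 * α₁ ^ 2 * α₀ * β₁ ^ 2
    * β₀ + A * α₁ ^ 2 * α₀ * β₁ - 6 * B * α₁ ^ 2 * β₁ ^ 2 + 3 * A * α₁ ^ 2 * β₁ * β₀ + A ^ 2 *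
    α₁ ^ 2 - α₁ * α₀ ^ 2 * β₁ ^ 3 + 6 * α₁ * α₀ ^ 2 * β₀ + 3 * A * α₁ * α₀ * β₁ ^ 2 + 3 * α₁ *
    α₀ * β₀ ^ 2 + 9 * B * α₁ * α₀ - 3 * B * α₁ * β₁ ^ 3 + A * α₁ * β₁ ^ 2 * β₀ + 2 * A ^ 2 *
    α₁ * β₁ - 3 * α₁ * β₀ ^ 3 + 9 * B * α₁ * β₀ - 3 * α₀ ^ 3 * β₁ + 3 * α₀ ^ 2 * β₁ * β₀ - 3 *
    A * α₀ ^ 2 + 2 * A * α₀ * β₁ ^ 3 + 6 * α₀ * β₁ * β₀ ^ 2 + 9 * B * α₀ * β₁ - 6 * A * α₀ *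
    β₀ + A ^ 2 * β₁ ^ 2 + 9 * B * β₁ * β₀ - 3 * A * β₀ ^ 2

/-- Coefficient of `x^3` in the part of `S_(P,Q)` without `y`, up to a common factor. -/
def sumA3 {F : Type*} [CommRing F] (A B α₁ α₀ β₁ β₀ : F) : F :=
  4 * B * α₁ ^ 3 * β₁ ^ 3 - 2 * A * α₁ ^ 3 * β₁ ^ 2 * β₀ + A ^ 2 * α₁ ^ 3 * β₁ - α₁ ^ 3 * β₀ ^
    3 + 9 * B * α₁ ^ 3 * β₀ - 2 * A * α₁ ^ 2 * α₀ * β₁ ^ 3 - α₁ ^ 2 * α₀ * β₁ * β₀ ^ 2 + 3 * B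
    * α₁ ^ 2 * α₀ * β₁ - 7 * A * α₁ ^ 2 * α₀ * β₀ + A ^ 2 * α₁ ^ 2 * β₁ ^ 2 - 6 * B * α₁ ^ 2 *
    β₁ * β₀ + 3 * A * α₁ ^ 2 * β₀ ^ 2 + 6 * A * B * α₁ ^ 2 - α₁ * α₀ ^ 2 * β₁ ^ 2 * β₀ + A *
    α₁ * α₀ ^ 2 * β₁ - 6 * B * α₁ * α₀ * β₁ ^ 2 + 12 * A * α₁ * α₀ * β₁ * β₀ - 8 * A ^ 2 * α₁
    * α₀ + A ^ 2 * α₁ * β₁ ^ 3 + 3 * B * α₁ * β₁ ^ 2 * β₀ + A * α₁ * β₁ * β₀ ^ 2 - 6 * A * B *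
    α₁ * β₁ + 4 * A ^ 2 * α₁ * β₀ - α₀ ^ 3 * β₁ ^ 3 - 3 * α₀ ^ 3 * β₀ + 3 * A * α₀ ^ 2 * β₁ ^
    2 + 21 * α₀ ^ 2 * β₀ ^ 2 - 18 * B * α₀ ^ 2 + 9 * B * α₀ * β₁ ^ 3 - 7 * A * α₀ * β₁ ^ 2 *
    β₀ + 4 * A ^ 2 * α₀ * β₁ - 3 * α₀ * β₀ ^ 3 + 18 * B * α₀ * β₀ + 6 * A * B * β₁ ^ 2 - 8 * A
    ^ 2 * β₁ * β₀ - 18 * B * β₀ ^ 2 + 4 * A ^ 3 + 27 * B ^ 2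

/-- Coefficient of `x^2` in the part of `S_(P,Q)` without `y`, up to a common factor. -/
def sumA2 {F : Type*} [CommRing F] (A B α₁ α₀ β₁ β₀ : F) : F :=
  -A ^ 2 * α₁ ^ 3 * β₁ ^ 3 - 2 * A * α₁ ^ 3 * β₁ * β₀ ^ 2 - 6 * A * B * α₁ ^ 3 * β₁ + A ^ 2 *
    α₁ ^ 3 * β₀ - 2 * A * α₁ ^ 2 * α₀ * β₁ ^ 2 * β₀ + 5 * A ^ 2 * α₁ ^ 2 * α₀ * β₁ - 3 * α₁ ^
    2 * α₀ * β₀ ^ 3 - 9 * B * α₁ ^ 2 * α₀ * β₀ + 6 * A * B * α₁ ^ 2 * β₁ ^ 2 + 9 * B * α₁ ^ 2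
    * β₀ ^ 2 + (2 * A ^ 3 + 27 * B ^ 2) * α₁ ^ 2 - 2 * A * α₁ * α₀ ^ 2 * β₁ ^ 3 - 3 * α₁ * α₀
    ^ 2 * β₁ * β₀ ^ 2 + 9 * B * α₁ * α₀ ^ 2 * β₁ + 9 * A * α₁ * α₀ ^ 2 * β₀ + 36 * B * α₁ * α₀
    * β₁ * β₀ - 12 * A * α₁ * α₀ * β₀ ^ 2 - 18 * A * B * α₁ * α₀ - 6 * A * B * α₁ * β₁ ^ 3 + 5
    * A ^ 2 * α₁ * β₁ ^ 2 * β₀ + 9 * B * α₁ * β₁ * β₀ ^ 2 + (4 * A ^ 3 - 27 * B ^ 2) * α₁ * β₁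
    - 3 * A * α₁ * β₀ ^ 3 + 36 * A * B * α₁ * β₀ - 3 * α₀ ^ 3 * β₁ ^ 2 * β₀ - 3 * A * α₀ ^ 3 *
    β₁ + 9 * B * α₀ ^ 2 * β₁ ^ 2 - 12 * A * α₀ ^ 2 * β₁ * β₀ + 6 * A ^ 2 * α₀ ^ 2 + A ^ 2 * α₀
    * β₁ ^ 3 - 9 * B * α₀ * β₁ ^ 2 * β₀ + 9 * A * α₀ * β₁ * β₀ ^ 2 + 36 * A * B * α₀ * β₁ - 24
    * A ^ 2 * α₀ * β₀ + (2 * A ^ 3 + 27 * B ^ 2) * β₁ ^ 2 - 18 * A * B * β₁ * β₀ + 6 * A ^ 2 *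
    β₀ ^ 2

/-- Coefficient of `x^1` in the part of `S_(P,Q)` without `y`, up to a common factor. -/
def sumA1 {F : Type*} [CommRing F] (A B α₁ α₀ β₁ β₀ : F) : F :=
  -A ^ 2 * α₁ ^ 3 * β₁ ^ 2 * β₀ - 4 * B * α₁ ^ 3 * β₁ * β₀ ^ 2 + (A ^ 3 - 12 * B ^ 2) * α₁ ^ 3
    * β₁ + 8 * A * B * α₁ ^ 3 * β₀ - A ^ 2 * α₁ ^ 2 * α₀ * β₁ ^ 3 - 4 * B * α₁ ^ 2 * α₀ * β₁ ^
    2 * β₀ + 16 * A * B * α₁ ^ 2 * α₀ * β₁ - 3 * A ^ 2 * α₁ ^ 2 * α₀ * β₀ + (-3 * A ^ 3 + 12 *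
    B ^ 2) * α₁ ^ 2 * β₁ ^ 2 - 24 * A * B * α₁ ^ 2 * β₁ * β₀ + 3 * A ^ 2 * α₁ ^ 2 * β₀ ^ 2 - 2
    * A ^ 2 * B * α₁ ^ 2 - 4 * B * α₁ * α₀ ^ 2 * β₁ ^ 3 - 3 * A ^ 2 * α₁ * α₀ ^ 2 * β₁ - 3 *
    α₁ * α₀ ^ 2 * β₀ ^ 3 + 15 * B * α₁ * α₀ ^ 2 * β₀ - 24 * A * B * α₁ * α₀ * β₁ ^ 2 + 12 * A
    ^ 2 * α₁ * α₀ * β₁ * β₀ - 6 * B * α₁ * α₀ * β₀ ^ 2 - 18 * B ^ 2 * α₁ * α₀ + (A ^ 3 - 12 *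
    B ^ 2) * α₁ * β₁ ^ 3 + 16 * A * B * α₁ * β₁ ^ 2 * β₀ - 3 * A ^ 2 * α₁ * β₁ * β₀ ^ 2 + 14 *
    A ^ 2 * B * α₁ * β₁ - 3 * B * α₁ * β₀ ^ 3 + 63 * B ^ 2 * α₁ * β₀ - 3 * α₀ ^ 3 * β₁ * β₀ ^
    2 - 3 * B * α₀ ^ 3 * β₁ - 3 * A * α₀ ^ 3 * β₀ + 3 * A ^ 2 * α₀ ^ 2 * β₁ ^ 2 - 6 * B * α₀ ^
    2 * β₁ * β₀ + 9 * A * α₀ ^ 2 * β₀ ^ 2 + 6 * A * B * α₀ ^ 2 + 8 * A * B * α₀ * β₁ ^ 3 - 3 *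
    A ^ 2 * α₀ * β₁ ^ 2 * β₀ + 15 * B * α₀ * β₁ * β₀ ^ 2 + 63 * B ^ 2 * α₀ * β₁ - 3 * A * α₀ *
    β₀ ^ 3 - 42 * A * B * α₀ * β₀ - 2 * A ^ 2 * B * β₁ ^ 2 - 18 * B ^ 2 * β₁ * β₀ + 6 * A * B
    * β₀ ^ 2 + 4 * A ^ 4 + 27 * A * B ^ 2

/-- Coefficient of `x^0` in the part of `S_(P,Q)` without `y`, up to a common factor. -/
def sumA0 {F : Type*} [CommRing F] (A B α₁ α₀ β₁ β₀ : F) : F :=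
  2 * A ^ 2 * B * α₁ ^ 3 * β₁ - A ^ 3 * α₁ ^ 3 * β₀ - A ^ 2 * α₁ ^ 2 * α₀ * β₁ ^ 2 * β₀ - 4 *
    B * α₁ ^ 2 * α₀ * β₁ * β₀ ^ 2 + 12 * B ^ 2 * α₁ ^ 2 * α₀ * β₁ - 4 * A * B * α₁ ^ 2 * α₀ *
    β₀ - 5 * A ^ 2 * B * α₁ ^ 2 * β₁ ^ 2 + (A ^ 3 - 24 * B ^ 2) * α₁ ^ 2 * β₁ * β₀ + 6 * A * B
    * α₁ ^ 2 * β₀ ^ 2 + (A ^ 4 + 6 * A * B ^ 2) * α₁ ^ 2 - 4 * B * α₁ * α₀ ^ 2 * β₁ ^ 2 * β₀ +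
    2 * A * α₁ * α₀ ^ 2 * β₁ * β₀ ^ 2 - 2 * A * B * α₁ * α₀ ^ 2 * β₁ - A ^ 2 * α₁ * α₀ ^ 2 *
    β₀ + (A ^ 3 - 24 * B ^ 2) * α₁ * α₀ * β₁ ^ 2 + 24 * A * B * α₁ * α₀ * β₁ * β₀ - 3 * A ^ 2
    * α₁ * α₀ * β₀ ^ 2 + A ^ 2 * B * α₁ * α₀ + 2 * A ^ 2 * B * α₁ * β₁ ^ 3 + 12 * B ^ 2 * α₁ *
    β₁ ^ 2 * β₀ - 2 * A * B * α₁ * β₁ * β₀ ^ 2 + (-2 * A ^ 4 - 6 * A * B ^ 2) * α₁ * β₁ - 5 *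
    A ^ 2 * B * α₁ * β₀ - α₀ ^ 3 * β₀ ^ 3 - 3 * B * α₀ ^ 3 * β₀ + 6 * A * B * α₀ ^ 2 * β₁ ^ 2
    - 3 * A ^ 2 * α₀ ^ 2 * β₁ * β₀ + 3 * B * α₀ ^ 2 * β₀ ^ 2 + (A ^ 3 + 9 * B ^ 2) * α₀ ^ 2 -
    A ^ 3 * α₀ * β₁ ^ 3 - 4 * A * B * α₀ * β₁ ^ 2 * β₀ - A ^ 2 * α₀ * β₁ * β₀ ^ 2 - 5 * A ^ 2
    * B * α₀ * β₁ - 3 * B * α₀ * β₀ ^ 3 + (2 * A ^ 3 - 9 * B ^ 2) * α₀ * β₀ + (A ^ 4 + 6 * A *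
    B ^ 2) * β₁ ^ 2 + A ^ 2 * B * β₁ * β₀ + (A ^ 3 + 9 * B ^ 2) * β₀ ^ 2 + 4 * A ^ 3 * B + 27
    * B ^ 3

/-- Coefficient of `x^3 y` in `S_(P,Q)`, up to the same common factor. -/
def sumB3 {F : Type*} [CommRing F] (A B α₁ α₀ β₁ β₀ : F) : F :=
  α₁ ^ 3 * β₀ ^ 2 - B * α₁ ^ 3 - 2 * α₁ ^ 2 * α₀ * β₁ * β₀ + A * α₁ ^ 2 * α₀ + α₁ ^ 2 * β₁ *
    β₀ ^ 2 - 3 * B * α₁ ^ 2 * β₁ + A * α₁ ^ 2 * β₀ + α₁ * α₀ ^ 2 * β₁ ^ 2 - 2 * α₁ * α₀ * β₁ ^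
    2 * β₀ + 2 * A * α₁ * α₀ * β₁ - 3 * B * α₁ * β₁ ^ 2 + 2 * A * α₁ * β₁ * β₀ + α₀ ^ 3 + α₀ ^
    2 * β₁ ^ 3 + 3 * α₀ ^ 2 * β₀ + A * α₀ * β₁ ^ 2 + 3 * α₀ * β₀ ^ 2 - B * β₁ ^ 3 + A * β₁ ^ 2
    * β₀ + β₀ ^ 3

/-- Coefficient of `x^2 y` in `S_(P,Q)`, up to the same common factor. -/
def sumB2 {F : Type*} [CommRing F] (A B α₁ α₀ β₁ β₀ : F) : F :=
  A ^ 2 * α₁ ^ 3 + 3 * α₁ ^ 2 * α₀ * β₀ ^ 2 + 9 * B * α₁ ^ 2 * α₀ + 3 * A ^ 2 * α₁ ^ 2 * β₁ +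
    3 * α₁ ^ 2 * β₀ ^ 3 + 9 * B * α₁ ^ 2 * β₀ - 6 * α₁ * α₀ ^ 2 * β₁ * β₀ - 3 * A * α₁ * α₀ ^
    2 - 6 * α₁ * α₀ * β₁ * β₀ ^ 2 + 18 * B * α₁ * α₀ * β₁ - 6 * A * α₁ * α₀ * β₀ + 3 * A ^ 2 *
    α₁ * β₁ ^ 2 + 18 * B * α₁ * β₁ * β₀ - 3 * A * α₁ * β₀ ^ 2 + 3 * α₀ ^ 3 * β₁ ^ 2 + 3 * α₀ ^
    2 * β₁ ^ 2 * β₀ - 3 * A * α₀ ^ 2 * β₁ + 9 * B * α₀ * β₁ ^ 2 - 6 * A * α₀ * β₁ * β₀ + A ^ 2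
    * β₁ ^ 3 + 9 * B * β₁ ^ 2 * β₀ - 3 * A * β₁ * β₀ ^ 2

/-- Coefficient of `x^1 y` in `S_(P,Q)`, up to the same common factor. -/
def sumB1 {F : Type*} [CommRing F] (A B α₁ α₀ β₁ β₀ : F) : F :=
  -A ^ 2 * α₁ ^ 3 * β₁ ^ 2 - 2 * A * α₁ ^ 3 * β₀ ^ 2 + 2 * A * B * α₁ ^ 3 - 12 * B * α₁ ^ 2 *
    α₀ * β₁ ^ 2 + 4 * A * α₁ ^ 2 * α₀ * β₁ * β₀ - 3 * A ^ 2 * α₁ ^ 2 * α₀ - A ^ 2 * α₁ ^ 2 *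
    β₁ ^ 3 - 12 * B * α₁ ^ 2 * β₁ ^ 2 * β₀ + 4 * A * α₁ ^ 2 * β₁ * β₀ ^ 2 + A ^ 2 * α₁ ^ 2 *
    β₀ + 4 * A * α₁ * α₀ ^ 2 * β₁ ^ 2 - 3 * α₁ * α₀ ^ 2 * β₀ ^ 2 - 9 * B * α₁ * α₀ ^ 2 + 4 * A
    * α₁ * α₀ * β₁ ^ 2 * β₀ + 2 * A ^ 2 * α₁ * α₀ * β₁ + 6 * α₁ * α₀ * β₀ ^ 3 + 18 * B * α₁ *
    α₀ * β₀ + 2 * A ^ 2 * α₁ * β₁ * β₀ + 9 * B * α₁ * β₀ ^ 2 + (4 * A ^ 3 + 27 * B ^ 2) * α₁ +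
    6 * α₀ ^ 3 * β₁ * β₀ + A * α₀ ^ 3 - 2 * A * α₀ ^ 2 * β₁ ^ 3 - 3 * α₀ ^ 2 * β₁ * β₀ ^ 2 + 9
    * B * α₀ ^ 2 * β₁ - 9 * A * α₀ ^ 2 * β₀ + A ^ 2 * α₀ * β₁ ^ 2 + 18 * B * α₀ * β₁ * β₀ - 9
    * A * α₀ * β₀ ^ 2 + 2 * A * B * β₁ ^ 3 - 3 * A ^ 2 * β₁ ^ 2 * β₀ - 9 * B * β₁ * β₀ ^ 2 +
    (4 * A ^ 3 + 27 * B ^ 2) * β₁ + A * β₀ ^ 3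

/-- Coefficient of `x^0 y` in `S_(P,Q)`, up to the same common factor. -/
def sumB0 {F : Type*} [CommRing F] (A B α₁ α₀ β₁ β₀ : F) : F :=
  -2 * A ^ 2 * α₁ ^ 3 * β₁ * β₀ - 8 * B * α₁ ^ 3 * β₀ ^ 2 + (A ^ 3 + 8 * B ^ 2) * α₁ ^ 3 + A ^
    2 * α₁ ^ 2 * α₀ * β₁ ^ 2 - 8 * B * α₁ ^ 2 * α₀ * β₁ * β₀ + 6 * A * α₁ ^ 2 * α₀ * β₀ ^ 2 -
    2 * A * B * α₁ ^ 2 * α₀ + A ^ 2 * α₁ ^ 2 * β₁ ^ 2 * β₀ + 4 * B * α₁ ^ 2 * β₁ * β₀ ^ 2 +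
    (-A ^ 3 - 12 * B ^ 2) * α₁ ^ 2 * β₁ + 4 * A * B * α₁ ^ 2 * β₀ + 4 * B * α₁ * α₀ ^ 2 * β₁ ^
    2 + A ^ 2 * α₁ * α₀ ^ 2 - 2 * A ^ 2 * α₁ * α₀ * β₁ ^ 3 - 8 * B * α₁ * α₀ * β₁ ^ 2 * β₀ + 8
    * A * B * α₁ * α₀ * β₁ - 6 * A ^ 2 * α₁ * α₀ * β₀ + (-A ^ 3 - 12 * B ^ 2) * α₁ * β₁ ^ 2 +
    8 * A * B * α₁ * β₁ * β₀ - 3 * A ^ 2 * α₁ * β₀ ^ 2 + 3 * α₀ ^ 3 * β₀ ^ 2 + B * α₀ ^ 3 - 8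
    * B * α₀ ^ 2 * β₁ ^ 3 + 6 * A * α₀ ^ 2 * β₁ ^ 2 * β₀ - 3 * A ^ 2 * α₀ ^ 2 * β₁ + 3 * α₀ ^
    2 * β₀ ^ 3 - 15 * B * α₀ ^ 2 * β₀ + 4 * A * B * α₀ * β₁ ^ 2 - 6 * A ^ 2 * α₀ * β₁ * β₀ -
    15 * B * α₀ * β₀ ^ 2 + (4 * A ^ 3 + 27 * B ^ 2) * α₀ + (A ^ 3 + 8 * B ^ 2) * β₁ ^ 3 - 2 *
    A * B * β₁ ^ 2 * β₀ + A ^ 2 * β₁ * β₀ ^ 2 + B * β₀ ^ 3 + (4 * A ^ 3 + 27 * B ^ 2) * β₀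

/-- Doubling: `h_(2P)` is `c y - (u₀ + u₁ x)` up to a constant; this is `u₁`. -/
def dblU1 {F : Type*} [CommRing F] (A B α₁ α₀ : F) : F :=
  4 * B * α₁ ^ 4 - 4 * A * α₁ ^ 3 * α₀ + 4 * A ^ 2 * α₁ ^ 2 - 4 * α₁ * α₀ ^ 3 + 36 * B * α₁ *
    α₀ - 12 * A * α₀ ^ 2

/-- Doubling: the coefficient `u₀`. -/
def dblU0 {F : Type*} [CommRing F] (A B α₁ α₀ : F) : F :=
  -A ^ 2 * α₁ ^ 4 - 8 * B * α₁ ^ 3 * α₀ + 2 * A * α₁ ^ 2 * α₀ ^ 2 + 6 * A * B * α₁ ^ 2 - 8 * A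
    ^ 2 * α₁ * α₀ - α₀ ^ 4 - 18 * B * α₀ ^ 2 + 4 * A ^ 3 + 27 * B ^ 2

/-- Doubling: the coefficient `c`. -/
def dblC {F : Type*} [CommRing F] (A B α₁ α₀ : F) : F :=
  8 * B * α₁ ^ 3 - 8 * A * α₁ ^ 2 * α₀ - 8 * α₀ ^ 3

/-- Tripling: `h_(3P)` is `d y - (v₀ + v₁ x)` up to a constant; this is `v₁`. -/
def triV1 {F : Type*} [Field F] (A B α₁ α₀ : F) : F :=
  1 / 3 * A ^ 4 * α₁ ^ 9 + 8 * A ^ 2 * B * α₁ ^ 8 * α₀ + (-4 * A ^ 3 + 48 * B ^ 2) * α₁ ^ 7 *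
    α₀ ^ 2 + (16 * A ^ 3 * B + 144 * B ^ 3) * α₁ ^ 7 - 48 * A * B * α₁ ^ 6 * α₀ ^ 3 + (-16 * A
    ^ 4 - 240 * A * B ^ 2) * α₁ ^ 6 * α₀ + 10 * A ^ 2 * α₁ ^ 5 * α₀ ^ 4 + 192 * A ^ 2 * B * α₁
    ^ 5 * α₀ ^ 2 + (8 * A ^ 5 + 54 * A ^ 2 * B ^ 2) * α₁ ^ 5 - 24 * B * α₁ ^ 4 * α₀ ^ 5 +
    (-112 * A ^ 3 + 144 * B ^ 2) * α₁ ^ 4 * α₀ ^ 3 + (96 * A ^ 3 * B + 648 * B ^ 3) * α₁ ^ 4 *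
    α₀ + 12 * A * α₁ ^ 3 * α₀ ^ 6 - 240 * A * B * α₁ ^ 3 * α₀ ^ 4 + (-48 * A ^ 4 - 324 * A * B
    ^ 2) * α₁ ^ 3 * α₀ ^ 2 + (-32 * A ^ 4 * B - 216 * A * B ^ 3) * α₁ ^ 3 - 48 * A ^ 2 * α₁ ^
    2 * α₀ ^ 5 + (64 * A ^ 5 + 432 * A ^ 2 * B ^ 2) * α₁ ^ 2 * α₀ + 3 * α₁ * α₀ ^ 8 - 288 * B
    * α₁ * α₀ ^ 6 + (-24 * A ^ 3 - 162 * B ^ 2) * α₁ * α₀ ^ 4 + (288 * A ^ 3 * B + 1944 * B ^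
    3) * α₁ * α₀ ^ 2 + (-16 * A ^ 6 - 216 * A ^ 3 * B ^ 2 - 729 * B ^ 4) * α₁ + 48 * A * α₀ ^
    7 + (-64 * A ^ 4 - 432 * A * B ^ 2) * α₀ ^ 3

/-- Tripling: the coefficient `v₀`. -/
def triV0 {F : Type*} [Field F] (A B α₁ α₀ : F) : F :=
  (-8 / 3 * A ^ 3 * B - 64 / 3 * B ^ 3) * α₁ ^ 9 + (3 * A ^ 4 + 32 * A * B ^ 2) * α₁ ^ 8 * α₀
    - 16 * A ^ 2 * B * α₁ ^ 7 * α₀ ^ 2 - 8 * A ^ 2 * B ^ 2 * α₁ ^ 7 + (12 * A ^ 3 + 16 * B ^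
    2) * α₁ ^ 6 * α₀ ^ 3 + (8 * A ^ 3 * B - 144 * B ^ 3) * α₁ ^ 6 * α₀ + 8 * A * B * α₁ ^ 5 *
    α₀ ^ 4 + 288 * A * B ^ 2 * α₁ ^ 5 * α₀ ^ 2 + (32 * A ^ 4 * B + 216 * A * B ^ 3) * α₁ ^ 5 +
    10 * A ^ 2 * α₁ ^ 4 * α₀ ^ 5 - 200 * A ^ 2 * B * α₁ ^ 4 * α₀ ^ 3 + (-24 * A ^ 5 - 162 * A
    ^ 2 * B ^ 2) * α₁ ^ 4 * α₀ + 32 * B * α₁ ^ 3 * α₀ ^ 6 + (64 * A ^ 3 + 72 * B ^ 2) * α₁ ^ 3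
    * α₀ ^ 4 + (192 * A ^ 3 * B + 1296 * B ^ 3) * α₁ ^ 3 * α₀ ^ 2 + (96 * A ^ 3 * B ^ 2 + 648
    * B ^ 4) * α₁ ^ 3 - 4 * A * α₁ ^ 2 * α₀ ^ 7 - 72 * A * B * α₁ ^ 2 * α₀ ^ 5 + (-176 * A ^ 4
    - 1188 * A * B ^ 2) * α₁ ^ 2 * α₀ ^ 3 + (-192 * A ^ 4 * B - 1296 * A * B ^ 3) * α₁ ^ 2 *
    α₀ + 64 * A ^ 2 * α₁ * α₀ ^ 6 + (128 * A ^ 5 + 864 * A ^ 2 * B ^ 2) * α₁ * α₀ ^ 2 + 1 / 3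
    * α₀ ^ 9 + 72 * B * α₀ ^ 7 + (-120 * A ^ 3 - 810 * B ^ 2) * α₀ ^ 5 + (192 * A ^ 3 * B +
    1296 * B ^ 3) * α₀ ^ 3 + (-16 * A ^ 6 - 216 * A ^ 3 * B ^ 2 - 729 * B ^ 4) * α₀

/-- Tripling: the coefficient `d`. -/
def triD {F : Type*} [Field F] (A B α₁ α₀ : F) : F :=
  A ^ 4 * α₁ ^ 8 + 24 * A ^ 2 * B * α₁ ^ 7 * α₀ + (-12 * A ^ 3 + 144 * B ^ 2) * α₁ ^ 6 * α₀ ^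
    2 + (-24 * A ^ 3 * B - 144 * B ^ 3) * α₁ ^ 6 - 144 * A * B * α₁ ^ 5 * α₀ ^ 3 + (32 * A ^ 4
    + 144 * A * B ^ 2) * α₁ ^ 5 * α₀ + 30 * A ^ 2 * α₁ ^ 4 * α₀ ^ 4 + 120 * A ^ 2 * B * α₁ ^ 4
    * α₀ ^ 2 + (-8 * A ^ 5 - 54 * A ^ 2 * B ^ 2) * α₁ ^ 4 - 72 * B * α₁ ^ 3 * α₀ ^ 5 + 720 * B
    ^ 2 * α₁ ^ 3 * α₀ ^ 3 + (-96 * A ^ 3 * B - 648 * B ^ 3) * α₁ ^ 3 * α₀ + 36 * A * α₁ ^ 2 *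
    α₀ ^ 6 - 360 * A * B * α₁ ^ 2 * α₀ ^ 4 + (48 * A ^ 4 + 324 * A * B ^ 2) * α₁ ^ 2 * α₀ ^ 2
    + 96 * A ^ 2 * α₁ * α₀ ^ 5 + 9 * α₀ ^ 8 + 72 * B * α₀ ^ 6 + (24 * A ^ 3 + 162 * B ^ 2) *
    α₀ ^ 4 - 16 / 3 * A ^ 6 - 72 * A ^ 3 * B ^ 2 - 243 * B ^ 4

/-- `D(h_P) = h_(2P)`. -/
def TLine.double {F : Type*} [Field F] (A B : F) (h : TLine F) : TLine F :=
  ⟨dblU1 A B h.slope h.icept / dblC A B h.slope h.icept,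
    dblU0 A B h.slope h.icept / dblC A B h.slope h.icept⟩

/-- `h_(3P)` from `h_P`. -/
def TLine.triple {F : Type*} [Field F] (A B : F) (h : TLine F) : TLine F :=
  ⟨triV1 A B h.slope h.icept / triD A B h.slope h.icept,
    triV0 A B h.slope h.icept / triD A B h.slope h.icept⟩

/-- The polynomial `f = x³ + A x + B`. -/
noncomputable def cubicF {F : Type*} [Field F] (A B : F) : F[X] := X ^ 3 + C A * X + C B

/-- A polynomial `S = S₁(x) + y S₂(x)`. -/
structure SPoly (F : Type*) [Field F] where
  fst : F[X]
  snd : F[X]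

open Classical in
/-- The polynomial `S_(P,Q) = S₁ + y S₂` computed from `h_P` and `h_Q`.  It is only determined up
to a nonzero constant; if the coefficient of `x³ y` is nonzero, it is scaled to be `1`. -/
noncomputable def sPoly {F : Type*} [Field F] (A B : F) (h k : TLine F) : SPoly F :=
  let c : F := if sumB3 A B h.slope h.icept k.slope k.icept = 0 then 1
    else (sumB3 A B h.slope h.icept k.slope k.icept)⁻¹
  { fst := C c * (C (sumA4 A B h.slope h.icept k.slope k.icept) * X ^ 4
      + C (sumA3 A B h.slope h.icept k.slope k.icept) * X ^ 3
      + C (sumA2 A B h.slope h.icept k.slope k.icept) * X ^ 2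
      + C (sumA1 A B h.slope h.icept k.slope k.icept) * X
      + C (sumA0 A B h.slope h.icept k.slope k.icept))
    snd := C c * (C (sumB3 A B h.slope h.icept k.slope k.icept) * X ^ 3
      + C (sumB2 A B h.slope h.icept k.slope k.icept) * X ^ 2
      + C (sumB1 A B h.slope h.icept k.slope k.icept) * X
      + C (sumB0 A B h.slope h.icept k.slope k.icept)) }

/-- The polynomial `f S₂² - S₁²`. -/
noncomputable def SPoly.normPoly {F : Type*} [Field F] (A B : F) (S : SPoly F) : F[X] :=
  cubicF A B * S.snd ^ 2 - S.fst ^ 2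

/-! ### The subalgorithm -/

/-- The augmented matrix `L(W, S)` of the linear system in `(γ₁, γ₀)`, for `W` a monic cubic. -/
noncomputable def systemMatrix {F : Type*} [Field F] (W : F[X]) (S : SPoly F) :
    Matrix (Fin 3) (Fin 3) F :=
  let w := W.coeff
  let a := S.fst.coeff
  let b := S.snd.coeff
  !![w 0 * (w 2 - b 2), b 0 - w 0, w 0 * a 3 - a 4 * w 2 * w 0 - a 0;
     w 0 * (w 1 - b 1), b 0 * w 2 - w 0 * b 2, w 0 * a 2 - a 4 * w 1 * w 0 - a 0 * w 2;
     w 0 * (w 0 - b 0), b 0 * w 1 - b 1 * w 0, w 0 * a 1 - a 4 * w 0 ^ 2 - a 0 * w 1]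

/-- `h = y - (γ₁ x + γ₀)` solves the linear system with augmented matrix `L(W, S)`. -/
def SolvesSystem {F : Type*} [Field F] (W : F[X]) (S : SPoly F) (h : TLine F) : Prop :=
  ∀ i, systemMatrix W S i 0 * h.slope + systemMatrix W S i 1 * h.icept = systemMatrix W S i 2

open Classical in
/-- The line obtained by solving the linear system with augmented matrix `L(W, S)`; no result if
the system does not have exactly one solution. -/
noncomputable def solveSystem {F : Type*} [Field F] (W : F[X]) (S : SPoly F) :
    Option (TLine F) :=
  if hs : ∃! h, SolvesSystem W S h then some hs.choose else none

/-- The monic multiple of a nonzero polynomial. -/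
noncomputable def makeMonic {F : Type*} [Field F] (g : F[X]) : F[X] := C g.leadingCoeff⁻¹ * g

open Classical in
/-- The distinct monic irreducible factors of degree `3` of `G`, in some order. -/
noncomputable def cubicFactors {F : Type*} [Field F] (G : F[X]) : List F[X] :=
  ((UniqueFactorizationMonoid.normalizedFactors G).toFinset.filter
    fun W => W.natDegree = 3).toList

open Classical in
/-- One pass of the loop of the subalgorithm, for the factor `W`. -/
noncomputable def subalgTry {F : Type*} [Field F] (S₁ S₂ : SPoly F) (W : F[X]) :
    Option (TLine F) :=
  if W ≠ S₁.snd then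
    (solveSystem W S₁).filter fun h => W ∣ (C h.slope * X + C h.icept) * S₂.snd + S₂.fst
  else solveSystem W S₂

open Classical in
/-- The subalgorithm for four given lines `h_(m₁P)`, `h_(m₂P)`, `h_(n₁P)`, `h_(n₂P)`. -/
noncomputable def subalgLines {F : Type*} [Field F] (A B : F) (h₁ h₂ h₃ h₄ : TLine F) :
    Option (TLine F) :=
  if h₁ = h₂ then some h₁.flip
  else if h₃ = h₄ then some h₃.flip
  else
    let S₁ := sPoly A B h₁ h₂
    let S₂ := sPoly A B h₃ h₄
    if h₁ = h₂.flip then solveSystem (makeMonic S₁.fst) S₂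
    else if h₃ = h₄.flip then solveSystem (makeMonic S₂.fst) S₁
    else (cubicFactors (EuclideanDomain.gcd (S₁.normPoly A B) (S₂.normPoly A B))).findSome?
      (subalgTry S₁ S₂)

/-- The subalgorithm.  Lines are passed on as `Option`s, where `none` stands for a line that does
not exist or that some step failed to compute; such a value is harmless as long as the output of
the algorithm does not use it. -/
noncomputable def subalg {F : Type*} [Field F] (A B : F) (h₁ h₂ h₃ h₄ : Option (TLine F)) :
    Option (TLine F) :=
  h₁.bind fun a => h₂.bind fun b => h₃.bind fun c => h₄.bind fun d => subalgLines A B a b c d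

/-! ### Algorithm 1: the ladder -/

/-- The set `M` of exceptional residues for the ladder. -/
def ladderM {p : ℕ} [Fact p.Prime] (s : ZMod p) : Set (ZMod p) :=
  {3 / (2 * s + 1), -3 / (2 * s + 1), (s - 4) / (3 * s), (4 * s - 1) / (2 * s + 1),
    (s + 5) / (3 * (s + 1)), (4 * s + 5) / (2 * s + 1)}

/-- `k` is an odd integer in `{0, …, p - 1}` whose residue lies in `M`. -/
def LadderExceptional {p : ℕ} [Fact p.Prime] (s : ZMod p) (k : ℕ) : Prop :=
  k < p ∧ Odd k ∧ (k : ZMod p) ∈ ladderM s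

/-- A pair of lines `(u, v)` as stored by the ladder. -/
abbrev LinePair (F : Type*) := Option (TLine F) × Option (TLine F)

/-- The doubling step on possibly missing lines. -/
def dbl {F : Type*} [Field F] (A B : F) (h : Option (TLine F)) : Option (TLine F) :=
  h.map (TLine.double A B)

/-- The line `-h(x, -y)` on possibly missing lines. -/
def neg {F : Type*} [Field F] (h : Option (TLine F)) : Option (TLine F) := h.map TLine.flip

/-- The line `h_exc` of step `i`, computed from the pairs `L₁ = (u_(i+3), v_(i+3))` and
`L₂ = (u_(i+2), v_(i+2))`.  The lines `h_(5P)`, `h_(7P)` come from the subalgorithm. -/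
noncomputable def ladderExc {F : Type*} [Field F] (A B : F) (h : Option (TLine F)) (m i : ℕ)
    (L₁ L₂ : LinePair F) : Option (TLine F) :=
  let h2 := dbl A B h
  let h3 := h.map (TLine.triple A B)
  let h4 := dbl A B h2
  let h5 := subalg A B h h4 h2 h3
  let h7 := subalg A B h (dbl A B h3) h3 h4
  if m.testBit (i + 1) then
    if m.testBit (i + 2) then
      subalg A B h3 (dbl A B (dbl A B L₂.1)) h7 (dbl A B (dbl A B (dbl A B L₁.1)))
    else
      subalg A B h3 (dbl A B (dbl A B (dbl A B L₁.1)))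
        (neg h5) (dbl A B (dbl A B (dbl A B L₁.2)))
  else
    if m.testBit (i + 2) then
      subalg A B (neg h3) (dbl A B (dbl A B (dbl A B L₁.2)))
        h5 (dbl A B (dbl A B (dbl A B L₁.1)))
    else
      subalg A B (neg h3) (dbl A B (dbl A B L₂.2))
        (neg h7) (dbl A B (dbl A B (dbl A B L₁.2)))

open Classical in
/-- Step `i` of the ladder.  The list `L` holds the last two or three pairs, oldest first, and the
pair `(u_i, v_i)` is appended to it.  Here `k_i = m / 2^i`. -/
noncomputable def ladderStep {F : Type*} [Field F] (A B : F) {p : ℕ} [Fact p.Prime] (s : ZMod p)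
    (h : Option (TLine F)) (m : ℕ) (L : List (LinePair F)) (i : ℕ) : List (LinePair F) :=
  let special : Prop :=
    LadderExceptional s (m / 2 ^ i) ∨ LadderExceptional s (m / 2 ^ i + 1)
  let exc := ladderExc A B h m i (L.getD 0 (none, none)) (L.getD 1 (none, none))
  let L' := if L.length = 3 then L.tail else L
  let prev := L'.getD 1 (none, none)
  let w := if special then exc else subalg A B h (dbl A B prev.1) prev.1 prev.2
  if m.testBit i then L' ++ [(w, dbl A B prev.2)] else L' ++ [(dbl A B prev.1, w)]

/-- The pairs of the steps `ℓ - 1` and `ℓ - 2`, where `ℓ ≥ 2` is the number of binary digits. -/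
def ladderStart {F : Type*} [Field F] (A B : F) (h : Option (TLine F)) (m : ℕ) :
    List (LinePair F) :=
  let h2 := dbl A B h
  let h3 := h.map (TLine.triple A B)
  [(h, h2), if m.testBit (m.size - 2) then (h3, dbl A B h2) else (h2, h3)]

/-- Algorithm 1 with input `h_P` and an integer `m > 0`, returning the last pair computed, that is
`(h_(mP), h_((m+1)P))`. -/
noncomputable def alg1 {F : Type*} [Field F] (A B : F) {p : ℕ} [Fact p.Prime] (s : ZMod p)
    (h : Option (TLine F)) (m : ℕ) : LinePair F :=
  if m = 0 then (none, none)
  else if m.size = 1 then (h, dbl A B h)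
  else ((List.range (m.size - 2)).reverse.foldl (ladderStep A B s h m)
    (ladderStart A B h m)).getLastD (none, none)

/-! ### Algorithm 2: Frobenius reduction -/

/-- The exceptional set `𝒜₁`. -/
def excA₁ {p : ℕ} [Fact p.Prime] (s : ZMod p) : Set (ZMod p) :=
  {-2, s, -3 * (1 + s) / (2 + s), -3 / (2 + s), (s + 2) / (s - 1), -3 / (2 * s + 1)}

/-- The exceptional set `𝒜₂`. -/
def excA₂ {p : ℕ} [Fact p.Prime] (s : ZMod p) : Set (ZMod p) :=
  {1, s, (s + 2) / (s - 1), (2 * s + 1) / -3, (1 - s) / (3 * s)}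

/-- The exceptional set `ℬ₁`: all the quotients of the list whose denominator is nonzero. -/
def excB₁ {p : ℕ} [Fact p.Prime] (m₀ m₁ : ZMod p) : Set (ZMod p) :=
  {x | ∃ r ∈ [(3 * m₀ + m₁, m₁), (m₁, 3 * m₀ + m₁), (m₁ - m₀, 2 * m₀ + m₁),
      (2 * m₀ + m₁, m₁ - m₀), (m₀ + 2 * m₁, -(2 * m₀ + m₁)),
      (3 * m₀ + 2 * m₁, -(3 * m₀ + m₁)), (2 * m₁, -(3 * m₀ + m₁))],
    r.2 ≠ 0 ∧ x = r.1 / r.2}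

/-- The exceptional set `ℬ₂`: all the quotients of the list whose denominator is nonzero. -/
def excB₂ {p : ℕ} [Fact p.Prime] (m₀ m₁ : ZMod p) : Set (ZMod p) :=
  {x | ∃ r ∈ [(m₀ + 3 * m₁, -(2 * m₀ + 3 * m₁)), (-(2 * m₀ + 3 * m₁), m₀ + 3 * m₁),
      (m₀ - m₁, m₀ + 2 * m₁), (m₀ + 2 * m₁, m₀ - m₁), (2 * m₀ + 3 * m₁, -m₀),
      (m₀ + 3 * m₁, -(2 * m₀))],
    r.2 ≠ 0 ∧ x = r.1 / r.2}

/-- The polynomials whose roots in `𝔽_p` form the set `ℛ`. -/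
noncomputable def excPolys (p : ℕ) : List (ZMod p)[X] :=
  [X + 1, X - 1, X + 2, X + 3, 3 * X + 1, X ^ 2 + 1, X ^ 2 + X + 1, X ^ 2 + 4 * X + 2,
    2 * X ^ 2 + X + 1, X ^ 2 - X - 1, 2 * X ^ 2 + 4 * X + 1, X ^ 2 + 4 * X + 1,
    X ^ 2 + 2 * X + 2, X ^ 2 + 3 * X + 1, X ^ 2 + X - 1, 2 * X ^ 2 + 2 * X + 1,
    X ^ 2 - 2 * X - 1, X ^ 2 + 2 * X - 1, 2 * X ^ 2 + 3 * X - 1, 2 * X ^ 2 + 3 * X + 1]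

/-- The set `ℛ`. -/
def excRoots (p : ℕ) : Set (ZMod p) := {α | ∃ g ∈ excPolys p, g.eval α = 0}

open Classical in
/-- Look-up of `h_(x(1-s)P)`, `x ∈ 𝒜₁ ∪ 𝒜₂`, in the precomputed set, which is filled by running
Algorithm 1 on `h_((1-s)P)` and `x`. -/
noncomputable def precompA {F : Type*} [Field F] (A B : F) {p : ℕ} [Fact p.Prime] (s : ZMod p)
    (h : Option (TLine F)) (x : ZMod p) : Option (TLine F) :=
  if x ∈ excA₁ s ∪ excA₂ s then
    (alg1 A B s (neg (alg1 A B s h (s - 1).val).1) x.val).1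
  else none

open Classical in
/-- Look-up of `h_((s+α)P)`, `α ∈ ℛ`, in the precomputed set. -/
noncomputable def precompR {F : Type*} [Field F] (A B : F) {p : ℕ} [Fact p.Prime] (s : ZMod p)
    (h : Option (TLine F)) (α : ZMod p) : Option (TLine F) :=
  if α ∈ excRoots p then (alg1 A B s h (s + α).val).1 else none

open Classical in
/-- The line `h_(x(1-s)P)`: looked up if `x ∈ 𝒜₁ ∪ 𝒜₂`, and otherwise computed by two calls of the
subalgorithm from `h_(xP)` and `h_((x+1)P)`. -/
noncomputable def oneSubLine {F : Type*} [Field F] (A B : F) {p : ℕ} [Fact p.Prime] (s : ZMod p)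
    (h : Option (TLine F)) (x : ZMod p) : Option (TLine F) :=
  if x ∉ excA₁ s ∪ excA₂ s then
    let hx := (alg1 A B s h x.val).1
    let hx1 := (alg1 A B s h x.val).2
    let hxs := subalg A B h hx hx1 (neg (precompA A B s h 1))
    subalg A B hx (neg hx) (neg hx1) hxs
  else precompA A B s h x

/-- The residue `m̄`: it is `-m` if `m > (p - 1) / 2`, and `m` otherwise. -/
def foldResidue {p : ℕ} (m : ZMod p) : ZMod p := if m.val > (p - 1) / 2 then -m else m

open Classical in
/-- Algorithm 2 with input `h` and `m`, where `m̄ = m₀ + s m₁` is the decomposition that is used. -/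
noncomputable def alg2 {F : Type*} [Field F] (A B : F) {p : ℕ} [Fact p.Prime] (s : ZMod p)
    (h : TLine F) (m m₀ m₁ : ZMod p) : Option (TLine F) :=
  let hP : Option (TLine F) := some h
  let res : Option (TLine F) :=
    if m₀ = 0 then (alg1 A B s hP m₁.val).1
    else if m₁ = 0 then (alg1 A B s hP m₀.val).1
    else if s ∈ excB₁ m₀ m₁ ∩ excB₂ m₀ m₁ then
      (alg1 A B s (precompR A B s hP (m₀ / m₁)) m₁.val).1
    else
      let hm₀ := (alg1 A B s hP m₀.val).1
      let hm₁ := (alg1 A B s hP m₁.val).1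
      let hsum := (alg1 A B s hP (m₀ + m₁).val).1
      if s ∉ excB₁ m₀ m₁ ∧ 2 * m₀ + m₁ ≠ 0 then
        subalg A B hm₀ hm₁ hsum (oneSubLine A B s hP m₀)
      else
        subalg A B hm₀ hm₁ hsum (neg (oneSubLine A B s hP m₁))
  if m.val > (p - 1) / 2 then neg res else res

/-! ### Which decompositions are allowed -/

/-- The standing assumption on the data of one call of the subalgorithm, which is to compute
`h_((a+b)P) = h_((c+d)P)` from `h_(aP)`, `h_(bP)`, `h_(cP)`, `h_(dP)`: the four points are not the
point at infinity, so that their lines exist, and `aP ≠ bP`, `cP ≠ dP`. -/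
def CallAllowed {p : ℕ} (a b c d : ZMod p) : Prop :=
  a ≠ 0 ∧ b ≠ 0 ∧ c ≠ 0 ∧ d ≠ 0 ∧ a ≠ b ∧ c ≠ d

/-- The two calls that compute `h_(x(1-s)P)` for `x ∉ 𝒜₁ ∪ 𝒜₂` meet the standing assumption. -/
def OneSubAllowed {p : ℕ} [Fact p.Prime] (s x : ZMod p) : Prop :=
  x ∉ excA₁ s ∪ excA₂ s →
    CallAllowed s x (x + 1) (s - 1) ∧ CallAllowed x (-(s * x)) (-(s * (x + 1))) (x + s)

/-- All calls of the subalgorithm that Algorithm 2 itself makes for the decomposition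
`m̄ = m₀ + s m₁` meet the standing assumption. -/
def DecompAllowed {p : ℕ} [Fact p.Prime] (s m₀ m₁ : ZMod p) : Prop :=
  m₀ ≠ 0 → m₁ ≠ 0 → s ∉ excB₁ m₀ m₁ ∩ excB₂ m₀ m₁ →
    ((s ∉ excB₁ m₀ m₁ ∧ 2 * m₀ + m₁ ≠ 0 →
      OneSubAllowed s m₀ ∧ CallAllowed m₀ (s * m₁) (s * (m₀ + m₁)) ((1 - s) * m₀)) ∧
    (¬(s ∉ excB₁ m₀ m₁ ∧ 2 * m₀ + m₁ ≠ 0) →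
      OneSubAllowed s m₁ ∧ CallAllowed m₀ (s * m₁) (m₀ + m₁) ((s - 1) * m₁)))

/-! The trace-zero group is identified with `ZMod p`, where Frobenius acts as multiplication by s
with s² + s + 1 = 0. Write θ(u), η(u) for the coordinates of uP; `TraceCoords` collects the laws
they satisfy. Since φ(uP) ≠ ±uP, θ(u) has degree 3 over F. Hence uP has exactly one line over F,
this line determines u up to powers of s, and f - (α₁x + α₀)² is the minimal polynomial of θ(u),
which determines u up to sign and powers of s.

The explicit formulas are polynomial identities once A and B are eliminated by Vieta on a chord or
tangent. Their denominators are nonzero because they are values of irreducible cubics at elements of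
F, up to units, or products of 3-division polynomials at points that are not 3-torsion.

The heart is the subalgorithm. The function S built from the lines of aP and bP vanishes at the
three points (a + sʲb)P, and its norm fS₂² - S₁² is the product of their minimal polynomials
(`normPoly_eq`). If W is the minimal polynomial of θ(w) and S vanishes at wP, then W divides (γ₁x +
γ₀)S₂ + S₁ exactly when the line passes through wP or W divides S₂ (`dvd_line_iff`); so solving the
system gives the line of wP. A factor common to the two norms, other than that of a + b = c + d,
comes from a relation a + sʲb = ±sˡ(c + sᵏd) with j, k ≠ 0. The divisibility test rejects the minus
sign, and the plus sign is one of twelve coincidences. Without coincidences the output is correct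
(`subalgLines_eq_some`).

A coincidence is a linear equation with coefficients in ℤ[s], the image of the Eisenstein integers.
A nonzero Eisenstein integer of norm below p has nonzero image in `ZMod p`; this is where p > 10⁶
enters. A finite computation therefore shows that the exceptional sets cover all coincidences: M for
the ladder, 𝒜 and ℬ for the Frobenius reduction. In the ladder the exceptional calls are replaced by
other calls, themselves verified.

For fixed n = m₀ + sm₁ each way of not being allowed fixes m₀, and counting these ways gives at most
ten pairs. The relations x + sy = 0 contain an ideal of ℤ[ω] generated by a vector of size at most
√p, so every square of side 3⌊√p⌋ contains a decomposition of n. Sixteen disjoint squares then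
provide one that is allowed. -/

/-! ### Polynomial identities behind the explicit formulas -/

set_option maxHeartbeats 4000000 in
set_option maxRecDepth 100000 in
-- The tangent y = lX + n at abscissa x meets the curve again at x₃, and `hA`, `hB` are Vieta for X³
-- + AX + B - (lX + n)² = (X - x)²(X - x₃). A line through the point of tangency has slope a + l, so
-- x, l, n, a are free parameters and the claim, that 2P lies on the doubled line, becomes an
-- identity in them.
theorem double_identity {R : Type*} [CommRing R] (x l n a x₃ A B α₁ α₀ : R)
    (hx : x₃ = l ^ 2 - 2 * x) (hA : A = x * x + (x + x) * x₃ + 2 * l * n)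
    (hB : B = n ^ 2 - x * x * x₃) (h1 : α₁ = a + l) (h2 : α₀ = n - a * x) :
    dblU1 A B α₁ α₀ * x₃ + dblU0 A B α₁ α₀ = - (l * x₃ + n) * dblC A B α₁ α₀ := by
  simp only [dblU1, dblU0, dblC]
  subst h1 h2 hA hB hx
  ring

theorem sumB3_neg {R : Type*} [CommRing R] (A B α₁ α₀ : R) : sumB3 A B α₁ α₀ (-α₁) (-α₀) = 0 := by
  simp only [sumB3]; ring

theorem sumB2_neg {R : Type*} [CommRing R] (A B α₁ α₀ : R) : sumB2 A B α₁ α₀ (-α₁) (-α₀) = 0 := by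
  simp only [sumB2]; ring

theorem sumB1_neg {R : Type*} [CommRing R] (A B α₁ α₀ : R) : sumB1 A B α₁ α₀ (-α₁) (-α₀) = 0 := by
  simp only [sumB1]; ring

theorem sumB0_neg {R : Type*} [CommRing R] (A B α₁ α₀ : R) : sumB0 A B α₁ α₀ (-α₁) (-α₀) = 0 := by
  simp only [sumB0]; ring

theorem sumA4_neg {R : Type*} [CommRing R] (A B α₁ α₀ : R) : sumA4 A B α₁ α₀ (-α₁) (-α₀) = 0 := by
  simp only [sumA4]; ring
set_option maxHeartbeats 4000000 in
set_option maxRecDepth 100000 in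
-- For a line and its flip all coefficients of S but those of x³, x², x, 1 vanish. The cubic
-- coefficient is minus the discriminant of the three abscissas on the line, so S is then a genuine
-- cubic in x.
theorem sumA3_neg {R : Type*} [CommRing R] (x₁ x₂ l n x₃ A B : R)
    (hx : x₃ = l ^ 2 - x₁ - x₂) (hA : A = x₁ * x₂ + (x₁ + x₂) * x₃ + 2 * l * n)
    (hB : B = n ^ 2 - x₁ * x₂ * x₃) :
    sumA3 A B l n (-l) (-n) = -((x₁ - x₂) * (x₁ - x₃) * (x₂ - x₃)) ^ 2 := by
  simp only [sumA3]
  subst hA hB hx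
  ring

set_option maxHeartbeats 4000000 in
set_option maxRecDepth 100000 in
-- The denominator of the tripling formula is, up to the factor 3, the norm of the 3-division
-- polynomial over the three points of the line.
theorem triD_identity {F : Type*} [Field F] (h3 : (3 : F) ≠ 0) (x₁ x₂ l n x₃ A B : F)
    (hx : x₃ = l ^ 2 - x₁ - x₂) (hA : A = x₁ * x₂ + (x₁ + x₂) * x₃ + 2 * l * n)
    (hB : B = n ^ 2 - x₁ * x₂ * x₃) :
    3 * triD A B l n = (3 * x₁ ^ 4 + 6 * A * x₁ ^ 2 + 12 * B * x₁ - A ^ 2) *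
      (3 * x₂ ^ 4 + 6 * A * x₂ ^ 2 + 12 * B * x₂ - A ^ 2) *
      (3 * x₃ ^ 4 + 6 * A * x₃ ^ 2 + 12 * B * x₃ - A ^ 2) := by
  simp only [triD]
  field_simp
  subst hA hB hx
  ring

set_option maxHeartbeats 4000000 in
set_option maxRecDepth 100000 in
-- The curve is parametrised by x, the tangent slope l and t = y / (l² - 3x). Since x(2P) - x(P) =
-- l² - 3x, the chord through P and 2P has the polynomial slope -l - 2t, and no denominators remain
-- except 3.
theorem triple_identity {F : Type*} [Field F] (h3 : (3 : F) ≠ 0) (x l t y A B X X₃ α₁ α₀ : F)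
    (hy : y = t * (l ^ 2 - 3 * x)) (hA : A = 2 * y * l - 3 * x ^ 2)
    (hB : B = y ^ 2 - x ^ 3 - A * x) (hX : X = l ^ 2 - 2 * x)
    (hX₃ : X₃ = (-l - 2 * t) ^ 2 - x - X) (h1 : α₀ = y - α₁ * x) :
    triV1 A B α₁ α₀ * X₃ + triV0 A B α₁ α₀ =
      -((-l - 2 * t) * (X₃ - x) + y) * triD A B α₁ α₀ := by
  simp only [triV1, triV0, triD]
  field_simp
  subst h1 hX₃ hX hB hA hy
  ring

set_option maxHeartbeats 1000000 in
/-- The value of `S` at the negative of a point `(X, z / 2)` of the curve, up to a constant factor,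
in terms of the slopes `a`, `b` of the two lines, of `p`, `q` such that their values at `X` are
`p + z / 2`, `q + z / 2`, of `c = f'(X)` and of `e = 3 X`. -/
def sumValue {R : Type*} [CommRing R] (a p b q z c e : R) : R :=
  (b ^ 3 * p + a ^ 3 * q - a ^ 3 * b * e + 2 * a ^ 2 * b ^ 2 * e - 2 * a ^ 2 * b * q + a ^ 2 *
    b * p - a * b ^ 3 * e + a * b ^ 2 * q - 2 * a * b ^ 2 * p) * z ^ 4 + (-q ^ 3 - p ^ 3 - 3 *
    p ^ 2 * q - 3 * p * q ^ 2 + b ^ 3 * p ^ 2 + b ^ 3 * c * e - b ^ 2 * e ^ 2 * q - b ^ 2 * c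
    * q - b ^ 2 * c * p + 2 * b * e * q ^ 2 - b * e * p ^ 2 + b * e * p * q + a ^ 3 * q ^ 2 +
    a ^ 3 * c * e - a ^ 3 * b * e * q - a ^ 2 * e ^ 2 * p - a ^ 2 * c * q - a ^ 2 * c * p + a
    ^ 2 * b ^ 2 * e * q + a ^ 2 * b ^ 2 * e * p - a ^ 2 * b * q ^ 2 - a ^ 2 * b * c * e - a *
    e * q ^ 2 + 2 * a * e * p ^ 2 + a * e * p * q - a * b ^ 3 * e * p - a * b ^ 2 * p ^ 2 - a
    * b ^ 2 * c * e + a * b * e ^ 2 * q + a * b * e ^ 2 * p + 2 * a * b * c * q + 2 * a * b *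
    c * p) * z ^ 3 + (-3 * p ^ 3 * q - 6 * p ^ 2 * q ^ 2 - 3 * p * q ^ 3 + e ^ 3 * p * q - c *
    e * q ^ 2 - c * e * p ^ 2 - 2 * c * e * p * q + b ^ 3 * c * e * p - b ^ 2 * e ^ 2 * p * q
    - b ^ 2 * c ^ 2 * e - 4 * b ^ 2 * c * p * q + b * e * p ^ 2 * q + 4 * b * e * p * q ^ 2 +
    b * c * e ^ 2 * q - b * c * e ^ 2 * p + a ^ 3 * c * e * q + a ^ 3 * b * c ^ 2 - a ^ 2 * e
    ^ 2 * p * q - a ^ 2 * c ^ 2 * e - 4 * a ^ 2 * c * p * q + a ^ 2 * b ^ 2 * e * p * q - 2 *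
    a ^ 2 * b ^ 2 * c ^ 2 - a ^ 2 * b * p * q ^ 2 - a ^ 2 * b * c * e * q + 4 * a * e * p ^ 2
    * q + a * e * p * q ^ 2 - a * c * e ^ 2 * q + a * c * e ^ 2 * p + a * b ^ 3 * c ^ 2 - a *
    b ^ 2 * p ^ 2 * q - a * b ^ 2 * c * e * p + 2 * a * b * c ^ 2 * e + 8 * a * b * c * p * q)
    * z ^ 2 + (-3 * p ^ 3 * q ^ 2 - 3 * p ^ 2 * q ^ 3 + c * e * p ^ 2 * q + c * e * p * q ^ 2
    - b ^ 3 * c ^ 3 + b ^ 2 * c ^ 2 * e * q - 3 * b ^ 2 * c * p ^ 2 * q + 2 * b * e * p ^ 2 *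
    q ^ 2 - b * c ^ 2 * q ^ 2 - b * c ^ 2 * p * q - a ^ 3 * c ^ 3 + a ^ 3 * b * c ^ 2 * q + a
    ^ 2 * c ^ 2 * e * p - 3 * a ^ 2 * c * p * q ^ 2 - a ^ 2 * b ^ 2 * c ^ 2 * q - a ^ 2 * b ^
    2 * c ^ 2 * p + a ^ 2 * b * c ^ 3 + 2 * a * e * p ^ 2 * q ^ 2 - a * c ^ 2 * p ^ 2 - a * c
    ^ 2 * p * q + a * b ^ 3 * c ^ 2 * p + a * b ^ 2 * c ^ 3 - a * b * c ^ 2 * e * q - a * b *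
    c ^ 2 * e * p + 2 * a * b * c * p ^ 2 * q + 2 * a * b * c * p * q ^ 2) * z + (-p ^ 3 * q ^
    3 + c ^ 3 * q ^ 2 + c ^ 3 * p ^ 2 + 2 * c ^ 3 * p * q - c ^ 2 * e ^ 2 * p * q + 2 * c * e
    * p ^ 2 * q ^ 2 - b ^ 3 * c ^ 3 * p + b ^ 2 * c ^ 4 + b ^ 2 * c ^ 2 * e * p * q - b * c ^
    3 * e * q + b * c ^ 3 * e * p - 3 * b * c ^ 2 * p ^ 2 * q - b * c ^ 2 * p * q ^ 2 - a ^ 3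
    * c ^ 3 * q + a ^ 2 * c ^ 4 + a ^ 2 * c ^ 2 * e * p * q - a ^ 2 * b ^ 2 * c ^ 2 * p * q +
    a ^ 2 * b * c ^ 3 * q + a * c ^ 3 * e * q - a * c ^ 3 * e * p - a * c ^ 2 * p ^ 2 * q - 3
    * a * c ^ 2 * p * q ^ 2 + a * b ^ 2 * c ^ 3 * p - 2 * a * b * c ^ 4 + 2 * a * b * c * p ^
    2 * q ^ 2)

set_option maxHeartbeats 4000000 in
set_option maxRecDepth 100000 in
-- Recentring at the point of evaluation: A and B are replaced by the derivative c of the cubic at X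
-- and the ordinate, and the lines by their slopes and their offsets p, q at X. This splits the
-- large verification of `sum_identity` into two expansions.
theorem sum_eq_sumValue {R : Type*} [CommRing R] (X Y A B α₁ α₀ β₁ β₀ p q c : R)
    (hc : A = c - 3 * X ^ 2) (hB : B = Y ^ 2 - c * X + 2 * X ^ 3) (hp : α₀ = Y + p - α₁ * X)
    (hq : β₀ = Y + q - β₁ * X) :
    sumA4 A B α₁ α₀ β₁ β₀ * X ^ 4 + sumA3 A B α₁ α₀ β₁ β₀ * X ^ 3 +
      sumA2 A B α₁ α₀ β₁ β₀ * X ^ 2 + sumA1 A B α₁ α₀ β₁ β₀ * X + sumA0 A B α₁ α₀ β₁ β₀ -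
      Y * (sumB3 A B α₁ α₀ β₁ β₀ * X ^ 3 + sumB2 A B α₁ α₀ β₁ β₀ * X ^ 2 +
        sumB1 A B α₁ α₀ β₁ β₀ * X + sumB0 A B α₁ α₀ β₁ β₀) =
      sumValue α₁ p β₁ q (2 * Y) c (3 * X) := by
  subst hp hq hc hB
  simp only [sumA4, sumA3, sumA2, sumA1, sumA0, sumB3, sumB2, sumB1, sumB0, sumValue]
  ring

set_option maxHeartbeats 4000000 in
set_option maxRecDepth 100000 in
-- Here u and v are the distances of the abscissas of the two summands from that of their sum, and l
-- is the slope of the chord. Lines through the summands with slopes a + l, b + l have offsets -au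
-- and -bv from the chord at the third point.
theorem sumValue_eq_zero {R : Type*} [CommRing R] (a b l z u v : R) :
    sumValue (a + l) (-(a * u)) (b + l) (-(b * v)) z (l * z + u * v)
      (l ^ 2 - u - v) = 0 := by
  simp only [sumValue]
  ring

theorem sum_identity {R : Type*} [CommRing R] (x₁ x₂ l n a b x₃ A B α₁ α₀ β₁ β₀ : R)
    (hx : x₃ = l ^ 2 - x₁ - x₂) (hA : A = x₁ * x₂ + (x₁ + x₂) * x₃ + 2 * l * n)
    (hB : B = n ^ 2 - x₁ * x₂ * x₃) (h1 : α₁ = a + l) (h2 : α₀ = n - a * x₁) (h3 : β₁ = b + l)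
    (h4 : β₀ = n - b * x₂) :
    sumA4 A B α₁ α₀ β₁ β₀ * x₃ ^ 4 + sumA3 A B α₁ α₀ β₁ β₀ * x₃ ^ 3 +
      sumA2 A B α₁ α₀ β₁ β₀ * x₃ ^ 2 + sumA1 A B α₁ α₀ β₁ β₀ * x₃ + sumA0 A B α₁ α₀ β₁ β₀ -
      (l * x₃ + n) * (sumB3 A B α₁ α₀ β₁ β₀ * x₃ ^ 3 + sumB2 A B α₁ α₀ β₁ β₀ * x₃ ^ 2 +
        sumB1 A B α₁ α₀ β₁ β₀ * x₃ + sumB0 A B α₁ α₀ β₁ β₀) = 0 := by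
  have hl : l ^ 2 = x₁ + x₂ + x₃ := by rw [hx]; ring
  rw [sum_eq_sumValue x₃ (l * x₃ + n) A B α₁ α₀ β₁ β₀ (-(a * (x₁ - x₃)))
    (-(b * (x₂ - x₃))) (l * (2 * (l * x₃ + n)) + (x₁ - x₃) * (x₂ - x₃))
    (by rw [hA]; linear_combination (-2 * x₃) * hl)
    (by rw [hB]; linear_combination (x₃ ^ 2) * hl) (by rw [h2, h1]; ring) (by rw [h4, h3]; ring),
    h1, h3, show 3 * x₃ = l ^ 2 - (x₁ - x₃) - (x₂ - x₃) by rw [hl]; ring]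
  exact sumValue_eq_zero a b l (2 * (l * x₃ + n)) (x₁ - x₃) (x₂ - x₃)

/-- The `x`-coordinate of a point, with value `0` at infinity. -/
def xCoord {F K : Type*} [Field F] [Field K] [Algebra F K] {A B : F} : CurvePoint K A B → K
  | .zero => 0
  | .some x _ _ => x

/-- The `y`-coordinate of a point, with value `0` at infinity. -/
def yCoord {F K : Type*} [Field F] [Field K] [Algebra F K] {A B : F} : CurvePoint K A B → K
  | .zero => 0
  | .some _ y _ => y

/-! ### From points of the curve to coordinate functions on ℤ/p -/

section Points

variable {F K : Type*} [Field F] [Field K] [Algebra F K] {A B : F}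

theorem curvePoint_equation {x y : K}
    (h : ((shortCurve A B).baseChange K).toAffine.Nonsingular x y) :
    y ^ 2 = x ^ 3 + algebraMap F K A * x + algebraMap F K B := by
  have := (WeierstrassCurve.Affine.equation_iff _ _).mp h.1
  simpa [shortCurve] using this

theorem curvePoint_neg_some {x y : K}
    (h : ((shortCurve A B).baseChange K).toAffine.Nonsingular x y) :
    ∃ h', -(WeierstrassCurve.Affine.Point.some x y h : CurvePoint K A B) =
      WeierstrassCurve.Affine.Point.some x (-y) h' := by
  have e : ((shortCurve A B).baseChange K).toAffine.negY x y = -y := by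
    simp [WeierstrassCurve.Affine.negY, shortCurve]
  have h2 := (WeierstrassCurve.Affine.nonsingular_neg x y).mpr h
  rw [e] at h2
  refine ⟨h2, ?_⟩
  rw [WeierstrassCurve.Affine.Point.neg_some]
  congr 1

/-- The coordinates `θ u`, `η u` of the multiples `uP`, `u ∈ ℤ/p`, of a generator `P` of the
trace-zero subgroup, with the laws of the group law that the algorithms depend on. -/
structure TraceCoords [Fintype F] (A B : F) {p : ℕ} [Fact p.Prime] (s : ZMod p) (θ η : ZMod p → K) :
    Prop where
  two_ne : (2 : F) ≠ 0
  three_ne : (3 : F) ≠ 0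
  finrank_eq : Module.finrank F K = 3
  large : 10 ^ 6 < p
  quad : s ^ 2 + s + 1 = 0
  equation : ∀ u, u ≠ 0 → η u ^ 2 = θ u ^ 3 + algebraMap F K A * θ u + algebraMap F K B
  x_mul : ∀ u, u ≠ 0 → θ (s * u) = FiniteField.frobeniusAlgHom F K (θ u)
  y_mul : ∀ u, u ≠ 0 → η (s * u) = FiniteField.frobeniusAlgHom F K (η u)
  x_neg : ∀ u, u ≠ 0 → θ (-u) = θ u
  y_neg : ∀ u, u ≠ 0 → η (-u) = -η u
  y_ne : ∀ u, u ≠ 0 → η u ≠ 0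
  eq_or_eq_neg : ∀ u v, u ≠ 0 → v ≠ 0 → θ u = θ v → u = v ∨ u = -v
  add : ∀ u v l, u ≠ 0 → v ≠ 0 → θ u ≠ θ v → η u - η v = l * (θ u - θ v) →
    θ (u + v) = l ^ 2 - θ u - θ v ∧ η (u + v) = -(l * (θ (u + v) - θ u) + η u)
  add_self : ∀ u l, u ≠ 0 → 3 * θ u ^ 2 + algebraMap F K A = l * (2 * η u) →
    θ (u + u) = l ^ 2 - θ u - θ u ∧ η (u + u) = -(l * (θ (u + u) - θ u) + η u)

variable [DecidableEq K]

theorem curvePoint_add_some {x₁ y₁ x₂ y₂ l : K}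
    (h₁ : ((shortCurve A B).baseChange K).toAffine.Nonsingular x₁ y₁)
    (h₂ : ((shortCurve A B).baseChange K).toAffine.Nonsingular x₂ y₂) (hx : x₁ ≠ x₂)
    (hl : y₁ - y₂ = l * (x₁ - x₂)) :
    ∃ h', (WeierstrassCurve.Affine.Point.some x₁ y₁ h₁ : CurvePoint K A B) +
      WeierstrassCurve.Affine.Point.some x₂ y₂ h₂ =
      WeierstrassCurve.Affine.Point.some (l ^ 2 - x₁ - x₂)
        (-(l * (l ^ 2 - x₁ - x₂ - x₁) + y₁)) h' := by
  have e := WeierstrassCurve.Affine.slope_of_X_ne (W := ((shortCurve A B).baseChange K).toAffine)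
    (y₁ := y₁) (y₂ := y₂) hx
  have e' : (y₁ - y₂) / (x₁ - x₂) = l := by rw [hl, mul_div_cancel_right₀ _ (sub_ne_zero.mpr hx)]
  rw [e'] at e
  have h3 := WeierstrassCurve.Affine.Point.add_of_X_ne (h₁ := h₁) (h₂ := h₂) hx
  have hX : ((shortCurve A B).baseChange K).toAffine.addX x₁ x₂ l = l ^ 2 - x₁ - x₂ := by
    simp [WeierstrassCurve.Affine.addX, shortCurve]
  have hY : ((shortCurve A B).baseChange K).toAffine.addY x₁ x₂ y₁ l =
      -(l * (l ^ 2 - x₁ - x₂ - x₁) + y₁) := by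
    simp [WeierstrassCurve.Affine.addY, WeierstrassCurve.Affine.negY,
      WeierstrassCurve.Affine.negAddY, WeierstrassCurve.Affine.addX, shortCurve]
  have h4 := WeierstrassCurve.Affine.nonsingular_add h₁ h₂ (fun h => hx h.1)
  rw [e, hX, hY] at h4
  refine ⟨h4, h3.trans ?_⟩
  simp only [e]
  congr 1

theorem curvePoint_add_self {x y l : K}
    (h : ((shortCurve A B).baseChange K).toAffine.Nonsingular x y) (hy : 2 * y ≠ 0)
    (hl : 3 * x ^ 2 + algebraMap F K A = l * (2 * y)) :
    ∃ h', (WeierstrassCurve.Affine.Point.some x y h : CurvePoint K A B) +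
      WeierstrassCurve.Affine.Point.some x y h =
      WeierstrassCurve.Affine.Point.some (l ^ 2 - x - x)
        (-(l * (l ^ 2 - x - x - x) + y)) h' := by
  have hn : y ≠ ((shortCurve A B).baseChange K).toAffine.negY x y := by
    intro hh
    apply hy
    simp [WeierstrassCurve.Affine.negY, shortCurve] at hh
    linear_combination hh
  have e := WeierstrassCurve.Affine.slope_of_Y_ne (W := ((shortCurve A B).baseChange K).toAffine)
    rfl hn
  have e' : ((shortCurve A B).baseChange K).toAffine.slope x x y y = l := by
    rw [e, div_eq_iff]
    · simp [WeierstrassCurve.Affine.negY, shortCurve]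
      linear_combination hl
    · simp [WeierstrassCurve.Affine.negY, shortCurve]
      intro hh; apply hy; linear_combination hh
  have h3 := WeierstrassCurve.Affine.Point.add_self_of_Y_ne (h₁ := h) hn
  have hX : ((shortCurve A B).baseChange K).toAffine.addX x x l = l ^ 2 - x - x := by
    simp [WeierstrassCurve.Affine.addX, shortCurve]
  have hY : ((shortCurve A B).baseChange K).toAffine.addY x x y l =
      -(l * (l ^ 2 - x - x - x) + y) := by
    simp [WeierstrassCurve.Affine.addY, WeierstrassCurve.Affine.negY,
      WeierstrassCurve.Affine.negAddY, WeierstrassCurve.Affine.addX, shortCurve]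
  have h4 := WeierstrassCurve.Affine.nonsingular_add h h (fun h => hn h.2)
  rw [e', hX, hY] at h4
  refine ⟨h4, h3.trans ?_⟩
  simp only [e']
  congr 1

variable [Fintype F]

theorem frobPoint_some {x y : K}
    (h : ((shortCurve A B).baseChange K).toAffine.Nonsingular x y) :
    ∃ h', frobPoint A B (WeierstrassCurve.Affine.Point.some x y h : CurvePoint K A B) =
      WeierstrassCurve.Affine.Point.some (FiniteField.frobeniusAlgHom F K x)
        (FiniteField.frobeniusAlgHom F K y) h' :=
  ⟨_, WeierstrassCurve.Affine.Point.map_some _ h⟩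

/-- The line has coefficients in F, so Frobenius carries an incidence with Q to one with φ(Q) and
φ²(Q). -/
theorem isTraceLine_iff {l : TLine F} {Q : CurvePoint K A B} (hQ : Q ≠ 0) :
    IsTraceLine l Q ↔
      yCoord Q = algebraMap F K l.slope * xCoord Q + algebraMap F K l.icept := by
  match Q, hQ with
  | .zero, hQ => exact absurd rfl hQ
  | .some x y h, _ =>
    have key : ∀ (x y : K) (h), y = algebraMap F K l.slope * x + algebraMap F K l.icept →
        l.Passes (frobPoint A B (.some x y h : CurvePoint K A B)) := by
      intro x y h e
      obtain ⟨h', e'⟩ := frobPoint_some h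
      rw [e']
      have := congrArg (FiniteField.frobeniusAlgHom F K) e
      rw [map_add, map_mul, AlgHom.commutes, AlgHom.commutes] at this
      exact this
    refine ⟨fun H => H.1, fun H => ⟨H, key x y h H, ?_⟩⟩
    have h1 := key x y h H
    obtain ⟨h', e'⟩ := frobPoint_some h
    rw [e'] at h1 ⊢
    exact key _ _ _ h1

theorem traceCoords (hchar2 : ringChar F ≠ 2) (hchar3 : ringChar F ≠ 3)
    (hdeg : Module.finrank F K = 3)
    (p : ℕ) [Fact p.Prime] (hp : 10 ^ 6 < p)
    (P : CurvePoint K A B) (hgen : AddSubgroup.zmultiples P = traceZero K A B)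
    (hcard : Nat.card (traceZero K A B) = p)
    (s : ZMod p) (hs : frobPoint A B P = s.val • P) :
    (∀ u : ZMod p, u ≠ 0 → u.val • P ≠ 0) ∧
    TraceCoords A B s (fun u => xCoord (u.val • P)) (fun u => yCoord (u.val • P)) := by
  have hord : addOrderOf P = p := by rw [← hcard, ← hgen, Nat.card_zmultiples]
  have hmod : ∀ n : ℕ, (n % p) • P = n • P := fun n => by
    have := mod_addOrderOf_nsmul P n
    rwa [hord] at this
  have hadd : ∀ u v : ZMod p, (u + v).val • P = u.val • P + v.val • P := by
    intro u v
    rw [ZMod.val_add, hmod, add_nsmul]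
  have hmul : ∀ u v : ZMod p, (u * v).val • P = v.val • u.val • P := by
    intro u v
    rw [ZMod.val_mul]
    rw [hmod, mul_nsmul]
  have hzero : ∀ u : ZMod p, u.val • P = 0 → u = 0 := by
    intro u hu
    have := addOrderOf_dvd_of_nsmul_eq_zero hu
    rw [hord] at this
    exact (ZMod.val_eq_zero u).mp (Nat.eq_zero_of_dvd_of_lt this (ZMod.val_lt u))
  have hneg : ∀ u : ZMod p, (-u).val • P = -(u.val • P) := by
    intro u
    rw [eq_neg_iff_add_eq_zero, ← hadd, neg_add_cancel, ZMod.val_zero, zero_nsmul]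
  have hinj : ∀ u v : ZMod p, u.val • P = v.val • P → u = v := by
    intro u v h
    have : (u + -v).val • P = 0 := by rw [hadd, hneg, h, add_neg_cancel]
    have := hzero _ this
    linear_combination this
  have hfrob : ∀ u : ZMod p, (s * u).val • P = frobPoint A B (u.val • P) := by
    intro u
    rw [hmul, map_nsmul, hs]
  have h2 : (2 : F) ≠ 0 := by
    intro h
    have : ((2 : ℕ) : F) = 0 := by exact_mod_cast h
    rw [ringChar.spec] at this
    rcases (Nat.dvd_prime Nat.prime_two).mp this with h | h
    · exact CharP.ringChar_ne_one h
    · exact hchar2 h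
  have h3 : (3 : F) ≠ 0 := by
    intro h
    have : ((3 : ℕ) : F) = 0 := by exact_mod_cast h
    rw [ringChar.spec] at this
    rcases (Nat.dvd_prime Nat.prime_three).mp this with h | h
    · exact CharP.ringChar_ne_one h
    · exact hchar3 h
  have hne : ∀ u : ZMod p, u ≠ 0 → u.val • P ≠ 0 := fun u hu h => hu (hzero u h)
  have hpt : ∀ u : ZMod p, u ≠ 0 → ∃ h, u.val • P = WeierstrassCurve.Affine.Point.some
      (xCoord (u.val • P)) (yCoord (u.val • P)) h := by
    intro u hu
    have := hne u hu
    generalize u.val • P = Q at this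
    match Q, this with
    | .zero, h => exact absurd rfl h
    | .some x y h, _ => exact ⟨h, rfl⟩
  have h2p : (2 : ZMod p) ≠ 0 := by
    intro h
    have : ((2 : ℕ) : ZMod p) = 0 := by exact_mod_cast h
    rw [ZMod.natCast_eq_zero_iff] at this
    have := Nat.le_of_dvd (by norm_num) this
    omega
  -- A vanishing ordinate would make uP equal to its negative, which is impossible in a group of odd
  -- prime order.
  have hy0 : ∀ u : ZMod p, u ≠ 0 → yCoord (u.val • P) ≠ 0 := by
    intro u hu h0
    obtain ⟨h, e⟩ := hpt u hu
    obtain ⟨h', e'⟩ := curvePoint_neg_some h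
    have : (-u).val • P = u.val • P := by
      rw [hneg]
      conv_lhs => rw [e]
      conv_rhs => rw [e]
      rw [e']
      congr 1
      rw [h0, neg_zero]
    have := hinj _ _ this
    have : 2 * u = 0 := by linear_combination -this
    rcases mul_eq_zero.mp this with h | h
    · exact h2p h
    · exact hu h
  refine ⟨hne, h2, h3, hdeg, hp, ?_, ?_, ?_, ?_, ?_, ?_, hy0, ?_, ?_, ?_⟩
  -- The relation s² + s + 1 = 0 holds because this multiple of P is P + φ(P) + φ²(P).
  · apply hzero
    have hP : P ∈ traceZero K A B := by rw [← hgen]; exact AddSubgroup.mem_zmultiples P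
    have h1 : (1 : ZMod p).val • P = P := by
      rw [ZMod.val_one_eq_one_mod, Nat.mod_eq_of_lt (by omega), one_nsmul]
    rw [hadd, hadd, pow_two, hfrob]
    have e2 : s.val • P = frobPoint A B P := hs.symm
    rw [e2, h1]
    have : P + frobPoint A B P + frobPoint A B (frobPoint A B P) = 0 := hP
    rw [← this]
    abel
  · intro u hu
    obtain ⟨h, e⟩ := hpt u hu
    exact curvePoint_equation h
  · intro u hu
    obtain ⟨h, e⟩ := hpt u hu
    obtain ⟨h', e'⟩ := frobPoint_some h
    simp only [hfrob]
    conv_lhs => rw [e, e']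
    rfl
  · intro u hu
    obtain ⟨h, e⟩ := hpt u hu
    obtain ⟨h', e'⟩ := frobPoint_some h
    simp only [hfrob]
    conv_lhs => rw [e, e']
    rfl
  · intro u hu
    obtain ⟨h, e⟩ := hpt u hu
    obtain ⟨h', e'⟩ := curvePoint_neg_some h
    simp only [hneg]
    conv_lhs => rw [e, e']
    rfl
  · intro u hu
    obtain ⟨h, e⟩ := hpt u hu
    obtain ⟨h', e'⟩ := curvePoint_neg_some h
    simp only [hneg]
    conv_lhs => rw [e, e']
    rfl
  · intro u v hu hv huv
    obtain ⟨h, e⟩ := hpt u hu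
    obtain ⟨h', e'⟩ := hpt v hv
    obtain ⟨h'', e''⟩ := curvePoint_neg_some h'
    have q1 := curvePoint_equation h
    have q2 := curvePoint_equation h'
    have : (yCoord (u.val • P) - yCoord (v.val • P)) * (yCoord (u.val • P) + yCoord (v.val • P))
        = 0 := by
      rw [huv] at q1
      linear_combination q1 - q2
    rcases mul_eq_zero.mp this with h0 | h0
    · left
      apply hinj
      rw [e, e']
      congr 1
      linear_combination h0
    · right
      apply hinj
      rw [hneg, e, e', e'']
      congr 1
      linear_combination h0
  · intro u v l hu hv huv hl
    obtain ⟨h, e⟩ := hpt u hu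
    obtain ⟨h', e'⟩ := hpt v hv
    obtain ⟨h3, e3⟩ := curvePoint_add_some h h' huv hl
    have : (u + v).val • P = _ := ((hadd u v).trans (congrArg₂ (· + ·) e e')).trans e3
    constructor
    · show xCoord ((u + v).val • P) = _
      rw [this]; rfl
    · show yCoord ((u + v).val • P) = -(l * (xCoord ((u + v).val • P) - _) + _)
      rw [this]; rfl
  · intro u l hu hl
    obtain ⟨h, e⟩ := hpt u hu
    have h2K : (2 : K) ≠ 0 := by
      rw [← map_ofNat (algebraMap F K) 2]
      exact (_root_.map_ne_zero _).mpr h2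
    obtain ⟨h3, e3⟩ := curvePoint_add_self h (mul_ne_zero h2K (hy0 u hu)) hl
    have : (u + u).val • P = _ := ((hadd u u).trans (congrArg₂ (· + ·) e e)).trans e3
    constructor
    · show xCoord ((u + u).val • P) = _
      rw [this]; rfl
    · show yCoord ((u + u).val • P) = -(l * (xCoord ((u + u).val • P) - _) + _)
      rw [this]; rfl

end Points

/-- The point with coordinates `(θ u, η u)` lies on the line `h = 0`. -/
def OnLine {F K R : Type*} [Field F] [Field K] [Algebra F K] (θ η : R → K) (u : R)
    (h : TLine F) : Prop :=
  η u = algebraMap F K h.slope * θ u + algebraMap F K h.icept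

/-- Subtracting the two curve equations and cancelling x₁ - x₂ gives A, then B follows. This is the
form in which the polynomial identities take their input. -/
theorem secant_parameters {K : Type*} [Field K] {x₁ x₂ y₁ y₂ A B l : K} (hx : x₁ ≠ x₂)
    (h₁ : y₁ ^ 2 = x₁ ^ 3 + A * x₁ + B) (h₂ : y₂ ^ 2 = x₂ ^ 3 + A * x₂ + B)
    (hl : y₁ - y₂ = l * (x₁ - x₂)) :
    A = x₁ * x₂ + (x₁ + x₂) * (l ^ 2 - x₁ - x₂) + 2 * l * (y₁ - l * x₁) ∧
      B = (y₁ - l * x₁) ^ 2 - x₁ * x₂ * (l ^ 2 - x₁ - x₂) := by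
  have hy : y₂ = y₁ - l * (x₁ - x₂) := by linear_combination -hl
  subst hy
  have hA : A = x₁ * x₂ + (x₁ + x₂) * (l ^ 2 - x₁ - x₂) + 2 * l * (y₁ - l * x₁) := by
    apply mul_left_cancel₀ (sub_ne_zero.mpr hx)
    linear_combination h₂ - h₁
  refine ⟨hA, ?_⟩
  linear_combination -h₁ - x₁ * hA

/-! ### Trace lines and minimal polynomials of abscissas -/

namespace TraceCoords

variable {F K : Type*} [Field F] [Fintype F] [Field K] [Algebra F K] {A B : F}
  {p : ℕ} [Fact p.Prime] {s : ZMod p} {θ η : ZMod p → K}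

/-- If u + vs vanished, p would divide the norm u² - uv + v² of u + vω, which is positive and
smaller than p. All nondegeneracy conditions with explicit constants are reduced to this. -/
theorem intCast_add_mul_ne_zero (T : TraceCoords A B s θ η) (u v : ℤ)
    (h0 : 0 < u ^ 2 - u * v + v ^ 2) (h1 : u ^ 2 - u * v + v ^ 2 < 10 ^ 6) :
    (u : ZMod p) + v * s ≠ 0 := by
  intro h
  have h2 : ((u ^ 2 - u * v + v ^ 2 : ℤ) : ZMod p) = 0 := by
    push_cast
    -- The multiplier is the conjugate of u + vω.
    linear_combination (u - v - v * s : ZMod p) * h + v ^ 2 * T.quad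
  rw [ZMod.intCast_zmod_eq_zero_iff_dvd] at h2
  have := Int.le_of_dvd h0 h2
  have := T.large
  omega

theorem two_ne' (T : TraceCoords A B s θ η) : (2 : ZMod p) ≠ 0 := by
  have := T.intCast_add_mul_ne_zero 2 0 (by norm_num) (by norm_num)
  simpa using this

theorem three_ne' (T : TraceCoords A B s θ η) : (3 : ZMod p) ≠ 0 := by
  have := T.intCast_add_mul_ne_zero 3 0 (by norm_num) (by norm_num)
  simpa using this

theorem s_ne_zero (T : TraceCoords A B s θ η) : s ≠ 0 := by
  have := T.intCast_add_mul_ne_zero 0 1 (by norm_num) (by norm_num)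
  simpa using this

theorem s_cube (T : TraceCoords A B s θ η) : s ^ 3 = 1 := by
  linear_combination (s - 1) * T.quad

theorem two_ne_K (T : TraceCoords A B s θ η) : (2 : K) ≠ 0 := by
  rw [← map_ofNat (algebraMap F K) 2]
  exact (_root_.map_ne_zero _).mpr T.two_ne

theorem three_ne_K (T : TraceCoords A B s θ η) : (3 : K) ≠ 0 := by
  rw [← map_ofNat (algebraMap F K) 3]
  exact (_root_.map_ne_zero _).mpr T.three_ne

theorem x_pow (T : TraceCoords A B s θ η) (n : ℕ) {u : ZMod p} (hu : u ≠ 0) :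
    θ (s ^ n * u) = (FiniteField.frobeniusAlgHom F K ^ n) (θ u) := by
  induction n with
  | zero => simp
  | succ n ih =>
    rw [pow_succ', mul_assoc, T.x_mul _ (mul_ne_zero (pow_ne_zero _ T.s_ne_zero) hu), ih, pow_succ']
    rfl

theorem y_pow (T : TraceCoords A B s θ η) (n : ℕ) {u : ZMod p} (hu : u ≠ 0) :
    η (s ^ n * u) = (FiniteField.frobeniusAlgHom F K ^ n) (η u) := by
  induction n with
  | zero => simp
  | succ n ih =>
    rw [pow_succ', mul_assoc, T.y_mul _ (mul_ne_zero (pow_ne_zero _ T.s_ne_zero) hu), ih, pow_succ']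
    rfl

theorem finite (T : TraceCoords A B s θ η) : FiniteDimensional F K :=
  Module.finite_of_finrank_pos (by rw [T.finrank_eq]; norm_num)

theorem isIntegral (T : TraceCoords A B s θ η) (x : K) : IsIntegral F x := by
  have := T.finite
  exact Algebra.IsIntegral.isIntegral x

theorem x_ne_x_mul (T : TraceCoords A B s θ η) {u : ZMod p} (hu : u ≠ 0) : θ (s * u) ≠ θ u := by
  intro h
  rcases T.eq_or_eq_neg _ _ (mul_ne_zero T.s_ne_zero hu) hu h with h | h
  · have h1 := T.intCast_add_mul_ne_zero (-1) 1 (by norm_num) (by norm_num)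
    push_cast at h1
    apply mul_ne_zero h1 hu
    linear_combination h
  · have h1 := T.intCast_add_mul_ne_zero 1 1 (by norm_num) (by norm_num)
    push_cast at h1
    apply mul_ne_zero h1 hu
    linear_combination h

theorem x_notMem (T : TraceCoords A B s θ η) {u : ZMod p} (hu : u ≠ 0) (c : F) :
    algebraMap F K c ≠ θ u := by
  intro h
  apply T.x_ne_x_mul hu
  rw [T.x_mul u hu, ← h, AlgHom.commutes]

theorem eq_zero_of_linear (T : TraceCoords A B s θ η) {u : ZMod p} (hu : u ≠ 0) {a b : F}
    (h : algebraMap F K a * θ u + algebraMap F K b = 0) : a = 0 ∧ b = 0 := by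
  have ha : a = 0 := by
    by_contra ha
    apply T.x_notMem hu (-b / a)
    have : algebraMap F K a ≠ 0 := (_root_.map_ne_zero _).mpr ha
    rw [map_div₀, map_neg, div_eq_iff this]
    linear_combination -h
  subst ha
  simp at h
  exact ⟨rfl, h⟩

theorem onLine_unique (T : TraceCoords A B s θ η) {u : ZMod p} (hu : u ≠ 0) {h k : TLine F}
    (hh : OnLine θ η u h) (hk : OnLine θ η u k) : h = k := by
  obtain ⟨h1, h2⟩ := T.eq_zero_of_linear hu (a := h.slope - k.slope) (b := h.icept - k.icept) (by
    unfold OnLine at hh hk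
    rw [map_sub, map_sub]
    linear_combination hk - hh)
  exact TLine.ext (sub_eq_zero.mp h1) (sub_eq_zero.mp h2)

/-- The Galois group of K over F is generated by Frobenius. -/
theorem exists_of_fixed (T : TraceCoords A B s θ η) {x : K}
    (h : FiniteField.frobeniusAlgHom F K x = x) : ∃ c : F, algebraMap F K c = x := by
  have := T.finite
  have : Finite K := Module.finite_of_finite F
  apply (IsGalois.mem_range_algebraMap_iff_fixed x).mpr
  intro f
  obtain ⟨n, hn⟩ := (FiniteField.bijective_frobeniusAlgEquivOfAlgebraic_pow F K).2 f
  have key : ∀ n : ℕ, (FiniteField.frobeniusAlgEquivOfAlgebraic F K ^ n) x = x := by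
    intro n
    induction n with
    | zero => simp
    | succ n ih =>
      rw [pow_succ, AlgEquiv.mul_apply]
      have : FiniteField.frobeniusAlgEquivOfAlgebraic F K x = x := h
      rw [this, ih]
  rw [← hn]
  exact key n

/-- The chord through uP and φ(uP) meets the curve again at φ²(uP), because the three points sum to
zero. It is therefore also the chord through φ(uP) and φ²(uP), so its slope and intercept are fixed
by Frobenius and lie in F. -/
theorem exists_onLine (T : TraceCoords A B s θ η) {u : ZMod p} (hu : u ≠ 0) :
    ∃ h : TLine F, OnLine θ η u h := by
  have hsu := mul_ne_zero T.s_ne_zero hu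
  have hssu := mul_ne_zero T.s_ne_zero hsu
  have h1 := T.x_ne_x_mul hu
  have h2 := T.x_ne_x_mul hsu
  set l := (η u - η (s * u)) / (θ u - θ (s * u)) with hl
  have hl1 : η u - η (s * u) = l * (θ u - θ (s * u)) := by
    rw [hl, div_mul_cancel₀ _ (sub_ne_zero.mpr h1.symm)]
  obtain ⟨hx, hy⟩ := T.add u (s * u) l hu hsu h1.symm hl1
  have hs : u + s * u = -(s * (s * u)) := by linear_combination u * T.quad
  rw [hs, T.x_neg _ hssu] at hx hy
  rw [T.y_neg _ hssu] at hy
  have hfix : FiniteField.frobeniusAlgHom F K l = l := by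
    have e := congrArg (FiniteField.frobeniusAlgHom F K) hl1
    rw [map_sub, map_mul, map_sub, ← T.x_mul u hu, ← T.y_mul u hu, ← T.x_mul _ hsu,
      ← T.y_mul _ hsu] at e
    apply mul_right_cancel₀ (sub_ne_zero.mpr h2.symm)
    linear_combination -e + hy - hl1
  obtain ⟨c, hc⟩ := T.exists_of_fixed hfix
  have hfix2 : FiniteField.frobeniusAlgHom F K (η u - l * θ u) = η u - l * θ u := by
    rw [map_sub, map_mul, hfix, ← T.x_mul u hu, ← T.y_mul u hu]
    linear_combination -hl1
  obtain ⟨d, hd⟩ := T.exists_of_fixed hfix2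
  refine ⟨⟨c, d⟩, ?_⟩
  unfold OnLine
  simp only [hc, hd]
  ring

theorem onLine_mul (T : TraceCoords A B s θ η) {u : ZMod p} (hu : u ≠ 0) {h : TLine F}
    (hh : OnLine θ η u h) : OnLine θ η (s * u) h := by
  unfold OnLine at *
  rw [T.x_mul u hu, T.y_mul u hu, hh, map_add, map_mul, AlgHom.commutes, AlgHom.commutes]

theorem onLine_pow (T : TraceCoords A B s θ η) (n : ℕ) {u : ZMod p} (hu : u ≠ 0) {h : TLine F}
    (hh : OnLine θ η u h) : OnLine θ η (s ^ n * u) h := by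
  induction n with
  | zero => simpa using hh
  | succ n ih =>
    rw [pow_succ', mul_assoc]
    exact T.onLine_mul (mul_ne_zero (pow_ne_zero _ T.s_ne_zero) hu) ih

theorem onLine_neg (T : TraceCoords A B s θ η) {u : ZMod p} (hu : u ≠ 0) {h : TLine F}
    (hh : OnLine θ η u h) : OnLine θ η (-u) h.flip := by
  unfold OnLine at *
  rw [T.x_neg u hu, T.y_neg u hu, hh]
  simp only [TLine.flip, map_neg]
  ring

theorem minpoly_natDegree (T : TraceCoords A B s θ η) {u : ZMod p} (hu : u ≠ 0) :
    (minpoly F (θ u)).natDegree = 3 := by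
  have h1 := minpoly.degree_dvd (T.isIntegral (θ u))
  rw [T.finrank_eq] at h1
  rcases (Nat.dvd_prime Nat.prime_three).mp h1 with h | h
  · obtain ⟨c, hc⟩ := minpoly.natDegree_eq_one_iff.mp h
    exact absurd hc (T.x_notMem hu c)
  · exact h

/-- Elements with the same minimal polynomial are Galois conjugate, a power of Frobenius multiplies
the index by a power of s, and equal abscissas determine the index up to sign. -/
theorem eq_of_minpoly_eq (T : TraceCoords A B s θ η) {u v : ZMod p} (hu : u ≠ 0) (hv : v ≠ 0)
    (h : minpoly F (θ u) = minpoly F (θ v)) : ∃ n < 3, u = s ^ n * v ∨ u = -(s ^ n * v) := by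
  have := T.finite
  have : Finite K := Module.finite_of_finite F
  obtain ⟨g, hg⟩ := (Normal.minpoly_eq_iff_mem_orbit K).mp h
  obtain ⟨n, hn⟩ := (FiniteField.bijective_frobeniusAlgEquivOfAlgebraic_pow F K).2 g
  have key : ∀ n : ℕ, (FiniteField.frobeniusAlgEquivOfAlgebraic F K ^ n) (θ v) =
      θ (s ^ n * v) := by
    intro n
    induction n with
    | zero => simp
    | succ n ih =>
      rw [pow_succ', AlgEquiv.mul_apply, ih, pow_succ', mul_assoc,
        T.x_mul _ (mul_ne_zero (pow_ne_zero _ T.s_ne_zero) hv)]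
      rfl
  refine ⟨n.1, ?_, ?_⟩
  · exact n.2.trans_eq T.finrank_eq
  · apply T.eq_or_eq_neg _ _ hu (mul_ne_zero (pow_ne_zero _ T.s_ne_zero) hv)
    rw [← key, ← hg, ← hn]
    rfl

theorem minpoly_pow (T : TraceCoords A B s θ η) (n : ℕ) {u : ZMod p} (hu : u ≠ 0) :
    minpoly F (θ (s ^ n * u)) = minpoly F (θ u) := by
  rw [T.x_pow n hu]
  exact minpoly.algHom_eq _ (RingHom.injective _) _

theorem minpoly_neg (T : TraceCoords A B s θ η) {u : ZMod p} (hu : u ≠ 0) :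
    minpoly F (θ (-u)) = minpoly F (θ u) := by
  rw [T.x_neg u hu]

theorem minpoly_irreducible (T : TraceCoords A B s θ η) (u : ZMod p) :
    Irreducible (minpoly F (θ u)) := minpoly.irreducible (T.isIntegral _)

theorem minpoly_monic (T : TraceCoords A B s θ η) (u : ZMod p) :
    (minpoly F (θ u)).Monic := minpoly.monic (T.isIntegral _)

theorem natDegree_monic_cubic {R : Type*} [Field R] (a b c : R) :
    (X ^ 3 + (C a * X ^ 2 + C b * X + C c) : R[X]).natDegree = 3 ∧
    (X ^ 3 + (C a * X ^ 2 + C b * X + C c) : R[X]).Monic := by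
  constructor
  · compute_degree!
  · monicity!

/-- Both sides are monic cubics vanishing at θ(u), and the right-hand side is irreducible. -/
theorem minpoly_eq_of_onLine (T : TraceCoords A B s θ η) {u : ZMod p} (hu : u ≠ 0) {h : TLine F}
    (hh : OnLine θ η u h) :
    cubicF A B - (C h.slope * X + C h.icept) ^ 2 = minpoly F (θ u) := by
  have e : cubicF A B - (C h.slope * X + C h.icept) ^ 2 =
      X ^ 3 + (C (-h.slope ^ 2) * X ^ 2 + C (A - 2 * h.slope * h.icept) * X +
        C (B - h.icept ^ 2)) := by
    simp only [cubicF, map_sub, map_neg, map_mul, map_pow, map_ofNat]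
    ring
  obtain ⟨h1, h2⟩ := natDegree_monic_cubic (-h.slope ^ 2) (A - 2 * h.slope * h.icept)
    (B - h.icept ^ 2)
  rw [← e] at h1 h2
  have h3 : minpoly F (θ u) ∣ cubicF A B - (C h.slope * X + C h.icept) ^ 2 := by
    rw [minpoly.dvd_iff]
    have := T.equation u hu
    unfold OnLine at hh
    rw [hh] at this
    simp only [cubicF, map_sub, map_add, map_mul, map_pow, aeval_X, aeval_C]
    linear_combination -this
  exact (eq_of_monic_of_dvd_of_natDegree_le (T.minpoly_monic u) h2 h3
    (by rw [h1, T.minpoly_natDegree hu]))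

theorem eval_minpoly_ne_zero (T : TraceCoords A B s θ η) {u : ZMod p} (hu : u ≠ 0) (c : F) :
    (minpoly F (θ u)).eval c ≠ 0 := by
  intro h
  have := natDegree_eq_of_degree_eq_some (n := 1)
    (degree_eq_one_of_irreducible_of_root (T.minpoly_irreducible u) h)
  rw [T.minpoly_natDegree hu] at this
  exact absurd this (by norm_num)

theorem eval_cubic_ne_zero (T : TraceCoords A B s θ η) {u : ZMod p} (hu : u ≠ 0) {h : TLine F}
    (hh : OnLine θ η u h) (c : F) :
    c ^ 3 + A * c + B - (h.slope * c + h.icept) ^ 2 ≠ 0 := by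
  have := T.eval_minpoly_ne_zero hu c
  rw [← T.minpoly_eq_of_onLine hu hh] at this
  simpa [cubicF] using this

/-- Equal lines give equal minimal polynomials, so only the sign is in doubt. With the minus sign
the line would coincide with its flip and hence be y = 0, but no ordinate vanishes. -/
theorem eq_of_onLine (T : TraceCoords A B s θ η) {u v : ZMod p} (hu : u ≠ 0) (hv : v ≠ 0)
    {h : TLine F} (hh : OnLine θ η u h) (hk : OnLine θ η v h) : ∃ n < 3, u = s ^ n * v := by
  obtain ⟨n, hn, h1 | h1⟩ := T.eq_of_minpoly_eq hu hv
    ((T.minpoly_eq_of_onLine hu hh).symm.trans (T.minpoly_eq_of_onLine hv hk))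
  · exact ⟨n, hn, h1⟩
  · exfalso
    have hw := mul_ne_zero (pow_ne_zero n T.s_ne_zero) hv
    have h2 := T.onLine_neg hw (T.onLine_pow n hv hk)
    rw [← h1] at h2
    have h3 := T.onLine_unique hu hh h2
    have h4 := T.y_ne u hu
    unfold OnLine at hh
    have e1 := congrArg TLine.slope h3
    have e2 := congrArg TLine.icept h3
    simp only [TLine.flip] at e1 e2
    have e1' : h.slope = 0 := by
      have : 2 * h.slope = 0 := by linear_combination e1
      exact (mul_eq_zero.mp this).resolve_left T.two_ne
    have e2' : h.icept = 0 := by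
      have : 2 * h.icept = 0 := by linear_combination e2
      exact (mul_eq_zero.mp this).resolve_left T.two_ne
    apply h4
    rw [hh, e1', e2']
    simp

end TraceCoords

/-! ### Correctness of doubling, tripling and of the function S -/

section Map

variable {F K : Type*} [Field F] [Field K] (f : F →+* K) (A B α₁ α₀ β₁ β₀ : F)

theorem map_dblU1 : f (dblU1 A B α₁ α₀) = dblU1 (f A) (f B) (f α₁) (f α₀) := by simp [dblU1, _root_.map_ofNat]
theorem map_dblU0 : f (dblU0 A B α₁ α₀) = dblU0 (f A) (f B) (f α₁) (f α₀) := by simp [dblU0, _root_.map_ofNat]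
theorem map_dblC : f (dblC A B α₁ α₀) = dblC (f A) (f B) (f α₁) (f α₀) := by simp [dblC, _root_.map_ofNat]
theorem map_triV1 : f (triV1 A B α₁ α₀) = triV1 (f A) (f B) (f α₁) (f α₀) := by simp [triV1, _root_.map_ofNat]
theorem map_triV0 : f (triV0 A B α₁ α₀) = triV0 (f A) (f B) (f α₁) (f α₀) := by simp [triV0, _root_.map_ofNat]
theorem map_triD : f (triD A B α₁ α₀) = triD (f A) (f B) (f α₁) (f α₀) := by simp [triD, _root_.map_ofNat]
theorem map_sumA4 : f (sumA4 A B α₁ α₀ β₁ β₀) = sumA4 (f A) (f B) (f α₁) (f α₀) (f β₁) (f β₀) := by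
  simp [sumA4, _root_.map_ofNat]
theorem map_sumA3 : f (sumA3 A B α₁ α₀ β₁ β₀) = sumA3 (f A) (f B) (f α₁) (f α₀) (f β₁) (f β₀) := by
  simp [sumA3, _root_.map_ofNat]
theorem map_sumA2 : f (sumA2 A B α₁ α₀ β₁ β₀) = sumA2 (f A) (f B) (f α₁) (f α₀) (f β₁) (f β₀) := by
  simp [sumA2, _root_.map_ofNat]
theorem map_sumA1 : f (sumA1 A B α₁ α₀ β₁ β₀) = sumA1 (f A) (f B) (f α₁) (f α₀) (f β₁) (f β₀) := by
  simp [sumA1, _root_.map_ofNat]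
theorem map_sumA0 : f (sumA0 A B α₁ α₀ β₁ β₀) = sumA0 (f A) (f B) (f α₁) (f α₀) (f β₁) (f β₀) := by
  simp [sumA0, _root_.map_ofNat]
theorem map_sumB3 : f (sumB3 A B α₁ α₀ β₁ β₀) = sumB3 (f A) (f B) (f α₁) (f α₀) (f β₁) (f β₀) := by
  simp [sumB3, _root_.map_ofNat]
theorem map_sumB2 : f (sumB2 A B α₁ α₀ β₁ β₀) = sumB2 (f A) (f B) (f α₁) (f α₀) (f β₁) (f β₀) := by
  simp [sumB2, _root_.map_ofNat]
theorem map_sumB1 : f (sumB1 A B α₁ α₀ β₁ β₀) = sumB1 (f A) (f B) (f α₁) (f α₀) (f β₁) (f β₀) := by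
  simp [sumB1, _root_.map_ofNat]
theorem map_sumB0 : f (sumB0 A B α₁ α₀ β₁ β₀) = sumB0 (f A) (f B) (f α₁) (f α₀) (f β₁) (f β₀) := by
  simp [sumB0, _root_.map_ofNat]

end Map

theorem sumB3_eq {R : Type*} [CommRing R] (A B α₁ α₀ β₁ β₀ : R) :
    sumB3 A B α₁ α₀ β₁ β₀ = (α₀ + β₀) ^ 3 + A * (α₀ + β₀) * (α₁ + β₁) ^ 2 - B * (α₁ + β₁) ^ 3 +
      (α₁ + β₁) * (β₀ * (α₁ + β₁) - β₁ * (α₀ + β₀)) ^ 2 := by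
  simp only [sumB3]; ring

theorem sPoly_eq {F : Type*} [Field F] (A B : F) (h k : TLine F) : ∃ c : F,
    (sPoly A B h k).fst = C c * (C (sumA4 A B h.slope h.icept k.slope k.icept) * X ^ 4
      + C (sumA3 A B h.slope h.icept k.slope k.icept) * X ^ 3
      + C (sumA2 A B h.slope h.icept k.slope k.icept) * X ^ 2
      + C (sumA1 A B h.slope h.icept k.slope k.icept) * X
      + C (sumA0 A B h.slope h.icept k.slope k.icept)) ∧
    (sPoly A B h k).snd = C c * (C (sumB3 A B h.slope h.icept k.slope k.icept) * X ^ 3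
      + C (sumB2 A B h.slope h.icept k.slope k.icept) * X ^ 2
      + C (sumB1 A B h.slope h.icept k.slope k.icept) * X
      + C (sumB0 A B h.slope h.icept k.slope k.icept)) :=
  ⟨_, rfl, rfl⟩

theorem sPoly_fst_natDegree {F : Type*} [Field F] (A B : F) (g k : TLine F) :
    (sPoly A B g k).fst.natDegree ≤ 4 := by
  obtain ⟨c, h, -⟩ := sPoly_eq A B g k
  rw [h]
  compute_degree!

theorem sPoly_snd_natDegree {F : Type*} [Field F] (A B : F) (g k : TLine F) :
    (sPoly A B g k).snd.natDegree ≤ 3 := by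
  obtain ⟨c, -, h⟩ := sPoly_eq A B g k
  rw [h]
  compute_degree!

namespace TraceCoords

variable {F K : Type*} [Field F] [Fintype F] [Field K] [Algebra F K] {A B : F}
  {p : ℕ} [Fact p.Prime] {s : ZMod p} {θ η : ZMod p → K}

theorem add_self_ne (T : TraceCoords A B s θ η) {u : ZMod p} (hu : u ≠ 0) : u + u ≠ 0 := by
  rw [← two_mul]; exact mul_ne_zero T.two_ne' hu

theorem dblC_ne_zero (T : TraceCoords A B s θ η) {u : ZMod p} (hu : u ≠ 0) {h : TLine F}
    (hh : OnLine θ η u h) : dblC A B h.slope h.icept ≠ 0 := by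
  have h8 : (8 : F) ≠ 0 := by
    have : (8 : F) = 2 ^ 3 := by norm_num
    rw [this]; exact pow_ne_zero _ T.two_ne
  by_cases h1 : h.slope = 0
  · have h0 : h.icept ≠ 0 := by
      intro h0
      unfold OnLine at hh
      apply T.y_ne u hu
      rw [hh, h1, h0]; simp
    intro e
    apply mul_ne_zero h8 (pow_ne_zero 3 h0)
    simp only [dblC] at e
    rw [h1] at e
    linear_combination -e
  · intro e
    -- At the zero of the line the cubic f - h² takes the value f, which is `dblC` up to the factor
    -- 8α₁³.
    apply T.eval_cubic_ne_zero hu hh (-h.icept / h.slope)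
    simp only [dblC] at e
    have : B * h.slope ^ 3 - A * h.slope ^ 2 * h.icept - h.icept ^ 3 = 0 := by
      apply mul_left_cancel₀ h8
      linear_combination e
    field_simp
    linear_combination this

theorem tangent (T : TraceCoords A B s θ η) {u : ZMod p} (hu : u ≠ 0) :
    ∃ l, 3 * θ u ^ 2 + algebraMap F K A = l * (2 * η u) ∧
      θ (u + u) = l ^ 2 - θ u - θ u ∧ η (u + u) = -(l * (θ (u + u) - θ u) + η u) := by
  have h2 := mul_ne_zero T.two_ne_K (T.y_ne u hu)
  have : 3 * θ u ^ 2 + algebraMap F K A =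
      ((3 * θ u ^ 2 + algebraMap F K A) / (2 * η u)) * (2 * η u) := by
    rw [div_mul_cancel₀ _ h2]
  exact ⟨_, this, T.add_self u _ hu this⟩

theorem onLine_double (T : TraceCoords A B s θ η) {u : ZMod p} (hu : u ≠ 0) {h : TLine F}
    (hh : OnLine θ η u h) : OnLine θ η (u + u) (h.double A B) := by
  obtain ⟨l, hl, hx, hy⟩ := T.tangent hu
  have hC := (_root_.map_ne_zero (algebraMap F K)).mpr (T.dblC_ne_zero hu hh)
  have heq := T.equation u hu
  unfold OnLine at *
  have key := double_identity (θ u) l (η u - l * θ u) (algebraMap F K h.slope - l) (θ (u + u))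
    (algebraMap F K A) (algebraMap F K B) (algebraMap F K h.slope) (algebraMap F K h.icept)
    (by linear_combination hx) (by linear_combination hl + 2 * θ u * hx.symm)
    (by linear_combination -heq - θ u * hl + θ u ^ 2 * hx) (by ring) (by linear_combination -hh)
  simp only [TLine.double, map_div₀, map_dblC, map_dblU0, map_dblU1] at hC ⊢
  rw [div_mul_eq_mul_div, ← add_div, eq_div_iff hC]
  linear_combination -key + hy * dblC (algebraMap F K A) (algebraMap F K B)
    (algebraMap F K h.slope) (algebraMap F K h.icept)

theorem x_add_self_ne (T : TraceCoords A B s θ η) {u : ZMod p} (hu : u ≠ 0) :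
    θ u ≠ θ (u + u) := by
  intro h
  rcases T.eq_or_eq_neg _ _ hu (T.add_self_ne hu) h with h | h
  · exact hu (by linear_combination -h)
  · exact mul_ne_zero T.three_ne' hu (by linear_combination h)

/-- The 3-division polynomial equals (2y)²(x(P) - x(2P)), so a zero would force 2P = ±P. -/
theorem psi_ne_zero (T : TraceCoords A B s θ η) {u : ZMod p} (hu : u ≠ 0) :
    3 * θ u ^ 4 + 6 * algebraMap F K A * θ u ^ 2 + 12 * algebraMap F K B * θ u -
      algebraMap F K A ^ 2 ≠ 0 := by
  obtain ⟨l, hl, hx, hy⟩ := T.tangent hu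
  intro h
  have h4 : (2 * η u) ^ 2 ≠ 0 := pow_ne_zero _ (mul_ne_zero T.two_ne_K (T.y_ne u hu))
  apply mul_ne_zero h4 (sub_ne_zero.mpr (T.x_add_self_ne hu))
  have heq := T.equation u hu
  rw [hx]
  linear_combination h + 12 * θ u * heq + (3 * θ u ^ 2 + algebraMap F K A + l * (2 * η u)) * hl

theorem triD_ne_zero (T : TraceCoords A B s θ η) {u : ZMod p} (hu : u ≠ 0) {h : TLine F}
    (hh : OnLine θ η u h) : triD A B h.slope h.icept ≠ 0 := by
  have hsu := mul_ne_zero T.s_ne_zero hu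
  have hssu := mul_ne_zero T.s_ne_zero hsu
  have hs : u + s * u = -(s * (s * u)) := by linear_combination u * T.quad
  have hl := T.onLine_mul hu hh
  unfold OnLine at *
  have hl1 : η u - η (s * u) = algebraMap F K h.slope * (θ u - θ (s * u)) := by
    rw [hh, hl]; ring
  obtain ⟨hx, -⟩ := T.add u (s * u) _ hu hsu (T.x_ne_x_mul hu).symm hl1
  rw [hs, T.x_neg _ hssu] at hx
  obtain ⟨hA, hB⟩ := secant_parameters (T.x_ne_x_mul hu).symm (T.equation u hu)
    (T.equation _ hsu) hl1
  rw [← hx] at hA hB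
  have hn : η u - algebraMap F K h.slope * θ u = algebraMap F K h.icept := by rw [hh]; ring
  rw [hn] at hA hB
  have key := triD_identity T.three_ne_K _ _ _ _ _ _ _ hx hA hB
  have h3 := mul_ne_zero (mul_ne_zero (T.psi_ne_zero hu) (T.psi_ne_zero hsu)) (T.psi_ne_zero hssu)
  rw [← key, ← map_triD] at h3
  exact (_root_.map_ne_zero _).mp (right_ne_zero_of_mul h3)

theorem onLine_triple (T : TraceCoords A B s θ η) {u : ZMod p} (hu : u ≠ 0) {h : TLine F}
    (hh : OnLine θ η u h) : OnLine θ η (u + (u + u)) (h.triple A B) := by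
  obtain ⟨l, hl, hx, hy⟩ := T.tangent hu
  have hD := (_root_.map_ne_zero (algebraMap F K)).mpr (T.triD_ne_zero hu hh)
  have heq := T.equation u hu
  have hne := T.x_add_self_ne hu
  -- This is the difference of the abscissas of 2P and P.
  have hz : l ^ 2 - 3 * θ u ≠ 0 := by
    intro h0; apply hne; linear_combination -h0 - hx
  obtain ⟨t, ht⟩ : ∃ t, η u = t * (l ^ 2 - 3 * θ u) := ⟨η u / (l ^ 2 - 3 * θ u), by
    rw [div_mul_cancel₀ _ hz]⟩
  obtain ⟨hx3, hy3⟩ := T.add u (u + u) (-l - 2 * t) hu (T.add_self_ne hu) hne (by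
    rw [hy, hx]; linear_combination 2 * ht)
  unfold OnLine at *
  have key := triple_identity T.three_ne_K (θ u) l t (η u) (algebraMap F K A) (algebraMap F K B)
    (θ (u + u)) (θ (u + (u + u))) (algebraMap F K h.slope) (algebraMap F K h.icept)
    ht (by linear_combination hl) (by linear_combination -heq) (by linear_combination hx)
    hx3 (by linear_combination -hh)
  simp only [TLine.triple, map_div₀, map_triD, map_triV0, map_triV1] at hD ⊢
  rw [div_mul_eq_mul_div, ← add_div, eq_div_iff hD]
  linear_combination -key + hy3 * triD (algebraMap F K A) (algebraMap F K B)
    (algebraMap F K h.slope) (algebraMap F K h.icept)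

/-- When the slopes do not cancel, `sumB3` is a nonzero multiple of f - k² evaluated where g meets
the flip of k. That abscissa lies in F, and an irreducible cubic has no root there. Parallel lines
leave only the cube of α₀ + β₀. -/
theorem sumB3_ne_zero (T : TraceCoords A B s θ η) {v : ZMod p} (hv : v ≠ 0) {g k : TLine F}
    (hk : OnLine θ η v k) (hgk : g ≠ k.flip) :
    sumB3 A B g.slope g.icept k.slope k.icept ≠ 0 := by
  rw [sumB3_eq]
  by_cases h1 : g.slope + k.slope = 0
  · intro e
    rw [h1] at e
    have h0 : g.icept + k.icept = 0 := by
      have : (g.icept + k.icept) ^ 3 = 0 := by linear_combination e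
      exact pow_eq_zero_iff (by norm_num) |>.mp this
    exact hgk (TLine.ext (by simp only [TLine.flip]; linear_combination h1)
      (by simp only [TLine.flip]; linear_combination h0))
  · intro e
    apply T.eval_cubic_ne_zero hv hk (-(g.icept + k.icept) / (g.slope + k.slope))
    field_simp
    linear_combination -e

theorem sPoly_snd_coeff (T : TraceCoords A B s θ η) {v : ZMod p} (hv : v ≠ 0) {g k : TLine F}
    (hk : OnLine θ η v k) (hgk : g ≠ k.flip) : (sPoly A B g k).snd.coeff 3 = 1 := by
  have h := T.sumB3_ne_zero hv hk hgk
  unfold sPoly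
  simp only [if_neg h, coeff_C_mul]
  simp [coeff_X_pow, h]

theorem sPoly_flip (T : TraceCoords A B s θ η) {u : ZMod p} (hu : u ≠ 0) {g k : TLine F}
    (hg : OnLine θ η u g) (hgk : g = k.flip) :
    (sPoly A B g k).snd = 0 ∧ (sPoly A B g k).fst.natDegree = 3 := by
  have hk : k = ⟨-g.slope, -g.icept⟩ := by rw [hgk]; simp [TLine.flip]
  have hsu := mul_ne_zero T.s_ne_zero hu
  have hssu := mul_ne_zero T.s_ne_zero hsu
  have hs : u + s * u = -(s * (s * u)) := by linear_combination u * T.quad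
  have hl := T.onLine_mul hu hg
  have hA3 : sumA3 A B g.slope g.icept (-g.slope) (-g.icept) ≠ 0 := by
    unfold OnLine at *
    have hl1 : η u - η (s * u) = algebraMap F K g.slope * (θ u - θ (s * u)) := by
      rw [hg, hl]; ring
    obtain ⟨hx, -⟩ := T.add u (s * u) _ hu hsu (T.x_ne_x_mul hu).symm hl1
    rw [hs, T.x_neg _ hssu] at hx
    obtain ⟨hA, hB⟩ := secant_parameters (T.x_ne_x_mul hu).symm (T.equation u hu)
      (T.equation _ hsu) hl1
    rw [← hx] at hA hB
    have hn : η u - algebraMap F K g.slope * θ u = algebraMap F K g.icept := by rw [hg]; ring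
    rw [hn] at hA hB
    have key := sumA3_neg _ _ _ _ _ _ _ hx hA hB
    rw [← map_neg, ← map_neg, ← map_sumA3] at key
    intro h0
    rw [h0, map_zero] at key
    have h3 : θ u ≠ θ (s * (s * u)) := by
      have e : u = s * (s * (s * u)) := by linear_combination (-u) * T.s_cube
      have := T.x_ne_x_mul hssu
      rwa [← e] at this
    exact pow_ne_zero 2 (mul_ne_zero (mul_ne_zero (sub_ne_zero.mpr (T.x_ne_x_mul hu).symm)
      (sub_ne_zero.mpr h3)) (sub_ne_zero.mpr (T.x_ne_x_mul hsu).symm)) (neg_eq_zero.mp key.symm)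
  subst hk
  unfold sPoly
  simp only [sumB3_neg, sumB2_neg, sumB1_neg, sumB0_neg, sumA4_neg, if_true, map_zero, map_one]
  constructor
  · simp
  · simp only [zero_mul, zero_add, one_mul]
    compute_degree!

/-- Only the sum u + v is treated; replacing v by its conjugates, which share the line k, yields the
other zeros of S. -/
theorem aeval_sPoly (T : TraceCoords A B s θ η) {u v : ZMod p} (hu : u ≠ 0) (hv : v ≠ 0)
    {g k : TLine F} (hg : OnLine θ η u g) (hk : OnLine θ η v k) (hx : θ u ≠ θ v) :
    aeval (θ (u + v)) (sPoly A B g k).fst +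
      η (u + v) * aeval (θ (u + v)) (sPoly A B g k).snd = 0 := by
  obtain ⟨l, hl⟩ : ∃ l, η u - η v = l * (θ u - θ v) := ⟨(η u - η v) / (θ u - θ v), by
    rw [div_mul_cancel₀ _ (sub_ne_zero.mpr hx)]⟩
  obtain ⟨h1, h2⟩ := T.add u v l hu hv hx hl
  obtain ⟨hA, hB⟩ := secant_parameters hx (T.equation u hu) (T.equation v hv) hl
  unfold OnLine at *
  have key := sum_identity (θ u) (θ v) l (η u - l * θ u) (algebraMap F K g.slope - l)
    (algebraMap F K k.slope - l) (θ (u + v)) (algebraMap F K A) (algebraMap F K B)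
    (algebraMap F K g.slope) (algebraMap F K g.icept) (algebraMap F K k.slope)
    (algebraMap F K k.icept) h1 (by rw [h1]; exact hA) (by rw [h1]; exact hB) (by ring)
    (by linear_combination -hg) (by ring) (by linear_combination -hk - hl)
  obtain ⟨c, hc1, hc2⟩ := sPoly_eq A B g k
  rw [hc1, hc2, h2]
  simp only [map_mul, map_add, aeval_C, aeval_X, map_pow, map_sumA4, map_sumA3, map_sumA2,
    map_sumA1, map_sumA0, map_sumB3, map_sumB2, map_sumB1, map_sumB0]
  linear_combination (algebraMap F K c) * key

end TraceCoords

/-! ### The linear system as a divisibility -/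

section SolveSystem

variable {F : Type*} [Field F]

theorem eq_of_natDegree_le_four {p : F[X]} (h : p.natDegree ≤ 4) :
    p = C (p.coeff 4) * X ^ 4 + C (p.coeff 3) * X ^ 3 + C (p.coeff 2) * X ^ 2 + C (p.coeff 1) * X
      + C (p.coeff 0) := by
  conv_lhs => rw [p.as_sum_range_C_mul_X_pow' (Nat.lt_succ_of_le h)]
  simp only [Finset.sum_range_succ, Finset.sum_range_zero]
  ring

theorem eq_of_natDegree_le_three {p : F[X]} (h : p.natDegree ≤ 3) :
    p = C (p.coeff 3) * X ^ 3 + C (p.coeff 2) * X ^ 2 + C (p.coeff 1) * X + C (p.coeff 0) := by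
  conv_lhs => rw [p.as_sum_range_C_mul_X_pow' (Nat.lt_succ_of_le h)]
  simp only [Finset.sum_range_succ, Finset.sum_range_zero]
  ring

theorem dvd_iff_coeff_eq_zero {W r : F[X]} (hW : W.natDegree = 3) {a b c : F}
    (hr : r = C a * X ^ 2 + C b * X + C c) : W ∣ r ↔ a = 0 ∧ b = 0 ∧ c = 0 := by
  constructor
  · intro h
    have hd : r.natDegree < W.natDegree := by
      rw [hW, hr]
      refine lt_of_le_of_lt natDegree_quadratic_le (by norm_num)
    have h0 := eq_zero_of_dvd_of_natDegree_lt h hd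
    rw [hr] at h0
    have h2 := congrArg (coeff · 2) h0
    have h1 := congrArg (coeff · 1) h0
    have h00 := congrArg (coeff · 0) h0
    simp [coeff_X, coeff_C] at h2 h1 h00
    exact ⟨h2, h1, h00⟩
  · rintro ⟨rfl, rfl, rfl⟩
    simp [hr]

/-- Division by the monic cubic W leaves a remainder r₂X² + r₁X + r₀. The rows of the system are r₀,
w₂r₀ - w₀r₂ and w₁r₀ - w₀r₁, up to sign, so they vanish together with the remainder because w₀ ≠ 0.
-/
theorem solvesSystem_iff {W : F[X]} (hW : W.natDegree = 3) (hm : W.Monic) (h0 : W.coeff 0 ≠ 0)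
    {S : SPoly F} (h1 : S.fst.natDegree ≤ 4) (h2 : S.snd.natDegree ≤ 3) (h3 : S.snd.coeff 3 = 1)
    (l : TLine F) :
    SolvesSystem W S l ↔ W ∣ (C l.slope * X + C l.icept) * S.snd + S.fst := by
  have hW3 : W.coeff 3 = 1 := by rw [← hW]; exact hm
  have eW := eq_of_natDegree_le_three hW.le
  have eS := eq_of_natDegree_le_three h2
  have eT := eq_of_natDegree_le_four h1
  rw [hW3] at eW
  rw [h3] at eS
  set w2 := W.coeff 2
  set w1 := W.coeff 1
  set w0 := W.coeff 0
  set b2 := S.snd.coeff 2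
  set b1 := S.snd.coeff 1
  set b0 := S.snd.coeff 0
  set a4 := S.fst.coeff 4
  set a3 := S.fst.coeff 3
  set a2 := S.fst.coeff 2
  set a1 := S.fst.coeff 1
  set a0 := S.fst.coeff 0
  obtain ⟨m, n⟩ := l
  -- The coefficients of X⁴ and X³ determine the linear quotient.
  set q1 := m + a4 with hq1
  set q0 := m * b2 + n + a3 - q1 * w2 with hq0
  have e : (C m * X + C n) * S.snd + S.fst - W * (C q1 * X + C q0) =
      C (m * b1 + n * b2 + a2 - q1 * w1 - q0 * w2) * X ^ 2 +
      C (m * b0 + n * b1 + a1 - q1 * w0 - q0 * w1) * X + C (n * b0 + a0 - q0 * w0) := by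
    conv_lhs => rw [eW, eS, eT]
    simp only [hq0, hq1, map_add, map_sub, map_mul, map_one]
    ring
  have e2 : W ∣ (C m * X + C n) * S.snd + S.fst ↔
      W ∣ (C m * X + C n) * S.snd + S.fst - W * (C q1 * X + C q0) :=
    (dvd_sub_left (Dvd.intro _ rfl)).symm
  simp only [e2]
  rw [dvd_iff_coeff_eq_zero hW e]
  have e3 : SolvesSystem W S ⟨m, n⟩ ↔
      (w0 * (w2 - b2) * m + (b0 - w0) * n = w0 * a3 - a4 * w2 * w0 - a0 ∧
      w0 * (w1 - b1) * m + (b0 * w2 - w0 * b2) * n = w0 * a2 - a4 * w1 * w0 - a0 * w2 ∧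
      w0 * (w0 - b0) * m + (b0 * w1 - b1 * w0) * n = w0 * a1 - a4 * w0 ^ 2 - a0 * w1) := by
    simp [SolvesSystem, systemMatrix, Fin.forall_fin_succ, w2, w1, w0, b2, b1, b0, a4, a3, a2, a1,
      a0]
  rw [e3]
  constructor
  · rintro ⟨r0, r1, r2⟩
    have t0 : n * b0 + a0 - q0 * w0 = 0 := by rw [hq0, hq1]; linear_combination r0
    refine ⟨?_, ?_, t0⟩
    · apply mul_left_cancel₀ h0
      linear_combination -r1 + w2 * t0
    · apply mul_left_cancel₀ h0
      linear_combination -r2 + w1 * t0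
  · rintro ⟨r2, r1, r0⟩
    refine ⟨?_, ?_, ?_⟩
    · linear_combination r0
    · linear_combination -w0 * r2 + w2 * r0
    · linear_combination -w0 * r1 + w1 * r0

theorem solveSystem_eq_some {W : F[X]} {S : SPoly F} {l : TLine F}
    (h : ∀ k, SolvesSystem W S k ↔ k = l) : solveSystem W S = some l := by
  have hex : ∃! k, SolvesSystem W S k := ⟨l, (h l).mpr rfl, fun k hk => (h k).mp hk⟩
  unfold solveSystem
  rw [dif_pos hex]
  congr 1
  exact (h _).mp hex.choose_spec.1

end SolveSystem

/-! ### Zeros of S and the factorisation of its norm -/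

/-- The function `S` vanishes at the point with coordinates `(θ w, η w)`. -/
def SPoly.Vanishes {F K R : Type*} [Field F] [Field K] [Algebra F K] (S : SPoly F) (θ η : R → K)
    (w : R) : Prop :=
  aeval (θ w) S.fst + η w * aeval (θ w) S.snd = 0

/-- The shape of `S_(P,Q)` when its divisor has no cancellation. -/
structure SPoly.IsGeneric {F : Type*} [Field F] (S : SPoly F) : Prop where
  fst_le : S.fst.natDegree ≤ 4
  snd_le : S.snd.natDegree ≤ 3
  coeff_eq : S.snd.coeff 3 = 1

namespace SPoly.IsGeneric

variable {F : Type*} [Field F] {S : SPoly F}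

theorem snd_natDegree (G : S.IsGeneric) : S.snd.natDegree = 3 :=
  natDegree_eq_of_le_of_coeff_ne_zero G.snd_le (by rw [G.coeff_eq]; exact one_ne_zero)

theorem snd_monic (G : S.IsGeneric) : S.snd.Monic := by
  rw [Monic, leadingCoeff, G.snd_natDegree, G.coeff_eq]

theorem snd_eq_of_dvd (G : S.IsGeneric) {W : F[X]} (hW : W.Monic) (hd : W.natDegree = 3)
    (h : W ∣ S.snd) : S.snd = W :=
  eq_of_monic_of_dvd_of_natDegree_le hW G.snd_monic h (by rw [hd, G.snd_natDegree])

theorem cubicF_natDegree (A B : F) : (cubicF A B).natDegree = 3 ∧ (cubicF A B).Monic := by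
  have := TraceCoords.natDegree_monic_cubic 0 A B
  have e : cubicF A B = X ^ 3 + (C 0 * X ^ 2 + C A * X + C B) := by
    simp only [cubicF, map_zero]; ring
  rwa [← e] at this

/-- The term fS₂² is monic of degree 9, while S₁² has degree at most 8. -/
theorem normPoly_natDegree (G : S.IsGeneric) (A B : F) :
    (S.normPoly A B).natDegree = 9 ∧ (S.normPoly A B).Monic := by
  obtain ⟨h1, h2⟩ := cubicF_natDegree A B
  have hm : (cubicF A B * S.snd ^ 2).Monic := h2.mul (G.snd_monic.pow 2)
  have hd : (cubicF A B * S.snd ^ 2).natDegree = 9 := by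
    rw [h2.natDegree_mul (G.snd_monic.pow 2), h1, G.snd_monic.natDegree_pow, G.snd_natDegree]
  have hlt : (S.fst ^ 2).natDegree < (cubicF A B * S.snd ^ 2).natDegree := by
    rw [hd, natDegree_pow]
    have := G.fst_le
    omega
  have hlt' : (S.fst ^ 2).degree < (cubicF A B * S.snd ^ 2).degree :=
    degree_lt_degree hlt
  unfold SPoly.normPoly
  exact ⟨by rw [natDegree_sub_eq_left_of_natDegree_lt hlt, hd], hm.sub_of_left hlt'⟩

end SPoly.IsGeneric

namespace TraceCoords

variable {F K : Type*} [Field F] [Fintype F] [Field K] [Algebra F K] {A B : F}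
  {p : ℕ} [Fact p.Prime] {s : ZMod p} {θ η : ZMod p → K}

theorem vanishes_pow (T : TraceCoords A B s θ η) {S : SPoly F} {w : ZMod p} (hw : w ≠ 0) (n : ℕ)
    (h : S.Vanishes θ η w) : S.Vanishes θ η (s ^ n * w) := by
  unfold SPoly.Vanishes at *
  rw [T.x_pow n hw, T.y_pow n hw, aeval_algHom_apply, aeval_algHom_apply, ← map_mul, ← map_add, h,
    map_zero]

theorem vanishes_sPoly (T : TraceCoords A B s θ η) {u v : ZMod p} (hu : u ≠ 0) (hv : v ≠ 0)
    {g k : TLine F} (hg : OnLine θ η u g) (hk : OnLine θ η v k) (hgk : g ≠ k) (n : ℕ)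
    (hw : u + s ^ n * v ≠ 0) : (sPoly A B g k).Vanishes θ η (u + s ^ n * v) := by
  have hv' := mul_ne_zero (pow_ne_zero n T.s_ne_zero) hv
  have hk' := T.onLine_pow n hv hk
  refine T.aeval_sPoly hu hv' hg hk' fun h => ?_
  rcases T.eq_or_eq_neg _ _ hu hv' h with h | h
  · rw [h] at hg
    exact hgk (T.onLine_unique hv' hg hk')
  · exact hw (by rw [h]; ring)

theorem isGeneric_sPoly (T : TraceCoords A B s θ η) {v : ZMod p} (hv : v ≠ 0) {g k : TLine F}
    (hk : OnLine θ η v k) (hgk : g ≠ k.flip) : (sPoly A B g k).IsGeneric :=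
  ⟨sPoly_fst_natDegree A B g k, sPoly_snd_natDegree A B g k, T.sPoly_snd_coeff hv hk hgk⟩

/-- Adding and subtracting the conditions at wP and -wP separates S₁ from yS₂, as 2y ≠ 0. -/
theorem minpoly_dvd_of_vanishes_neg (T : TraceCoords A B s θ η) {S : SPoly F} {w : ZMod p}
    (hw : w ≠ 0) (h : S.Vanishes θ η w) (h' : S.Vanishes θ η (-w)) :
    minpoly F (θ w) ∣ S.fst ∧ minpoly F (θ w) ∣ S.snd := by
  unfold SPoly.Vanishes at *
  rw [T.x_neg w hw, T.y_neg w hw] at h'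
  have h2 : aeval (θ w) S.snd = 0 := by
    apply mul_left_cancel₀ (mul_ne_zero T.two_ne_K (T.y_ne w hw))
    linear_combination h - h'
  rw [minpoly.dvd_iff, minpoly.dvd_iff]
  exact ⟨by rw [h2] at h; simpa using h, h2⟩

theorem minpoly_dvd_normPoly (T : TraceCoords A B s θ η) {S : SPoly F} {w : ZMod p}
    (hw : w ≠ 0) (h : S.Vanishes θ η w) : minpoly F (θ w) ∣ S.normPoly A B := by
  rw [minpoly.dvd_iff]
  unfold SPoly.Vanishes at h
  have := T.equation w hw
  simp only [SPoly.normPoly, cubicF, map_sub, map_mul, map_pow, map_add, aeval_X, aeval_C]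
  linear_combination -(aeval (θ w) S.snd) ^ 2 * this -
    (aeval (θ w) S.fst - η w * aeval (θ w) S.snd) * h

theorem minpoly_eq_of_dvd (T : TraceCoords A B s θ η) {u v : ZMod p}
    (h : minpoly F (θ u) ∣ minpoly F (θ v)) : minpoly F (θ u) = minpoly F (θ v) :=
  eq_of_monic_of_associated (T.minpoly_monic u) (T.minpoly_monic v)
    ((T.minpoly_irreducible u).associated_of_dvd (T.minpoly_irreducible v) h)

/-- No two of `w 0`, `w 1`, `w 2` differ by a power of `s`. -/
def Unrelated (s : ZMod p) (w : Fin 3 → ZMod p) : Prop :=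
  ∀ i j, i ≠ j → ∀ n, w i ≠ s ^ n * w j

/-- Unrelated indices with the same minimal polynomial differ by a power of s and a sign. Then S
vanishes at a point and its negative, so W divides both S₁ and S₂ and W² divides the norm. The third
factor is different, since two sign changes would relate w k to w j. -/
theorem mul_minpoly_dvd_normPoly_of_eq (T : TraceCoords A B s θ η) {S : SPoly F}
    {w : Fin 3 → ZMod p} (hw : ∀ i, w i ≠ 0) (hr : Unrelated s w)
    (hS : ∀ i, S.Vanishes θ η (w i)) {i j k : Fin 3} (hij : i ≠ j) (hik : i ≠ k) (hjk : j ≠ k)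
    (h : minpoly F (θ (w i)) = minpoly F (θ (w j))) :
    minpoly F (θ (w i)) * minpoly F (θ (w i)) * minpoly F (θ (w k)) ∣ S.normPoly A B := by
  have hneg : ∀ i j, i ≠ j → minpoly F (θ (w i)) = minpoly F (θ (w j)) →
      ∃ n, w i = -(s ^ n * w j) := by
    intro i j hij h
    obtain ⟨n, -, h | h⟩ := T.eq_of_minpoly_eq (hw i) (hw j) h
    · exact absurd h (hr i j hij n)
    · exact ⟨n, h⟩
  obtain ⟨n, hn⟩ := hneg i j hij h
  have hv := T.vanishes_pow (hw j) n (hS j)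
  rw [show s ^ n * w j = -w i by rw [hn]; ring] at hv
  obtain ⟨⟨e, he⟩, ⟨f, hf⟩⟩ := T.minpoly_dvd_of_vanishes_neg (hw i) (hS i) hv
  have hne : minpoly F (θ (w k)) ≠ minpoly F (θ (w i)) := by
    intro hk
    obtain ⟨m, hm⟩ := hneg k i hik.symm hk
    apply hr k j hjk.symm (m + n)
    rw [hm, hn]; ring
  have hN : S.normPoly A B = minpoly F (θ (w i)) * minpoly F (θ (w i)) *
      (cubicF A B * f ^ 2 - e ^ 2) := by
    rw [SPoly.normPoly, he, hf]; ring
  have hd := T.minpoly_dvd_normPoly (hw k) (hS k)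
  rw [hN] at hd ⊢
  apply mul_dvd_mul_left
  have hp := (T.minpoly_irreducible (w k)).prime
  rcases hp.dvd_or_dvd hd with h1 | h1
  · rcases hp.dvd_or_dvd h1 with h1 | h1 <;>
    exact absurd (T.minpoly_eq_of_dvd h1) hne
  · exact h1

/-- The product divides the norm, also when two of the minimal polynomials agree, and both are monic
of degree 9. -/
theorem normPoly_eq (T : TraceCoords A B s θ η) {S : SPoly F} (G : S.IsGeneric)
    {w : Fin 3 → ZMod p} (hw : ∀ i, w i ≠ 0) (hr : Unrelated s w)
    (hS : ∀ i, S.Vanishes θ η (w i)) :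
    S.normPoly A B = minpoly F (θ (w 0)) * minpoly F (θ (w 1)) * minpoly F (θ (w 2)) := by
  obtain ⟨h9, hm⟩ := G.normPoly_natDegree A B
  have hmon : (minpoly F (θ (w 0)) * minpoly F (θ (w 1)) * minpoly F (θ (w 2))).Monic :=
    ((T.minpoly_monic _).mul (T.minpoly_monic _)).mul (T.minpoly_monic _)
  have hdeg : (minpoly F (θ (w 0)) * minpoly F (θ (w 1)) * minpoly F (θ (w 2))).natDegree = 9 := by
    rw [((T.minpoly_monic _).mul (T.minpoly_monic _)).natDegree_mul (T.minpoly_monic _),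
      (T.minpoly_monic _).natDegree_mul (T.minpoly_monic _), T.minpoly_natDegree (hw 0),
      T.minpoly_natDegree (hw 1), T.minpoly_natDegree (hw 2)]
  refine eq_of_monic_of_dvd_of_natDegree_le hmon hm ?_ (by rw [h9, hdeg])
  by_cases h01 : minpoly F (θ (w 0)) = minpoly F (θ (w 1))
  · have := T.mul_minpoly_dvd_normPoly_of_eq hw hr hS (i := 0) (j := 1) (k := 2)
      (by decide) (by decide) (by decide) h01
    rwa [← h01]
  by_cases h02 : minpoly F (θ (w 0)) = minpoly F (θ (w 2))
  · have := T.mul_minpoly_dvd_normPoly_of_eq hw hr hS (i := 0) (j := 2) (k := 1)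
      (by decide) (by decide) (by decide) h02
    rw [← h02]
    convert this using 1
    ring
  by_cases h12 : minpoly F (θ (w 1)) = minpoly F (θ (w 2))
  · have := T.mul_minpoly_dvd_normPoly_of_eq hw hr hS (i := 1) (j := 2) (k := 0)
      (by decide) (by decide) (by decide) h12
    rw [← h12]
    convert this using 1
    ring
  have hcop : ∀ i j, minpoly F (θ (w i)) ≠ minpoly F (θ (w j)) →
      IsCoprime (minpoly F (θ (w i))) (minpoly F (θ (w j))) := by
    intro i j h
    exact ((T.minpoly_irreducible _).coprime_iff_not_dvd).mpr
      fun hd => h (T.minpoly_eq_of_dvd hd)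
  refine IsCoprime.mul_dvd ((hcop 0 2 h02).mul_left (hcop 1 2 h12))
    (IsCoprime.mul_dvd (hcop 0 1 h01) ?_ ?_) ?_ <;>
  exact T.minpoly_dvd_normPoly (hw _) (hS _)

theorem exists_minpoly_eq_of_dvd (T : TraceCoords A B s θ η) {S : SPoly F} (G : S.IsGeneric)
    {w : Fin 3 → ZMod p} (hw : ∀ i, w i ≠ 0) (hr : Unrelated s w)
    (hS : ∀ i, S.Vanishes θ η (w i)) {W : F[X]} (hW : Irreducible W) (hm : W.Monic)
    (hd : W ∣ S.normPoly A B) : ∃ i, W = minpoly F (θ (w i)) := by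
  rw [T.normPoly_eq G hw hr hS] at hd
  have key : ∀ i, W ∣ minpoly F (θ (w i)) → W = minpoly F (θ (w i)) := fun i h =>
    eq_of_monic_of_associated hm (T.minpoly_monic _)
      (hW.associated_of_dvd (T.minpoly_irreducible _) h)
  rcases hW.prime.dvd_or_dvd hd with h | h
  · rcases hW.prime.dvd_or_dvd h with h | h
    · exact ⟨0, key 0 h⟩
    · exact ⟨1, key 1 h⟩
  · exact ⟨2, key 2 h⟩

/-- If W divides S₂, the zero of S makes it divide S₁ too, so W² divides the norm and W occurs for a
second index. By unrelatedness the two indices have opposite signs. -/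
theorem exists_neg_of_dvd_snd (T : TraceCoords A B s θ η) {S : SPoly F} (G : S.IsGeneric)
    {w : Fin 3 → ZMod p} (hw : ∀ i, w i ≠ 0) (hr : Unrelated s w)
    (hS : ∀ i, S.Vanishes θ η (w i)) {i : Fin 3} (h : minpoly F (θ (w i)) ∣ S.snd) :
    ∃ j, j ≠ i ∧ ∃ n, w j = -(s ^ n * w i) := by
  have h1 : minpoly F (θ (w i)) ∣ S.fst := by
    have := hS i
    unfold SPoly.Vanishes at this
    rw [minpoly.dvd_iff] at h ⊢
    rw [h] at this
    simpa using this
  have h2 : minpoly F (θ (w i)) * minpoly F (θ (w i)) ∣ S.normPoly A B := by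
    obtain ⟨e, he⟩ := h1
    obtain ⟨f, hf⟩ := h
    exact ⟨cubicF A B * f ^ 2 - e ^ 2, by rw [SPoly.normPoly, he, hf]; ring⟩
  rw [T.normPoly_eq G hw hr hS] at h2
  have hex : ∃ j, j ≠ i ∧ minpoly F (θ (w j)) = minpoly F (θ (w i)) := by
    have hp := (T.minpoly_irreducible (w i)).prime
    have key : ∀ j k, minpoly F (θ (w i)) ∣ minpoly F (θ (w j)) * minpoly F (θ (w k)) →
        minpoly F (θ (w j)) = minpoly F (θ (w i)) ∨
        minpoly F (θ (w k)) = minpoly F (θ (w i)) := fun j k h =>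
      (hp.dvd_or_dvd h).imp (fun h => (T.minpoly_eq_of_dvd h).symm)
        (fun h => (T.minpoly_eq_of_dvd h).symm)
    fin_cases i
    · rw [mul_assoc] at h2
      have := key 1 2 ((mul_dvd_mul_iff_left hp.ne_zero).mp h2)
      exact this.elim (fun h => ⟨1, by decide, h⟩) (fun h => ⟨2, by decide, h⟩)
    · rw [mul_comm (minpoly F (θ (w 0))), mul_assoc] at h2
      have := key 0 2 ((mul_dvd_mul_iff_left hp.ne_zero).mp h2)
      exact this.elim (fun h => ⟨0, by decide, h⟩) (fun h => ⟨2, by decide, h⟩)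
    · rw [mul_comm (minpoly F (θ (w 0)) * minpoly F (θ (w 1)))] at h2
      have := key 0 1 ((mul_dvd_mul_iff_left hp.ne_zero).mp h2)
      exact this.elim (fun h => ⟨0, by decide, h⟩) (fun h => ⟨1, by decide, h⟩)
  obtain ⟨j, hj, hj'⟩ := hex
  obtain ⟨n, -, h | h⟩ := T.eq_of_minpoly_eq (hw j) (hw i) hj'
  · exact absurd h (hr j i hj n)
  · exact ⟨j, hj, n, h⟩

/-- Substituting S₁ = -yS₂ at the zero turns the right-hand polynomial into (γ₁x + γ₀ - y)S₂, which
vanishes when one of the two factors does. -/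
theorem dvd_line_iff (_T : TraceCoords A B s θ η) {S : SPoly F} {w : ZMod p}
    (hS : S.Vanishes θ η w) (l : TLine F) :
    minpoly F (θ w) ∣ (C l.slope * X + C l.icept) * S.snd + S.fst ↔
      OnLine θ η w l ∨ minpoly F (θ w) ∣ S.snd := by
  unfold SPoly.Vanishes at hS
  rw [minpoly.dvd_iff, minpoly.dvd_iff]
  unfold OnLine
  simp only [map_add, map_mul, aeval_C, aeval_X]
  constructor
  · intro h
    have : (η w - (algebraMap F K l.slope * θ w + algebraMap F K l.icept)) *
        aeval (θ w) S.snd = 0 := by linear_combination hS - h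
    rcases mul_eq_zero.mp this with h | h
    · exact Or.inl (sub_eq_zero.mp h)
    · exact Or.inr h
  · rintro (h | h)
    · rw [← h]; linear_combination hS
    · rw [h] at hS ⊢; linear_combination hS

theorem solveSystem_minpoly (T : TraceCoords A B s θ η) {S : SPoly F} (G : S.IsGeneric)
    {w : ZMod p} (hw : w ≠ 0) (hS : S.Vanishes θ η w) (hd : ¬ minpoly F (θ w) ∣ S.snd)
    {l : TLine F} (hl : OnLine θ η w l) : solveSystem (minpoly F (θ w)) S = some l := by
  apply solveSystem_eq_some
  intro k
  rw [solvesSystem_iff (T.minpoly_natDegree hw) (T.minpoly_monic w) (by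
    rw [coeff_zero_eq_eval_zero]; exact T.eval_minpoly_ne_zero hw 0) G.fst_le G.snd_le G.coeff_eq,
    T.dvd_line_iff hS]
  constructor
  · rintro (h | h)
    · exact T.onLine_unique hw h hl
    · exact absurd h hd
  · rintro rfl
    exact Or.inl hl

end TraceCoords

/-! ### Correctness of the subalgorithm in the absence of coincidences -/

/-- The three points `a + b`, `a + s b`, `a + s² b`. -/
def conjSums {p : ℕ} (s a b : ZMod p) (i : Fin 3) : ZMod p := a + s ^ (i : ℕ) * b

/-- The twelve coincidences, other than the intended one, between the sums of conjugates of
`a` and `b` and those of `c` and `d`. -/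
def NoCoincidence {p : ℕ} (s a b c d : ZMod p) : Prop :=
  ∀ j ∈ [1, 2], ∀ k ∈ [1, 2], ∀ l ∈ [0, 1, 2], a + s ^ j * b ≠ s ^ l * (c + s ^ k * d)

namespace TraceCoords

variable {F K : Type*} [Field F] [Fintype F] [Field K] [Algebra F K] {A B : F}
  {p : ℕ} [Fact p.Prime] {s : ZMod p} {θ η : ZMod p → K}

theorem pow_mod (T : TraceCoords A B s θ η) (n : ℕ) : s ^ n = s ^ (n % 3) := by
  conv_lhs => rw [← Nat.div_add_mod n 3, pow_add, pow_mul, T.s_cube, one_pow, one_mul]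

theorem ne_of_noCoincidence (T : TraceCoords A B s θ η) {a b c d : ZMod p}
    (h : NoCoincidence s a b c d) {j k : Fin 3} (hj : j ≠ 0) (hk : k ≠ 0) (n : ℕ) :
    conjSums s a b j ≠ s ^ n * conjSums s c d k := by
  rw [T.pow_mod n]
  have h3 : n % 3 ∈ [0, 1, 2] := by
    have := Nat.mod_lt n (show 3 > 0 by norm_num)
    simp only [List.mem_cons, List.not_mem_nil, or_false]
    omega
  have key : ∀ j : Fin 3, j ≠ 0 → (j : ℕ) ∈ [1, 2] := by decide
  exact h j (key j hj) k (key k hk) _ h3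

/-- In a relation a + sⁱb = sⁿ(a + sʲb) with i ≠ j, either one of a, b drops out, or the quotient of
the two differences of cube roots of unity is itself a power of s, so that a = sᵐb. -/
theorem unrelated_conjSums (T : TraceCoords A B s θ η) {a b : ZMod p} (ha : a ≠ 0) (hb : b ≠ 0)
    (h : ∀ m, a ≠ s ^ m * b) : Unrelated s (conjSums s a b) := by
  have h3 := T.three_ne'
  have hq := T.quad
  have h0 := h 0
  have h1 := h 1
  have h2 := h 2
  clear h
  intro i j hij n e
  rw [T.pow_mod n] at e
  have hn := Nat.mod_lt n (show 3 > 0 by norm_num)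
  generalize n % 3 = m at e hn
  unfold conjSums at e
  fin_cases i <;> fin_cases j <;> simp only [ne_eq, not_true_eq_false] at hij <;>
    interval_cases m <;> simp only [] at e <;> grind

theorem ne_flip_of_sums_ne_zero (T : TraceCoords A B s θ η) {a b : ZMod p} (ha : a ≠ 0)
    (hb : b ≠ 0) {g k : TLine F} (hg : OnLine θ η a g) (hk : OnLine θ η b k) :
    g = k.flip → ∃ i, conjSums s a b i = 0 := by
  intro h
  have h1 := T.onLine_neg hb hk
  rw [← h] at h1
  obtain ⟨n, hn, h2⟩ := T.eq_of_onLine ha (neg_ne_zero.mpr hb) hg h1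
  exact ⟨⟨n, hn⟩, by unfold conjSums; simp only []; rw [h2]; ring⟩

theorem conjSums_ne_zero (T : TraceCoords A B s θ η) {a b : ZMod p}
    (hb : b ≠ 0) {g k : TLine F} (hg : OnLine θ η a g) (hk : OnLine θ η b k)
    (hgk : g ≠ k.flip) (i : Fin 3) : conjSums s a b i ≠ 0 := by
  intro h
  apply hgk
  have hb' := mul_ne_zero (pow_ne_zero i.1 T.s_ne_zero) hb
  have h1 := T.onLine_neg hb' (T.onLine_pow i.1 hb hk)
  have h2 : a = -(s ^ i.1 * b) := by unfold conjSums at h; linear_combination h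
  rw [← h2] at h1
  exact T.onLine_unique (h2 ▸ neg_ne_zero.mpr hb') hg h1

theorem ne_pow_mul (T : TraceCoords A B s θ η) {a b : ZMod p} (hb : b ≠ 0) {g k : TLine F}
    (hg : OnLine θ η a g) (hk : OnLine θ η b k) (hgk : g ≠ k) (m : ℕ) : a ≠ s ^ m * b := by
  intro h
  apply hgk
  rw [h] at hg
  exact T.onLine_unique (mul_ne_zero (pow_ne_zero m T.s_ne_zero) hb) hg (T.onLine_pow m hb hk)

/-- Two different points of one trace line sum to the negative of the third. -/
theorem onLine_sum_of_eq (T : TraceCoords A B s θ η) {a b : ZMod p} (ha : a ≠ 0) (hb : b ≠ 0)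
    (hab : a ≠ b) {g : TLine F} (hg : OnLine θ η a g) (hk : OnLine θ η b g) :
    OnLine θ η (a + b) g.flip := by
  obtain ⟨n, hn, h⟩ := T.eq_of_onLine ha hb hg hk
  have h1 := T.onLine_neg hb hk
  have hnb := neg_ne_zero.mpr hb
  have hq := T.quad
  interval_cases n
  · exact absurd (by rw [h]; ring) hab
  · have := T.onLine_pow 2 hnb h1
    rwa [show s ^ 2 * -b = a + b by rw [h]; linear_combination (-b) * hq] at this
  · have := T.onLine_pow 1 hnb h1
    rwa [show s ^ 1 * -b = a + b by rw [h]; linear_combination (-b) * hq] at this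

/-- With opposite lines S₂ = 0 and S₁ is a cubic vanishing at θ(a + b), hence proportional to its
minimal polynomial. One of a + sb, a + s²b is zero and the other is minus a power of s times a + b.
If W divided the second part of S', some c + sᵏd with k ≠ 0 would have the same form, which is a
coincidence. -/
theorem solveSystem_flip (T : TraceCoords A B s θ η) {a b c d : ZMod p} (ha : a ≠ 0) (hb : b ≠ 0)
    (hc : c ≠ 0) (hd : d ≠ 0) (hn : a + b ≠ 0) (hsum : a + b = c + d) {g₁ g₂ g₃ g₄ l : TLine F}
    (h₁ : OnLine θ η a g₁) (h₂ : OnLine θ η b g₂) (h₃ : OnLine θ η c g₃) (h₄ : OnLine θ η d g₄)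
    (hl : OnLine θ η (a + b) l) (h12 : g₁ ≠ g₂) (h34 : g₃ ≠ g₄) (hf : g₁ = g₂.flip)
    (hnc : ∀ j k : Fin 3, j ≠ 0 → k ≠ 0 → ∀ n, conjSums s a b j ≠ s ^ n * conjSums s c d k) :
    solveSystem (makeMonic (sPoly A B g₁ g₂).fst) (sPoly A B g₃ g₄) = some l := by
  obtain ⟨hs0, hs3⟩ := T.sPoly_flip ha h₁ hf
  obtain ⟨i, hi⟩ := T.ne_flip_of_sums_ne_zero ha hb h₁ h₂ hf
  have hi0 : i ≠ 0 := by
    rintro rfl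
    apply hn; simpa [conjSums] using hi
  have hcd : conjSums s c d 0 = a + b := by rw [hsum]; simp [conjSums]
  have hf' : g₃ ≠ g₄.flip := by
    -- If both pairs of lines were opposite, a zero sum on each side would be a coincidence.
    intro hf'
    obtain ⟨k, hk⟩ := T.ne_flip_of_sums_ne_zero hc hd h₃ h₄ hf'
    have hk0 : k ≠ 0 := by
      rintro rfl
      exact hn (hcd.symm.trans hk)
    exact hnc i k hi0 hk0 0 (by rw [hi, hk]; simp)
  have hW : makeMonic (sPoly A B g₁ g₂).fst = minpoly F (θ (a + b)) := by
    have hv := T.vanishes_sPoly ha hb h₁ h₂ h12 0 (by simpa using hn)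
    have hne : (sPoly A B g₁ g₂).fst ≠ 0 := by
      intro h0
      rw [h0] at hs3
      simp at hs3
    rw [pow_zero, one_mul] at hv
    unfold SPoly.Vanishes at hv
    rw [hs0, map_zero, mul_zero, add_zero, ← minpoly.dvd_iff] at hv
    have hc0 : (sPoly A B g₁ g₂).fst.leadingCoeff⁻¹ ≠ 0 :=
      inv_ne_zero (leadingCoeff_ne_zero.mpr hne)
    refine eq_of_monic_of_dvd_of_natDegree_le (T.minpoly_monic _) ?_ (hv.mul_left _) ?_
    · unfold makeMonic
      rw [mul_comm]
      exact monic_mul_leadingCoeff_inv hne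
    · unfold makeMonic
      rw [natDegree_C_mul hc0, hs3, T.minpoly_natDegree hn]
  rw [hW]
  have G := T.isGeneric_sPoly hd h₄ hf' (g := g₃)
  have hw := T.conjSums_ne_zero hd h₃ h₄ hf'
  have hr := T.unrelated_conjSums hc hd (T.ne_pow_mul hd h₃ h₄ h34)
  have hS : ∀ i, (sPoly A B g₃ g₄).Vanishes θ η (conjSums s c d i) := fun i =>
    T.vanishes_sPoly hc hd h₃ h₄ h34 i (hw i)
  refine T.solveSystem_minpoly G hn (by rw [← hcd]; exact hS 0) (fun h => ?_) hl
  rw [← hcd] at h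
  obtain ⟨k, hk, n, hkn⟩ := T.exists_neg_of_dvd_snd G hw hr hS h
  rw [hcd] at hkn
  have hq := T.quad
  fin_cases i
  · exact hi0 rfl
  -- From a + sb = 0 one gets a + s²b = -s(a + b); the other case is symmetric.
  · apply hnc 2 k (by decide) hk (2 * n + 1)
    rw [hkn]
    have h3 := T.s_cube
    have e : s ^ (2 * n + 1) * -(s ^ n * (a + b)) = -(s * (a + b)) * (s ^ 3) ^ n := by
      rw [← pow_mul]; ring
    rw [e, h3, one_pow]
    have hi' : a + s ^ 1 * b = 0 := hi
    show a + s ^ 2 * b = _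
    linear_combination (1 + s) * hi'
  · apply hnc 1 k (by decide) hk (2 * n + 2)
    rw [hkn]
    have h3 := T.s_cube
    have e : s ^ (2 * n + 2) * -(s ^ n * (a + b)) = -(s ^ 2 * (a + b)) * (s ^ 3) ^ n := by
      rw [← pow_mul]; ring
    rw [e, h3, one_pow]
    have hi' : a + s ^ 2 * b = 0 := hi
    show a + s ^ 1 * b = _
    linear_combination (1 + s ^ 2) * hi' - b * s * h3

end TraceCoords

theorem mem_cubicFactors {F : Type*} [Field F] {G W : F[X]} (hG : G ≠ 0) :
    W ∈ cubicFactors G ↔ Irreducible W ∧ W.Monic ∧ W ∣ G ∧ W.natDegree = 3 := by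
  classical
  unfold cubicFactors
  rw [Finset.mem_toList, Finset.mem_filter, Multiset.mem_toFinset]
  rw [Polynomial.mem_normalizedFactors_iff hG]
  tauto

theorem findSome_eq_some {α β : Type*} {f : α → Option β} {L : List α} {b : β}
    (h : ∀ x ∈ L, f x = none ∨ f x = some b) {x : α} (hx : x ∈ L) (hb : f x = some b) :
    L.findSome? f = some b := by
  induction L with
  | nil => simp at hx
  | cons y L ih =>
    rw [List.findSome?_cons]
    rcases h y (by simp) with hy | hy
    · rw [hy]
      apply ih (fun z hz => h z (by simp [hz]))
      rcases List.mem_cons.mp hx with e | e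
      · rw [← e, hb] at hy; simp at hy
      · exact e
    · rw [hy]

namespace TraceCoords

variable {F K : Type*} [Field F] [Fintype F] [Field K] [Algebra F K] {A B : F}
  {p : ℕ} [Fact p.Prime] {s : ZMod p} {θ η : ZMod p → K}

open Classical in
-- The test W ≠ S₂ of the algorithm decides whether W divides S₂, both being monic cubics. When it
-- does, the system for S' has to be used, and the hypothesis ensures that this one is not
-- degenerate too.
theorem subalgTry_of_sum (T : TraceCoords A B s θ η) {S S' : SPoly F} (G : S.IsGeneric)
    (G' : S'.IsGeneric) {w : ZMod p} (hw : w ≠ 0) (hS : S.Vanishes θ η w)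
    (hS' : S'.Vanishes θ η w) (h : ¬ (minpoly F (θ w) ∣ S.snd ∧ minpoly F (θ w) ∣ S'.snd))
    {l : TLine F} (hl : OnLine θ η w l) : subalgTry S S' (minpoly F (θ w)) = some l := by
  unfold subalgTry
  split_ifs with h1
  · have hd : ¬ minpoly F (θ w) ∣ S.snd := fun hd =>
      h1 (G.snd_eq_of_dvd (T.minpoly_monic w) (T.minpoly_natDegree hw) hd).symm
    rw [T.solveSystem_minpoly G hw hS hd hl, Option.filter_some, if_pos]
    rw [decide_eq_true_eq, T.dvd_line_iff hS']
    exact Or.inl hl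
  · push Not at h1
    apply T.solveSystem_minpoly G' hw hS' _ hl
    intro hd
    exact h ⟨by rw [← h1], hd⟩

open Classical in
-- The system for S produces the line through wP. Passing the test for S' would put -wP on the same
-- line, but -w is not a power of s times w.
theorem subalgTry_of_neg (T : TraceCoords A B s θ η) {S S' : SPoly F} (G : S.IsGeneric)
    {w : ZMod p} (hw : w ≠ 0) (hS : S.Vanishes θ η w)
    (hS' : S'.Vanishes θ η (-w)) (h : ¬ minpoly F (θ w) ∣ S.snd)
    (h' : ¬ minpoly F (θ w) ∣ S'.snd) : subalgTry S S' (minpoly F (θ w)) = none := by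
  have hw' := neg_ne_zero.mpr hw
  obtain ⟨l, hl⟩ := T.exists_onLine hw
  unfold subalgTry
  rw [if_pos (fun e => h (by rw [← e])), T.solveSystem_minpoly G hw hS h hl, Option.filter_some,
    if_neg]
  rw [decide_eq_true_eq, ← T.minpoly_neg hw, T.dvd_line_iff hS', T.minpoly_neg hw]
  rintro (hl' | hd)
  · obtain ⟨n, hn, e⟩ := T.eq_of_onLine hw' hw hl' hl
    have h3 := T.three_ne'
    have h2 := T.two_ne'
    have hq := T.quad
    have key : ∀ n < 3, -1 - s ^ n ≠ 0 := by
      intro n hn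
      interval_cases n
      · have := T.intCast_add_mul_ne_zero (-2) 0 (by norm_num) (by norm_num)
        intro h; apply this; push_cast; linear_combination h
      · have := T.intCast_add_mul_ne_zero (-1) (-1) (by norm_num) (by norm_num)
        intro h; apply this; push_cast; linear_combination h
      · have := T.intCast_add_mul_ne_zero 0 1 (by norm_num) (by norm_num)
        intro h; apply this; push_cast; linear_combination h + hq
    exact mul_ne_zero (key n hn) hw (by linear_combination e)
  · exact h' hd

open Classical in
theorem subalgTry_generic (T : TraceCoords A B s θ η) {S S' : SPoly F} (G : S.IsGeneric)
    (G' : S'.IsGeneric) {w w' : Fin 3 → ZMod p} (hw : ∀ i, w i ≠ 0) (hw' : ∀ i, w' i ≠ 0)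
    (hr : Unrelated s w) (hr' : Unrelated s w') (hS : ∀ i, S.Vanishes θ η (w i))
    (hS' : ∀ i, S'.Vanishes θ η (w' i)) (h0 : w 0 = w' 0)
    (hnc : ∀ j k : Fin 3, j ≠ 0 → k ≠ 0 → ∀ n, w j ≠ s ^ n * w' k) {l : TLine F}
    (hl : OnLine θ η (w 0) l) :
    (cubicFactors (EuclideanDomain.gcd (S.normPoly A B) (S'.normPoly A B))).findSome?
      (subalgTry S S') = some l := by
  have hN : S.normPoly A B ≠ 0 := (G.normPoly_natDegree A B).2.ne_zero
  have hG : EuclideanDomain.gcd (S.normPoly A B) (S'.normPoly A B) ≠ 0 := fun h =>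
    hN (EuclideanDomain.gcd_eq_zero_iff.mp h).1
  have hpow : ∀ m n : ℕ, ∀ u : ZMod p, s ^ m * -(s ^ n * u) = -(s ^ (m + n) * u) := by
    intro m n u; ring
  have hinv : ∀ (n : ℕ) (u v : ZMod p), u = -(s ^ n * v) → v = -(s ^ (2 * n) * u) := by
    intro n u v h
    have : s ^ (3 * n) = 1 := by rw [pow_mul, T.s_cube, one_pow]
    rw [h]
    linear_combination (-v) * this
  have hsum : subalgTry S S' (minpoly F (θ (w 0))) = some l := by
    -- If W divided both second parts, each side would have a nontrivial sum equal to minus a power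
    -- of s times a + b; the signs cancel and leave a coincidence.
    refine T.subalgTry_of_sum G G' (hw 0) (hS 0) (h0 ▸ hS' 0) ?_ hl
    rintro ⟨hd, hd'⟩
    rw [h0] at hd'
    obtain ⟨j, hj, n, hn⟩ := T.exists_neg_of_dvd_snd G hw hr hS hd
    obtain ⟨k, hk, m, hm⟩ := T.exists_neg_of_dvd_snd G' hw' hr' hS' hd'
    apply hnc j k hj hk (n + 2 * m)
    rw [hn, h0, hinv m _ _ hm]
    ring
  refine findSome_eq_some (x := minpoly F (θ (w 0))) (fun W hW => ?_) ?_ hsum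
  · obtain ⟨hirr, hmon, hdvd, -⟩ := (mem_cubicFactors hG).mp hW
    obtain ⟨j, hj⟩ := T.exists_minpoly_eq_of_dvd G hw hr hS hirr hmon
      (hdvd.trans (EuclideanDomain.gcd_dvd_left _ _))
    obtain ⟨k, hk⟩ := T.exists_minpoly_eq_of_dvd G' hw' hr' hS' hirr hmon
      (hdvd.trans (EuclideanDomain.gcd_dvd_right _ _))
    by_cases hW0 : W = minpoly F (θ (w 0))
    · right; rw [hW0]; exact hsum
    left
    have hj0 : j ≠ 0 := by rintro rfl; exact hW0 hj
    have hk0 : k ≠ 0 := by rintro rfl; exact hW0 (by rw [hk, h0])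
    -- A factor different from the intended one belongs to nontrivial sums on both sides, and only
    -- the minus sign is left. If W divided either second part, a further change of sign would again
    -- produce a coincidence.
    obtain ⟨n, -, e | e⟩ := T.eq_of_minpoly_eq (hw j) (hw' k) (hj.symm.trans hk)
    · exact absurd e (hnc j k hj0 hk0 n)
    rw [hj]
    have hSn : S'.Vanishes θ η (-w j) := by
      have := T.vanishes_pow (hw' k) n (hS' k)
      rwa [show s ^ n * w' k = -w j by rw [e]; ring] at this
    refine T.subalgTry_of_neg G (hw j) (hS j) hSn (fun hd => ?_) (fun hd => ?_)
    · obtain ⟨i, hi, m, hm⟩ := T.exists_neg_of_dvd_snd G hw hr hS hd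
      have hi0 : i ≠ 0 := by
        rintro rfl
        apply hW0
        rw [hj, hm, T.minpoly_neg (mul_ne_zero (pow_ne_zero _ T.s_ne_zero) (hw j)),
          T.minpoly_pow m (hw j)]
      apply hnc i k hi0 hk0 (m + n)
      rw [hm, e]
      ring
    · rw [← hj, hk] at hd
      obtain ⟨i, hi, m, hm⟩ := T.exists_neg_of_dvd_snd G' hw' hr' hS' hd
      have hi0 : i ≠ 0 := by
        rintro rfl
        apply hW0
        rw [h0, hk, hm, T.minpoly_neg (mul_ne_zero (pow_ne_zero _ T.s_ne_zero) (hw' k)),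
          T.minpoly_pow m (hw' k)]
      apply hnc j i hj0 hi0 (n + 2 * m)
      rw [e, hinv m _ _ hm]
      ring
  · rw [mem_cubicFactors hG]
    refine ⟨T.minpoly_irreducible _, T.minpoly_monic _, EuclideanDomain.dvd_gcd ?_ ?_,
      T.minpoly_natDegree (hw 0)⟩
    · exact T.minpoly_dvd_normPoly (hw 0) (hS 0)
    · exact T.minpoly_dvd_normPoly (hw 0) (h0 ▸ hS' 0)

/-- The first two alternatives of `hnc` are calls in which two input lines agree; they return before
any coincidence matters. -/
theorem subalgLines_eq_some (T : TraceCoords A B s θ η) {a b c d : ZMod p} (ha : a ≠ 0)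
    (hb : b ≠ 0) (hc : c ≠ 0) (hd : d ≠ 0) (hn : a + b ≠ 0) (hsum : a + b = c + d)
    (hab : a ≠ b) (hcd : c ≠ d)
    (hnc : (∃ n, a = s ^ n * b) ∨ (∃ n, c = s ^ n * d) ∨ NoCoincidence s a b c d)
    {g₁ g₂ g₃ g₄ l : TLine F}
    (h₁ : OnLine θ η a g₁) (h₂ : OnLine θ η b g₂) (h₃ : OnLine θ η c g₃) (h₄ : OnLine θ η d g₄)
    (hl : OnLine θ η (a + b) l) : subalgLines A B g₁ g₂ g₃ g₄ = some l := by
  unfold subalgLines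
  split_ifs with h12 h34 hf hf'
  · subst h12
    rw [T.onLine_unique hn hl (T.onLine_sum_of_eq ha hb hab h₁ h₂)]
  · subst h34
    have hn' := hn
    rw [hsum] at hl hn'
    rw [T.onLine_unique hn' hl (T.onLine_sum_of_eq hc hd hcd h₃ h₄)]
  all_goals
    have hnc' : ∀ j k : Fin 3, j ≠ 0 → k ≠ 0 → ∀ n,
        conjSums s a b j ≠ s ^ n * conjSums s c d k := by
      rcases hnc with ⟨n, h⟩ | ⟨n, h⟩ | h
      · exact absurd h (T.ne_pow_mul hb h₁ h₂ h12 n)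
      · exact absurd h (T.ne_pow_mul hd h₃ h₄ h34 n)
      · exact fun j k hj hk n => T.ne_of_noCoincidence h hj hk n
  · exact T.solveSystem_flip ha hb hc hd hn hsum h₁ h₂ h₃ h₄ hl h12 h34 hf hnc'
  · refine T.solveSystem_flip hc hd ha hb (hsum ▸ hn) hsum.symm h₃ h₄ h₁ h₂ (hsum ▸ hl) h34 h12
      hf' fun j k hj hk n h => hnc' k j hk hj (2 * n) ?_
    rw [h]
    have : s ^ (3 * n) = 1 := by rw [pow_mul, T.s_cube, one_pow]
    linear_combination (-conjSums s a b k) * this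
  · have h0 : conjSums s a b 0 = a + b := by simp [conjSums]
    have h0' : conjSums s c d 0 = c + d := by simp [conjSums]
    have hw := T.conjSums_ne_zero hb h₁ h₂ hf
    have hw' := T.conjSums_ne_zero hd h₃ h₄ hf'
    exact T.subalgTry_generic (T.isGeneric_sPoly hb h₂ hf) (T.isGeneric_sPoly hd h₄ hf') hw hw'
      (T.unrelated_conjSums ha hb (T.ne_pow_mul hb h₁ h₂ h12))
      (T.unrelated_conjSums hc hd (T.ne_pow_mul hd h₃ h₄ h34))
      (fun i => T.vanishes_sPoly ha hb h₁ h₂ h12 i (hw i))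
      (fun i => T.vanishes_sPoly hc hd h₃ h₄ h34 i (hw' i))
      (by rw [h0, h0', hsum]) hnc' (by rw [h0]; exact hl)

end TraceCoords

/-! ### Eisenstein integers as pairs -/

/-- The product of `x₁ + x₂ ω` and `y₁ + y₂ ω`, where `ω² + ω + 1 = 0`. -/
def eisMul (x y : ℤ × ℤ) : ℤ × ℤ := (x.1 * y.1 - x.2 * y.2, x.1 * y.2 + x.2 * y.1 - x.2 * y.2)

/-- The norm of `x₁ + x₂ ω` is positive and less than `10 ^ 6`. -/
def eisSmall (x : ℤ × ℤ) : Bool :=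
  decide (0 < x.1 ^ 2 - x.1 * x.2 + x.2 ^ 2 ∧ x.1 ^ 2 - x.1 * x.2 + x.2 ^ 2 < 10 ^ 6)

/-- The power `ω ^ j`. -/
def eisPow : ℕ → ℤ × ℤ
  | 0 => (1, 0)
  | n + 1 => eisMul (0, 1) (eisPow n)

/-- The image of `x₁ + x₂ ω` under `ω ↦ s`. -/
def eisEval {R : Type*} [CommRing R] (s : R) (x : ℤ × ℤ) : R := x.1 + x.2 * s

/-- A linear form `α X + β Y` with Eisenstein integer coefficients. -/
abbrev EisForm := (ℤ × ℤ) × (ℤ × ℤ)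

/-- The value of a linear form. -/
def EisForm.eval {R : Type*} [CommRing R] (s x y : R) (f : EisForm) : R :=
  eisEval s f.1 * x + eisEval s f.2 * y

/-- The product of a linear form with a scalar. -/
def EisForm.smul (c : ℤ × ℤ) (f : EisForm) : EisForm := (eisMul c f.1, eisMul c f.2)

/-- The difference of the two sides of a coincidence. -/
def coincidenceForm (a b c d : EisForm) (j k l : ℕ) : EisForm :=
  a + EisForm.smul (eisPow j) b - EisForm.smul (eisPow l) (c + EisForm.smul (eisPow k) d)

/-- Either the form is a nonzero multiple of `Y`, or its zeros are proportional to an element of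
the list `L`. -/
def EisForm.covered (L : List EisForm) (f : EisForm) : Bool :=
  (f.1 == 0 && eisSmall f.2) ||
    (eisSmall f.1 && L.any fun q => eisMul f.1 q.2 + eisMul f.2 q.1 == 0)

/-- All twelve coincidences are covered by the list `L`. -/
def coincidencesCovered (L : List EisForm) (a b c d : EisForm) : Bool :=
  [1, 2].all fun j => [1, 2].all fun k => [0, 1, 2].all fun l =>
    (coincidenceForm a b c d j k l).covered L

section Eisenstein

variable {R : Type*} [CommRing R] {s : R}

theorem eisEval_add (x y : ℤ × ℤ) : eisEval s (x + y) = eisEval s x + eisEval s y := by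
  simp only [eisEval, Prod.fst_add, Prod.snd_add, Int.cast_add]; ring

theorem eisEval_sub (x y : ℤ × ℤ) : eisEval s (x - y) = eisEval s x - eisEval s y := by
  simp only [eisEval, Prod.fst_sub, Prod.snd_sub, Int.cast_sub]; ring

theorem eisEval_zero : eisEval s 0 = 0 := by simp [eisEval]

theorem eisEval_mul (hs : s ^ 2 + s + 1 = 0) (x y : ℤ × ℤ) :
    eisEval s (eisMul x y) = eisEval s x * eisEval s y := by
  simp only [eisEval, eisMul]
  push_cast
  linear_combination (-(x.2 : R) * y.2) * hs

theorem eisEval_pow (hs : s ^ 2 + s + 1 = 0) (n : ℕ) : eisEval s (eisPow n) = s ^ n := by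
  induction n with
  | zero => simp [eisEval, eisPow]
  | succ n ih =>
    rw [eisPow, eisEval_mul hs, ih, pow_succ']
    simp [eisEval]

theorem eval_coincidenceForm (hs : s ^ 2 + s + 1 = 0) (x y : R) (a b c d : EisForm) (j k l : ℕ) :
    (coincidenceForm a b c d j k l).eval s x y = a.eval s x y + s ^ j * b.eval s x y -
      s ^ l * (c.eval s x y + s ^ k * d.eval s x y) := by
  simp only [coincidenceForm, EisForm.eval, EisForm.smul, Prod.fst_add, Prod.snd_add,
    Prod.fst_sub, Prod.snd_sub, eisEval_add, eisEval_sub, eisEval_mul hs, eisEval_pow hs]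
  ring

end Eisenstein

/-- The data of one call of the subalgorithm that computes the line of `(a + b)P`. -/
structure GoodCall {p : ℕ} (s a b c d : ZMod p) : Prop where
  a_ne : a ≠ 0
  b_ne : b ≠ 0
  c_ne : c ≠ 0
  d_ne : d ≠ 0
  sum_ne : a + b ≠ 0
  sum_eq : a + b = c + d
  ab_ne : a ≠ b
  cd_ne : c ≠ d
  cases : (∃ n, a = s ^ n * b) ∨ (∃ n, c = s ^ n * d) ∨ NoCoincidence s a b c d

/-- The conditions of `GoodCall`, for four Eisenstein integers. -/
def goodCallCheck (a b c d : ℤ × ℤ) : Bool :=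
  eisSmall a && eisSmall b && eisSmall c && eisSmall d && eisSmall (a + b) &&
  a + b == c + d && eisSmall (a - b) && eisSmall (c - d) &&
    coincidencesCovered [] (0, a) (0, b) (0, c) (0, d)

/-- The value `o` is a line through the point with coordinates `(θ u, η u)`. -/
def HasLine {F K R : Type*} [Field F] [Field K] [Algebra F K] (θ η : R → K) (u : R)
    (o : Option (TLine F)) : Prop :=
  ∃ h, o = some h ∧ OnLine θ η u h

/-- All conditions are homogeneous, so denominators may be cleared before checking them. -/
theorem GoodCall.of_mul {p : ℕ} [Fact p.Prime] {s a b c d x : ZMod p} (hx : x ≠ 0)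
    (h : GoodCall s (x * a) (x * b) (x * c) (x * d)) : GoodCall s a b c d := by
  refine ⟨right_ne_zero_of_mul h.a_ne, right_ne_zero_of_mul h.b_ne, right_ne_zero_of_mul h.c_ne,
    right_ne_zero_of_mul h.d_ne, fun e => h.sum_ne ?_, ?_, fun e => h.ab_ne (by rw [e]),
    fun e => h.cd_ne (by rw [e]), ?_⟩
  · linear_combination x * e
  · apply mul_left_cancel₀ hx
    linear_combination h.sum_eq
  · rcases h.cases with ⟨n, e⟩ | ⟨n, e⟩ | e
    · exact Or.inl ⟨n, mul_left_cancel₀ hx (by linear_combination e)⟩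
    · exact Or.inr (Or.inl ⟨n, mul_left_cancel₀ hx (by linear_combination e)⟩)
    · refine Or.inr (Or.inr fun j hj k hk l hl e' => e j hj k hk l hl ?_)
      linear_combination x * e'

/-! ### Verifying calls by computation with Eisenstein integers -/

namespace TraceCoords

variable {F K : Type*} [Field F] [Fintype F] [Field K] [Algebra F K] {A B : F}
  {p : ℕ} [Fact p.Prime] {s : ZMod p} {θ η : ZMod p → K}

theorem eisEval_ne_zero (T : TraceCoords A B s θ η) {x : ℤ × ℤ} (h : eisSmall x = true) :
    eisEval s x ≠ 0 := by
  rw [eisSmall, decide_eq_true_eq] at h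
  exact T.intCast_add_mul_ne_zero x.1 x.2 h.1 h.2

/-- Each coincidence is a linear form in x and y. Either it reduces to a unit times y, or its zero
ratio is that of an entry of L, which `hL` excludes; smallness of the coefficients makes them units
modulo p. -/
theorem noCoincidence_of_covered (T : TraceCoords A B s θ η) {x y : ZMod p} (hy : y ≠ 0)
    {L : List EisForm} (hL : ∀ q ∈ L, eisEval s q.1 * x ≠ eisEval s q.2 * y)
    (a b c d : EisForm) (h : coincidencesCovered L a b c d = true) :
    NoCoincidence s (a.eval s x y) (b.eval s x y) (c.eval s x y) (d.eval s x y) := by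
  intro j hj k hk l hl e
  simp only [coincidencesCovered, List.all_eq_true] at h
  have h1 := h j hj k hk l hl
  have h2 := eval_coincidenceForm T.quad x y a b c d j k l
  rw [e, sub_self] at h2
  generalize coincidenceForm a b c d j k l = f at h1 h2
  rw [EisForm.covered, Bool.or_eq_true, Bool.and_eq_true, Bool.and_eq_true, beq_iff_eq] at h1
  rw [EisForm.eval] at h2
  rcases h1 with ⟨h3, h4⟩ | ⟨h3, h4⟩
  · rw [h3, eisEval_zero, zero_mul, zero_add] at h2
    exact mul_ne_zero (T.eisEval_ne_zero h4) hy h2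
  · rw [List.any_eq_true] at h4
    obtain ⟨q, hq, h5⟩ := h4
    rw [beq_iff_eq] at h5
    have h6 := congrArg (eisEval s) h5
    rw [eisEval_add, eisEval_mul T.quad, eisEval_mul T.quad, eisEval_zero] at h6
    apply hL q hq
    apply mul_left_cancel₀ (T.eisEval_ne_zero h3)
    linear_combination eisEval s q.1 * h2 - y * h6

theorem goodCall_of_check (T : TraceCoords A B s θ η) (a b c d : ℤ × ℤ)
    (h : goodCallCheck a b c d = true) :
    GoodCall s (eisEval s a) (eisEval s b) (eisEval s c) (eisEval s d) := by
  simp only [goodCallCheck, Bool.and_eq_true, beq_iff_eq] at h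
  obtain ⟨⟨⟨⟨⟨⟨⟨⟨ha, hb⟩, hc⟩, hd⟩, hn⟩, hs⟩, hab⟩, hcd⟩, hnc⟩ := h
  have h1 := T.eisEval_ne_zero hn
  have h2 := T.eisEval_ne_zero hab
  have h3 := T.eisEval_ne_zero hcd
  have h4 := congrArg (eisEval s) hs
  rw [eisEval_add] at h1 h4
  rw [eisEval_add] at h4
  rw [eisEval_sub] at h2 h3
  have h5 := T.noCoincidence_of_covered (x := 0) (y := 1) one_ne_zero (L := []) (by simp)
    _ _ _ _ hnc
  simp only [EisForm.eval, mul_zero, mul_one, zero_add] at h5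
  exact ⟨T.eisEval_ne_zero ha, T.eisEval_ne_zero hb, T.eisEval_ne_zero hc, T.eisEval_ne_zero hd,
    h1, h4, sub_ne_zero.mp h2, sub_ne_zero.mp h3, Or.inr (Or.inr h5)⟩

theorem hasLine_dbl (T : TraceCoords A B s θ η) {u : ZMod p} (hu : u ≠ 0) {o : Option (TLine F)}
    (h : HasLine θ η u o) : HasLine θ η (2 * u) (dbl A B o) := by
  obtain ⟨g, rfl, hg⟩ := h
  exact ⟨_, rfl, by rw [two_mul]; exact T.onLine_double hu hg⟩

theorem hasLine_triple (T : TraceCoords A B s θ η) {u : ZMod p} (hu : u ≠ 0)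
    {o : Option (TLine F)} (h : HasLine θ η u o) :
    HasLine θ η (3 * u) (o.map (TLine.triple A B)) := by
  obtain ⟨g, rfl, hg⟩ := h
  exact ⟨_, rfl, by rw [show 3 * u = u + (u + u) by ring]; exact T.onLine_triple hu hg⟩

theorem hasLine_neg (T : TraceCoords A B s θ η) {u : ZMod p} (hu : u ≠ 0) {o : Option (TLine F)}
    (h : HasLine θ η u o) : HasLine θ η (-u) (neg o) := by
  obtain ⟨g, rfl, hg⟩ := h
  exact ⟨_, rfl, T.onLine_neg hu hg⟩

theorem hasLine_mul (T : TraceCoords A B s θ η) {u : ZMod p} (hu : u ≠ 0) {o : Option (TLine F)}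
    (h : HasLine θ η u o) : HasLine θ η (s * u) o := by
  obtain ⟨g, rfl, hg⟩ := h
  exact ⟨_, rfl, T.onLine_mul hu hg⟩

theorem hasLine_subalg (T : TraceCoords A B s θ η) {a b c d : ZMod p} (G : GoodCall s a b c d)
    {o₁ o₂ o₃ o₄ : Option (TLine F)} (h₁ : HasLine θ η a o₁) (h₂ : HasLine θ η b o₂)
    (h₃ : HasLine θ η c o₃) (h₄ : HasLine θ η d o₄) :
    HasLine θ η (a + b) (subalg A B o₁ o₂ o₃ o₄) := by
  obtain ⟨g₁, rfl, h₁⟩ := h₁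
  obtain ⟨g₂, rfl, h₂⟩ := h₂
  obtain ⟨g₃, rfl, h₃⟩ := h₃
  obtain ⟨g₄, rfl, h₄⟩ := h₄
  obtain ⟨l, hl⟩ := T.exists_onLine G.sum_ne
  exact ⟨l, T.subalgLines_eq_some G.a_ne G.b_ne G.c_ne G.d_ne G.sum_ne G.sum_eq G.ab_ne G.cd_ne
    G.cases h₁ h₂ h₃ h₄ hl, hl⟩

/-- The whole set-up is invariant under replacing P by xP, so the ladder may start from any nonzero
multiple. -/
theorem mul_right (T : TraceCoords A B s θ η) {x : ZMod p} (hx : x ≠ 0) :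
    TraceCoords A B s (fun u => θ (u * x)) (fun u => η (u * x)) where
  two_ne := T.two_ne
  three_ne := T.three_ne
  finrank_eq := T.finrank_eq
  large := T.large
  quad := T.quad
  equation u hu := T.equation _ (mul_ne_zero hu hx)
  x_mul u hu := by simp only [mul_assoc]; exact T.x_mul _ (mul_ne_zero hu hx)
  y_mul u hu := by simp only [mul_assoc]; exact T.y_mul _ (mul_ne_zero hu hx)
  x_neg u hu := by simp only [neg_mul]; exact T.x_neg _ (mul_ne_zero hu hx)
  y_neg u hu := by simp only [neg_mul]; exact T.y_neg _ (mul_ne_zero hu hx)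
  y_ne u hu := T.y_ne _ (mul_ne_zero hu hx)
  eq_or_eq_neg u v hu hv h := by
    rcases T.eq_or_eq_neg _ _ (mul_ne_zero hu hx) (mul_ne_zero hv hx) h with h | h
    · exact Or.inl (mul_right_cancel₀ hx h)
    · exact Or.inr (mul_right_cancel₀ hx (by rw [h, neg_mul]))
  add u v l hu hv h1 h2 := by
    simp only [add_mul]; exact T.add _ _ l (mul_ne_zero hu hx) (mul_ne_zero hv hx) h1 h2
  add_self u l hu h := by
    simp only [add_mul]; exact T.add_self _ l (mul_ne_zero hu hx) h

end TraceCoords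

/-! ### The ladder -/

/-- Pairs `(d, r)` for which `ladderM s` consists of the quotients `r / d`. -/
def ladderRoots : List EisForm :=
  [((1, 2), (3, 0)), ((1, 2), (-3, 0)), ((0, 3), (-4, 1)), ((1, 2), (-1, 4)), ((3, 3), (5, 1)),
    ((1, 2), (5, 4))]

/-- The pair `L` consists of the lines of `kP` and, unless `k + 1 ≥ p`, of `(k + 1)P`. -/
def PairCorrect {F K : Type*} [Field F] [Field K] [Algebra F K] {p : ℕ} (θ η : ZMod p → K)
    (k : ℕ) (L : LinePair F) : Prop :=
  HasLine θ η (k : ZMod p) L.1 ∧ (k + 1 < p → HasLine θ η ((k : ZMod p) + 1) L.2)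

theorem natCast_ne_natCast {p a b : ℕ} (ha : a < p) (hb : b < p) (h : a ≠ b) :
    (a : ZMod p) ≠ b := by
  intro e
  rw [ZMod.natCast_eq_natCast_iff', Nat.mod_eq_of_lt ha, Nat.mod_eq_of_lt hb] at e
  exact h e

theorem natCast_ne_zero {p a : ℕ} (ha : a < p) (h : a ≠ 0) : (a : ZMod p) ≠ 0 := by
  have := natCast_ne_natCast (b := 0) ha (by omega) h
  rwa [Nat.cast_zero] at this

theorem div_two_pow_eq (m i : ℕ) :
    m / 2 ^ i = 2 * (m / 2 ^ (i + 1)) + (if m.testBit i then 1 else 0) := by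
  have h := Nat.testBit_eq_decide_div_mod_eq (x := m) (i := i)
  rw [pow_succ, ← Nat.div_div_eq_div_mul]
  have h2 := Nat.mod_lt (m / 2 ^ i) (show 2 > 0 by norm_num)
  split_ifs with hb
  · rw [hb] at h
    have := of_decide_eq_true h.symm
    omega
  · have : ¬ (m / 2 ^ i % 2 = 1) := by
      intro h'
      rw [h'] at h
      exact hb (by simpa using h)
    omega

namespace TraceCoords

variable {F K : Type*} [Field F] [Fintype F] [Field K] [Algebra F K] {A B : F}
  {p : ℕ} [Fact p.Prime] {s : ZMod p} {θ η : ZMod p → K}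

theorem mem_ladderM_iff (T : TraceCoords A B s θ η) (n : ZMod p) :
    n ∈ ladderM s ↔ ∃ q ∈ ladderRoots, eisEval s q.1 * n = eisEval s q.2 := by
  have h1 : 2 * s + 1 ≠ 0 := by
    have := T.intCast_add_mul_ne_zero 1 2 (by norm_num) (by norm_num)
    intro h; apply this; push_cast; linear_combination h
  have h2 : 3 * s ≠ 0 := mul_ne_zero T.three_ne' T.s_ne_zero
  have h3 : 3 * (s + 1) ≠ 0 := by
    have := T.intCast_add_mul_ne_zero 3 3 (by norm_num) (by norm_num)
    intro h; apply this; push_cast; linear_combination h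
  simp only [ladderM, Set.mem_insert_iff, Set.mem_singleton_iff, ladderRoots, List.mem_cons,
    List.not_mem_nil, or_false, exists_eq_or_imp, exists_eq_left, eisEval]
  push_cast
  rw [eq_div_iff h1, eq_div_iff h1, eq_div_iff h2, eq_div_iff h1, eq_div_iff h3, eq_div_iff h1]
  refine or_congr ?_ (or_congr ?_ (or_congr ?_ (or_congr ?_ (or_congr ?_ ?_)))) <;>
    constructor <;> intro h <;> linear_combination h

theorem goodCall_ladder (T : TraceCoords A B s θ η) {k : ℕ} (hk : 2 ≤ k) (hkp : 2 * k + 1 < p)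
    (h : ((2 * k + 1 : ℕ) : ZMod p) ∉ ladderM s) :
    GoodCall s 1 (2 * (k : ZMod p)) k (k + 1) := by
  have h2k := natCast_ne_zero (p := p) (a := 2 * k) (by omega) (by omega)
  have hk0 := natCast_ne_zero (p := p) (a := k) (by omega) (by omega)
  have hk1 := natCast_ne_zero (p := p) (a := k + 1) (by omega) (by omega)
  have hn := natCast_ne_zero (p := p) (a := 2 * k + 1) (by omega) (by omega)
  have h12 := natCast_ne_natCast (p := p) (a := 1) (b := 2 * k) (by omega) (by omega) (by omega)
  have h11 := natCast_ne_natCast (p := p) (a := k) (b := 1) (by omega) (by omega) (by omega)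
  rw [T.mem_ladderM_iff] at h
  push_cast at *
  refine ⟨one_ne_zero, h2k, hk0, hk1, by rwa [add_comm], by ring, h12, by simp, ?_⟩
  refine Or.inr (Or.inr ?_)
  -- The variable is the computed index 2k + 1, and the four entries of the call are doubled to have
  -- integral coefficients. The two extra entries of the list are the cases k = 0 and k = 1.
  have := T.noCoincidence_of_covered (x := 2 * (k : ZMod p) + 1) (y := 1) one_ne_zero
    (L := ladderRoots ++ [((1, 0), (1, 0)), ((1, 0), (3, 0))]) (by
      intro q hq e
      rcases List.mem_append.mp hq with hq | hq
      · exact h ⟨q, hq, by rw [e, mul_one]⟩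
      · simp only [List.mem_cons, List.not_mem_nil, or_false] at hq
        rcases hq with rfl | rfl <;> simp [eisEval] at e
        · exact e.elim T.two_ne' hk0
        · apply h11
          apply mul_left_cancel₀ T.two_ne'
          linear_combination e)
    ((0, 0), (2, 0)) ((2, 0), (-2, 0)) ((1, 0), (-1, 0)) ((1, 0), (1, 0)) (by decide)
  intro j hj k' hk' l hl e
  apply this j hj k' hk' l hl
  simp only [EisForm.eval, eisEval]
  push_cast
  linear_combination 2 * e

/-- On the finite set M the index is a quotient r/d of Eisenstein integers. Multiplying the
replacement call by d turns its conditions into a finite check, independent of p and s. -/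
theorem goodCall_of_mem_ladderM (T : TraceCoords A B s θ η) {n : ZMod p} (h : n ∈ ladderM s)
    {a c : ℤ} (hac : (a, c) ∈ [((3 : ℤ), (7 : ℤ)), (3, -5), (-3, 5), (-3, -7)]) :
    GoodCall s (a : ZMod p) (n - a) c (n - c) := by
  obtain ⟨q, hq, e⟩ := (T.mem_ladderM_iff n).mp h
  have key : ∀ t ∈ [((3 : ℤ), (7 : ℤ)), (3, -5), (-3, 5), (-3, -7)], ∀ q ∈ ladderRoots,
      eisSmall q.1 ∧ goodCallCheck (eisMul q.1 (t.1, 0)) (q.2 - eisMul q.1 (t.1, 0))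
        (eisMul q.1 (t.2, 0)) (q.2 - eisMul q.1 (t.2, 0)) = true := by decide
  obtain ⟨h1, h2⟩ := key _ hac q hq
  have h3 := T.goodCall_of_check _ _ _ _ h2
  refine GoodCall.of_mul (T.eisEval_ne_zero h1) ?_
  simp only [eisEval_sub, eisEval_mul T.quad] at h3
  have h4 : ∀ t : ℤ, eisEval s (t, 0) = (t : ZMod p) := fun t => by simp [eisEval]
  rw [h4, h4] at h3
  rw [mul_sub, mul_sub, e]
  exact h3

/-- The first pass of the loop computes index 5 or 7, when no third previous pair is stored yet;
hence the exceptional branch never needs a missing pair. -/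
theorem ne_of_mem_ladderM (T : TraceCoords A B s θ η) {n : ZMod p} (h : n ∈ ladderM s) {a : ℤ}
    (ha : a ∈ [(5 : ℤ), 7]) : n ≠ a := by
  rintro rfl
  obtain ⟨q, hq, e⟩ := (T.mem_ladderM_iff _).mp h
  have key : ∀ a ∈ [(5 : ℤ), 7], ∀ q ∈ ladderRoots, eisSmall (eisMul q.1 (a, 0) - q.2) := by decide
  apply T.eisEval_ne_zero (key a ha q hq)
  rw [eisEval_sub, eisEval_mul T.quad, ← e]
  simp [eisEval]

theorem hasLine_five (T : TraceCoords A B s θ η) {h : Option (TLine F)} (hh : HasLine θ η 1 h) :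
    HasLine θ η 5 (subalg A B h (dbl A B (dbl A B h)) (dbl A B h)
      (h.map (TLine.triple A B))) := by
  have G := T.goodCall_of_check (1, 0) (4, 0) (2, 0) (3, 0) (by decide)
  simp only [eisEval, Int.cast_one, Int.cast_zero, zero_mul, add_zero, Int.cast_ofNat] at G
  have h2 := T.hasLine_dbl one_ne_zero hh
  have h4 := T.hasLine_dbl (by rw [mul_one]; exact T.two_ne') h2
  have h3 := T.hasLine_triple one_ne_zero hh
  rw [mul_one] at h2 h3
  rw [show (2 * (2 * 1) : ZMod p) = 4 by norm_num] at h4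
  have := T.hasLine_subalg G hh h4 h2 h3
  rwa [show (1 + 4 : ZMod p) = 5 by norm_num] at this

theorem hasLine_seven (T : TraceCoords A B s θ η) {h : Option (TLine F)} (hh : HasLine θ η 1 h) :
    HasLine θ η 7 (subalg A B h (dbl A B (h.map (TLine.triple A B))) (h.map (TLine.triple A B))
      (dbl A B (dbl A B h))) := by
  have G := T.goodCall_of_check (1, 0) (6, 0) (3, 0) (4, 0) (by decide)
  simp only [eisEval, Int.cast_one, Int.cast_zero, zero_mul, add_zero, Int.cast_ofNat] at G
  have h2 := T.hasLine_dbl one_ne_zero hh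
  have h4 := T.hasLine_dbl (by rw [mul_one]; exact T.two_ne') h2
  have h3 := T.hasLine_triple one_ne_zero hh
  rw [mul_one] at h3
  have h6 := T.hasLine_dbl T.three_ne' h3
  rw [show (2 * (2 * 1) : ZMod p) = 4 by norm_num] at h4
  rw [show (2 * 3 : ZMod p) = 6 by norm_num] at h6
  have := T.hasLine_subalg G hh h6 h3 h4
  rwa [show (1 + 6 : ZMod p) = 7 by norm_num] at this

theorem hasLine_ladderExc (T : TraceCoords A B s θ η) {h : Option (TLine F)}
    (hh : HasLine θ η 1 h) {m i : ℕ} {L₁ L₂ : LinePair F} (h1 : 1 ≤ m / 2 ^ (i + 3))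
    (h1p : 2 * (m / 2 ^ (i + 1)) + 1 < p)
    (hL₁ : PairCorrect θ η (m / 2 ^ (i + 3)) L₁) (hL₂ : PairCorrect θ η (m / 2 ^ (i + 2)) L₂)
    (hM : ((2 * (m / 2 ^ (i + 1)) + 1 : ℕ) : ZMod p) ∈ ladderM s) :
    HasLine θ η ((2 * (m / 2 ^ (i + 1)) + 1 : ℕ) : ZMod p) (ladderExc A B h m i L₁ L₂) := by
  have e1 := div_two_pow_eq m (i + 1)
  have e2 := div_two_pow_eq m (i + 2)
  rw [show i + 1 + 1 = i + 2 by ring] at e1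
  rw [show i + 2 + 1 = i + 3 by ring] at e2
  generalize m / 2 ^ (i + 1) = k at *
  generalize m / 2 ^ (i + 2) = k₂ at *
  generalize m / 2 ^ (i + 3) = k₃ at *
  have hlarge := T.large
  have h3 := T.hasLine_triple one_ne_zero hh
  rw [mul_one] at h3
  have h5 := T.hasLine_five hh
  have h7 := T.hasLine_seven hh
  have h5' : (5 : ZMod p) ≠ 0 := by exact_mod_cast natCast_ne_zero (p := p) (a := 5) (by omega) (by omega)
  have h7' : (7 : ZMod p) ≠ 0 := by exact_mod_cast natCast_ne_zero (p := p) (a := 7) (by omega) (by omega)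
  have dd : ∀ {u : ZMod p} {o : Option (TLine F)}, u ≠ 0 → HasLine θ η u o →
      HasLine θ η (2 * (2 * u)) (dbl A B (dbl A B o)) := fun hu ho =>
    T.hasLine_dbl (mul_ne_zero T.two_ne' hu) (T.hasLine_dbl hu ho)
  have ddd : ∀ {u : ZMod p} {o : Option (TLine F)}, u ≠ 0 → HasLine θ η u o →
      HasLine θ η (2 * (2 * (2 * u))) (dbl A B (dbl A B (dbl A B o))) := fun hu ho =>
    T.hasLine_dbl (mul_ne_zero T.two_ne' (mul_ne_zero T.two_ne' hu)) (dd hu ho)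
  have n2 := natCast_ne_zero (p := p) (a := k₂) (by omega) (by omega)
  have n3 := natCast_ne_zero (p := p) (a := k₃) (by omega) (by omega)
  have n2' := natCast_ne_zero (p := p) (a := k₂ + 1) (by omega) (by omega)
  have n3' := natCast_ne_zero (p := p) (a := k₃ + 1) (by omega) (by omega)
  have l2 := hL₂.2 (by omega)
  have l3 := hL₁.2 (by omega)
  push_cast at n2' n3' hM ⊢
  unfold ladderExc
  simp only []
  -- The index is 8k₃ + 4b₂ + 2b₁ + 1. In each of the four cases the fixed multiples ±3 and ±5 or ±7
  -- are those that leave 8k₃, 8(k₃ + 1), 4k₂ or 4(k₂ + 1), which repeated doubling provides.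
  split_ifs at e1 e2 ⊢ <;> subst e1 <;> subst e2 <;> push_cast at *
  · have G := T.goodCall_of_mem_ladderM hM (a := 3) (c := 7) (by decide)
    push_cast at G
    have := T.hasLine_subalg G h3 (o₂ := dbl A B (dbl A B L₂.1)) (by
      have h21 := hL₂.1
      push_cast at h21
      convert dd n2 h21 using 1; ring) h7 (o₄ := dbl A B (dbl A B (dbl A B L₁.1))) (by
      have := ddd n3 hL₁.1
      convert this using 1; ring)
    convert this using 1; ring
  · have G := T.goodCall_of_mem_ladderM hM (a := 3) (c := -5) (by decide)
    push_cast at G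
    have := T.hasLine_subalg G h3 (o₂ := dbl A B (dbl A B (dbl A B L₁.1))) (by
      have := ddd n3 hL₁.1
      convert this using 1; ring) (T.hasLine_neg h5' h5)
      (o₄ := dbl A B (dbl A B (dbl A B L₁.2))) (by
      have := ddd n3' l3
      convert this using 1; ring)
    convert this using 1; ring
  · have G := T.goodCall_of_mem_ladderM hM (a := -3) (c := 5) (by decide)
    push_cast at G
    have := T.hasLine_subalg G (T.hasLine_neg T.three_ne' h3)
      (o₂ := dbl A B (dbl A B (dbl A B L₁.2))) (by
      have := ddd n3' l3
      convert this using 1; ring) h5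
      (o₄ := dbl A B (dbl A B (dbl A B L₁.1))) (by
      have := ddd n3 hL₁.1
      convert this using 1; ring)
    convert this using 1; ring
  · have G := T.goodCall_of_mem_ladderM hM (a := -3) (c := -7) (by decide)
    push_cast at G
    have := T.hasLine_subalg G (T.hasLine_neg T.three_ne' h3)
      (o₂ := dbl A B (dbl A B L₂.2)) (by
      have := dd n2' l2
      convert this using 1; ring) (T.hasLine_neg h7' h7)
      (o₄ := dbl A B (dbl A B (dbl A B L₁.2))) (by
      have := ddd n3' l3
      convert this using 1; ring)
    convert this using 1; ring

end TraceCoords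

/-- The list `L` of pairs stored by the ladder after step `i` is correct. -/
def LadderState {F K : Type*} [Field F] [Field K] [Algebra F K] {p : ℕ} (θ η : ZMod p → K)
    (m i : ℕ) (L : List (LinePair F)) : Prop :=
  1 ≤ m / 2 ^ (i + 1) ∧ ∃ L₁ L₂, PairCorrect θ η (m / 2 ^ (i + 1)) L₁ ∧
    PairCorrect θ η (m / 2 ^ i) L₂ ∧ ((m / 2 ^ (i + 2) = 0 ∧ L = [L₁, L₂]) ∨
      (1 ≤ m / 2 ^ (i + 2) ∧ ∃ L₀, L = [L₀, L₁, L₂] ∧ PairCorrect θ η (m / 2 ^ (i + 2)) L₀))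

/-- Exactly one of kᵢ and kᵢ + 1 is odd, namely 2kᵢ₊₁ + 1, the index that doubling does not give. -/
theorem ladderExceptional_iff {p : ℕ} [Fact p.Prime] (s : ZMod p) {m i : ℕ}
    (h : 2 * (m / 2 ^ (i + 1)) + 1 < p) :
    (LadderExceptional s (m / 2 ^ i) ∨ LadderExceptional s (m / 2 ^ i + 1)) ↔
      ((2 * (m / 2 ^ (i + 1)) + 1 : ℕ) : ZMod p) ∈ ladderM s := by
  have e := div_two_pow_eq m i
  generalize m / 2 ^ (i + 1) = k at *
  unfold LadderExceptional
  split_ifs at e <;> rw [e]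
  · constructor
    · rintro (h | h)
      · exact h.2.2
      · exact absurd h.2.1 (by rw [Nat.not_odd_iff_even]; exact ⟨k + 1, by ring⟩)
    · exact fun h' => Or.inl ⟨h, ⟨k, rfl⟩, h'⟩
  · constructor
    · rintro (h | h)
      · exact absurd h.2.1 (by rw [Nat.not_odd_iff_even]; exact ⟨k, by ring⟩)
      · exact h.2.2
    · exact fun h' => Or.inr ⟨h, ⟨k, rfl⟩, h'⟩

namespace TraceCoords

variable {F K : Type*} [Field F] [Fintype F] [Field K] [Algebra F K] {A B : F}
  {p : ℕ} [Fact p.Prime] {s : ZMod p} {θ η : ZMod p → K}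

theorem pairCorrect_double (T : TraceCoords A B s θ η) {k : ℕ} (hk : 1 ≤ k) (_ : 2 * k < p)
    {L : LinePair F} (hL : PairCorrect θ η k L) {w : Option (TLine F)}
    (hw : 2 * k + 1 < p → HasLine θ η ((2 * k + 1 : ℕ) : ZMod p) w) :
    PairCorrect θ η (2 * k) (dbl A B L.1, w) := by
  refine ⟨?_, fun h => ?_⟩
  · push_cast
    exact T.hasLine_dbl (natCast_ne_zero (by omega) (by omega)) hL.1
  · have := hw h
    push_cast at this ⊢
    exact this

theorem pairCorrect_double_add_one (T : TraceCoords A B s θ η) {k : ℕ} (_ : 2 * k + 1 < p)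
    {L : LinePair F} (hL : PairCorrect θ η k L) {w : Option (TLine F)}
    (hw : HasLine θ η ((2 * k + 1 : ℕ) : ZMod p) w) :
    PairCorrect θ η (2 * k + 1) (w, dbl A B L.2) := by
  refine ⟨hw, fun h => ?_⟩
  have h1 := natCast_ne_zero (p := p) (a := k + 1) (by omega) (by omega)
  push_cast at h1 ⊢
  rw [show (2 * (k : ZMod p) + 1 + 1) = 2 * (k + 1) by ring]
  exact T.hasLine_dbl h1 (hL.2 (by omega))

theorem hasLine_ladder (T : TraceCoords A B s θ η) {h : Option (TLine F)} (hh : HasLine θ η 1 h)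
    {k : ℕ} (hk : 2 ≤ k) (hkp : 2 * k + 1 < p)
    (hM : ((2 * k + 1 : ℕ) : ZMod p) ∉ ladderM s) {L : LinePair F} (hL : PairCorrect θ η k L) :
    HasLine θ η ((2 * k + 1 : ℕ) : ZMod p) (subalg A B h (dbl A B L.1) L.1 L.2) := by
  have := T.hasLine_subalg (T.goodCall_ladder hk hkp hM) hh
    (T.hasLine_dbl (natCast_ne_zero (by omega) (by omega)) hL.1) hL.1 (hL.2 (by omega))
  push_cast
  rwa [add_comm]

theorem ladderState_step (T : TraceCoords A B s θ η) {h : Option (TLine F)}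
    (hh : HasLine θ η 1 h) {m i : ℕ} (hm : m < p) {L : List (LinePair F)}
    (hL : LadderState θ η m (i + 1) L) : LadderState θ η m i (ladderStep A B s h m L i) := by
  obtain ⟨h1, L₁, L₂, hL₁, hL₂, hcases⟩ := hL
  rw [show i + 1 + 1 = i + 2 by ring] at h1 hL₁
  rw [show i + 1 + 2 = i + 3 by ring] at hcases
  have e0 := div_two_pow_eq m i
  have e1 := div_two_pow_eq m (i + 1)
  have e2 := div_two_pow_eq m (i + 2)
  rw [show i + 1 + 1 = i + 2 by ring] at e1
  rw [show i + 2 + 1 = i + 3 by ring] at e2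
  have hk : 2 ≤ m / 2 ^ (i + 1) := by omega
  have hki : m / 2 ^ i < p := (Nat.div_le_self _ _).trans_lt hm
  have key : ∀ w, (2 * (m / 2 ^ (i + 1)) + 1 < p →
      HasLine θ η ((2 * (m / 2 ^ (i + 1)) + 1 : ℕ) : ZMod p) w) →
      LadderState θ η m i (if m.testBit i then [L₁, L₂] ++ [(w, dbl A B L₂.2)]
        else [L₁, L₂] ++ [(dbl A B L₂.1, w)]) := by
    intro w hw
    refine ⟨by omega, L₂, if m.testBit i then (w, dbl A B L₂.2) else (dbl A B L₂.1, w), hL₂, ?_,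
      Or.inr ⟨h1, L₁, by split_ifs <;> rfl, hL₁⟩⟩
    rw [e0]
    split_ifs at e0 ⊢
    · exact T.pairCorrect_double_add_one (by omega) hL₂ (hw (by omega))
    · exact T.pairCorrect_double (by omega) (by omega) hL₂ hw
  rcases hcases with ⟨h0, rfl⟩ | ⟨h3, L₀, rfl, hL₀⟩
  · simp only [ladderStep, List.length_cons, List.length_nil, List.getD_cons_succ,
      List.getD_cons_zero]
    refine key _ fun hlt => ?_
    have hiff := ladderExceptional_iff s hlt
    have hM : ((2 * (m / 2 ^ (i + 1)) + 1 : ℕ) : ZMod p) ∉ ladderM s := by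
      intro hM
      have h5 := T.ne_of_mem_ladderM hM (a := 5) (by decide)
      have h7 := T.ne_of_mem_ladderM hM (a := 7) (by decide)
      have : m / 2 ^ (i + 1) = 2 ∨ m / 2 ^ (i + 1) = 3 := by
        -- With only two pairs stored, kᵢ₊₁ has two binary digits.
        split_ifs at e1 e2 <;> omega
      rcases this with e | e <;> rw [e] at h5 h7
      · exact h5 (by norm_num)
      · exact h7 (by norm_num)
    rw [if_neg (mt hiff.mp hM)]
    exact T.hasLine_ladder hh hk hlt hM hL₂
  · simp only [ladderStep, List.length_cons, List.length_nil, List.getD_cons_succ,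
      List.getD_cons_zero, List.tail_cons]
    refine key _ fun hlt => ?_
    have hiff := ladderExceptional_iff s hlt
    simp only [if_true]
    split_ifs with hM
    · exact T.hasLine_ladderExc hh h3 hlt hL₀ hL₁ (hiff.mp hM)
    · exact T.hasLine_ladder hh hk hlt (mt hiff.mpr hM) hL₂

theorem ladderState_foldl (T : TraceCoords A B s θ η) {h : Option (TLine F)}
    (hh : HasLine θ η 1 h) {m : ℕ} (hm : m < p) (n : ℕ) (L : List (LinePair F))
    (hL : LadderState θ η m n L) :
    LadderState θ η m 0 ((List.range n).reverse.foldl (ladderStep A B s h m) L) := by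
  induction n generalizing L with
  | zero => simpa using hL
  | succ n ih =>
    rw [List.range_succ, List.reverse_append, List.reverse_singleton, List.singleton_append,
      List.foldl_cons]
    exact ih _ (T.ladderState_step hh hm hL)

theorem ladderState_start (T : TraceCoords A B s θ η) {h : Option (TLine F)}
    (hh : HasLine θ η 1 h) {m : ℕ} (hm : 2 ≤ m.size) :
    LadderState θ η m (m.size - 2) (ladderStart A B h m) := by
  have hlarge := T.large
  obtain ⟨n, hn⟩ : ∃ n, m.size = n + 2 := ⟨m.size - 2, by omega⟩
  have e0 := div_two_pow_eq m n
  have e1 := div_two_pow_eq m (n + 1)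
  have hlt : m < 2 ^ (n + 2) := by rw [← hn]; exact Nat.lt_size_self m
  have hle : 2 ^ (n + 1) ≤ m := Nat.lt_size.mp (by omega)
  have h2 : m / 2 ^ (n + 2) = 0 := Nat.div_eq_of_lt hlt
  have h1 : 1 ≤ m / 2 ^ (n + 1) := by
    rw [Nat.le_div_iff_mul_le (by positivity)]; omega
  have h1' : m / 2 ^ (n + 1) = 1 := by
    rw [show n + 1 + 1 = n + 2 by ring, h2] at e1
    split_ifs at e1 <;> omega
  have hd2 := T.hasLine_dbl one_ne_zero hh
  have hd4 := T.hasLine_dbl (by rw [mul_one]; exact T.two_ne') hd2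
  have hd3 := T.hasLine_triple one_ne_zero hh
  rw [mul_one] at hd2 hd3
  have c1 : PairCorrect θ η 1 (h, dbl A B h) := by
    refine ⟨by simpa using hh, fun _ => ?_⟩
    rwa [Nat.cast_one, one_add_one_eq_two]
  rw [ladderStart, hn, Nat.add_sub_cancel]
  refine ⟨h1, (h, dbl A B h), if m.testBit n then (h.map (TLine.triple A B), dbl A B (dbl A B h))
    else (dbl A B h, h.map (TLine.triple A B)), ?_, ?_, Or.inl ⟨h2, rfl⟩⟩
  · rw [h1']; exact c1
  · rw [e0, h1']
    split_ifs
    · exact T.pairCorrect_double_add_one (by omega) c1 (by push_cast; exact hd3)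
    · exact T.pairCorrect_double (by omega) (by omega) c1 (fun _ => by push_cast; exact hd3)

/-- Correctness of the ladder. -/
theorem pairCorrect_alg1 (T : TraceCoords A B s θ η) {h : Option (TLine F)}
    (hh : HasLine θ η 1 h) {m : ℕ} (h0 : m ≠ 0) (hm : m < p) :
    PairCorrect θ η m (alg1 A B s h m) := by
  rw [alg1, if_neg h0]
  split_ifs with h1
  · have hlt := Nat.lt_size_self m
    rw [h1] at hlt
    have : m = 1 := by omega
    subst this
    refine ⟨by simpa using hh, fun _ => ?_⟩
    have := T.hasLine_dbl one_ne_zero hh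
    rw [mul_one, ← one_add_one_eq_two] at this
    rwa [Nat.cast_one]
  · have h2 : 2 ≤ m.size := by
      have : m.size ≠ 0 := by rwa [Ne, Nat.size_eq_zero]
      omega
    obtain ⟨-, L₁, L₂, -, hL, hc⟩ := T.ladderState_foldl hh hm _ _ (T.ladderState_start hh h2)
    rw [pow_zero, Nat.div_one] at hL
    rcases hc with ⟨-, e⟩ | ⟨-, L₀, e, -⟩ <;> rw [e] <;> exact hL

theorem hasLine_alg1 (T : TraceCoords A B s θ η) {x : ZMod p} (hx : x ≠ 0)
    {h : Option (TLine F)} (hh : HasLine θ η x h) {u : ZMod p} (hu : u ≠ 0) :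
    HasLine θ η (u * x) (alg1 A B s h u.val).1 := by
  have hh' : HasLine (fun u => θ (u * x)) (fun u => η (u * x)) 1 h := by
    obtain ⟨g, rfl, hg⟩ := hh
    exact ⟨g, rfl, by simpa [OnLine] using hg⟩
  have := ((T.mul_right hx).pairCorrect_alg1 hh' (m := u.val) (by rwa [Ne, ZMod.val_eq_zero])
    (ZMod.val_lt u)).1
  rw [ZMod.natCast_zmod_val] at this
  exact this

theorem hasLine_alg1_snd (T : TraceCoords A B s θ η) {h : Option (TLine F)}
    (hh : HasLine θ η 1 h) {u : ZMod p} (hu : u ≠ 0) (hu1 : u + 1 ≠ 0) :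
    HasLine θ η (u + 1) (alg1 A B s h u.val).2 := by
  have := (T.pairCorrect_alg1 hh (m := u.val) (by rwa [Ne, ZMod.val_eq_zero])
    (ZMod.val_lt u)).2 ?_
  · rwa [ZMod.natCast_zmod_val] at this
  · have := ZMod.val_lt u
    -- The second line is only claimed below p, and the representative of u reaches p - 1 exactly
    -- when u + 1 = 0.
    refine lt_of_le_of_ne this fun e => hu1 ?_
    have e' := congrArg (Nat.cast (R := ZMod p)) e
    rwa [Nat.cast_succ, ZMod.natCast_zmod_val, ZMod.natCast_self] at e'

end TraceCoords

/-! ### The Frobenius reduction -/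

/-- Pairs `(d, r)` for which `excA₁ s ∪ excA₂ s` consists of the quotients `r / d`. -/
def excARoots : List EisForm :=
  [((1, 0), (-2, 0)), ((1, 0), (0, 1)), ((2, 1), (-3, -3)), ((2, 1), (-3, 0)), ((-1, 1), (2, 1)),
    ((1, 2), (-3, 0)), ((1, 0), (1, 0)), ((-3, 0), (1, 2)), ((0, 3), (1, -1))]

/-- Pairs `(d, r)` such that `s ∈ excB₁ m₀ m₁` if and only if `d m₀ = r m₁` for one of them. -/
def excB₁Roots : List EisForm :=
  [((3, 0), (-1, 1)), ((0, 3), (1, -1)), ((1, 2), (1, -1)), ((-2, -1), (1, -1)),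
    ((-1, -2), (2, 1)), ((-3, -3), (2, 1)), ((0, -3), (2, 1))]

/-- Pairs `(d, r)` such that `s ∈ excB₂ m₀ m₁` if and only if `d m₀ = r m₁` for one of them. -/
def excB₂Roots : List EisForm :=
  [((-1, -2), (3, 3)), ((2, 1), (-3, -3)), ((-1, 1), (-1, -2)), ((-1, 1), (2, 1)),
    ((-2, -1), (3, 0)), ((-1, -2), (3, 0))]

/-- The determinant of two linear forms `d X - r Y`. -/
def EisForm.det (q r : EisForm) : ℤ × ℤ := eisMul q.1 r.2 - eisMul q.2 r.1

namespace TraceCoords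

variable {F K : Type*} [Field F] [Fintype F] [Field K] [Algebra F K] {A B : F}
  {p : ℕ} [Fact p.Prime] {s : ZMod p} {θ η : ZMod p → K}

theorem not_both_of_det (T : TraceCoords A B s θ η) {x y : ZMod p} (hx : x ≠ 0) {q r : EisForm}
    (h : eisSmall (q.det r) = true) (hq : eisEval s q.1 * x = eisEval s q.2 * y)
    (hr : eisEval s r.1 * x = eisEval s r.2 * y) : False := by
  refine mul_ne_zero (T.eisEval_ne_zero h) hx ?_
  rw [EisForm.det, eisEval_sub, eisEval_mul T.quad, eisEval_mul T.quad]
  linear_combination eisEval s r.2 * hq - eisEval s q.2 * hr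

theorem mem_excA_iff (T : TraceCoords A B s θ η) (x : ZMod p) :
    x ∈ excA₁ s ∪ excA₂ s ↔ ∃ q ∈ excARoots, eisEval s q.1 * x = eisEval s q.2 := by
  have h1 : 2 + s ≠ 0 := by
    simpa [eisEval] using T.eisEval_ne_zero (x := (2, 1)) (by decide)
  have h2 : s - 1 ≠ 0 := by
    have := T.eisEval_ne_zero (x := (-1, 1)) (by decide)
    intro h; apply this; simp only [eisEval]; push_cast; linear_combination h
  have h3 : 2 * s + 1 ≠ 0 := by
    have := T.eisEval_ne_zero (x := (1, 2)) (by decide)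
    intro h; apply this; simp only [eisEval]; push_cast; linear_combination h
  have h4 : (-3 : ZMod p) ≠ 0 := neg_ne_zero.mpr T.three_ne'
  have h5 : 3 * s ≠ 0 := mul_ne_zero T.three_ne' T.s_ne_zero
  simp only [excA₁, excA₂, Set.mem_union, Set.mem_insert_iff, Set.mem_singleton_iff, excARoots,
    List.mem_cons, List.not_mem_nil, or_false, exists_eq_or_imp, exists_eq_left, eisEval]
  push_cast
  rw [eq_div_iff h1, eq_div_iff h1, eq_div_iff h2, eq_div_iff h3, eq_div_iff h4, eq_div_iff h5]
  constructor
  · rintro ((h | h | h | h | h | h) | (h | h | h | h | h))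
    · exact Or.inl (by linear_combination h)
    · exact Or.inr (Or.inl (by linear_combination h))
    · exact Or.inr (Or.inr (Or.inl (by linear_combination h)))
    · exact Or.inr (Or.inr (Or.inr (Or.inl (by linear_combination h))))
    · exact Or.inr (Or.inr (Or.inr (Or.inr (Or.inl (by linear_combination h)))))
    · exact Or.inr (Or.inr (Or.inr (Or.inr (Or.inr (Or.inl (by linear_combination h))))))
    · exact Or.inr (Or.inr (Or.inr (Or.inr (Or.inr (Or.inr (Or.inl (by linear_combination h)))))))
    · exact Or.inr (Or.inl (by linear_combination h))
    · exact Or.inr (Or.inr (Or.inr (Or.inr (Or.inl (by linear_combination h)))))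
    · exact Or.inr (Or.inr (Or.inr (Or.inr (Or.inr (Or.inr (Or.inr (Or.inl
        (by linear_combination h))))))))
    · exact Or.inr (Or.inr (Or.inr (Or.inr (Or.inr (Or.inr (Or.inr (Or.inr
        (by linear_combination h))))))))
  · rintro (h | h | h | h | h | h | h | h | h)
    · exact Or.inl (Or.inl (by linear_combination h))
    · exact Or.inl (Or.inr (Or.inl (by linear_combination h)))
    · exact Or.inl (Or.inr (Or.inr (Or.inl (by linear_combination h))))
    · exact Or.inl (Or.inr (Or.inr (Or.inr (Or.inl (by linear_combination h)))))
    · exact Or.inl (Or.inr (Or.inr (Or.inr (Or.inr (Or.inl (by linear_combination h))))))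
    · exact Or.inl (Or.inr (Or.inr (Or.inr (Or.inr (Or.inr (by linear_combination h))))))
    · exact Or.inr (Or.inl (by linear_combination h))
    · exact Or.inr (Or.inr (Or.inr (Or.inr (Or.inl (by linear_combination h)))))
    · exact Or.inr (Or.inr (Or.inr (Or.inr (Or.inr (by linear_combination h)))))

theorem mem_excB₁_iff (T : TraceCoords A B s θ η) {m₀ m₁ : ZMod p} (h : m₁ ≠ 0) :
    s ∈ excB₁ m₀ m₁ ↔ ∃ q ∈ excB₁Roots, eisEval s q.1 * m₀ = eisEval s q.2 * m₁ := by
  -- The restriction to nonzero denominators can be dropped: if numerator and denominator vanished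
  -- together, m₁ would be zero.
  have key : ∀ a b : ZMod p, (b = 0 → a = 0 → m₁ = 0) → ((b ≠ 0 ∧ s = a / b) ↔ s * b = a) := by
    intro a b hab
    constructor
    · rintro ⟨hb, e⟩
      exact (eq_div_iff hb).mp e
    · intro e
      have hb : b ≠ 0 := fun hb => h (hab hb (by rw [← e, hb, mul_zero]))
      exact ⟨hb, (eq_div_iff hb).mpr e⟩
  have c3 : ∀ {z : ZMod p}, 3 * z = 0 → z = 0 := fun hz =>
    (mul_eq_zero.mp hz).resolve_left T.three_ne'
  have c2 : ∀ {z : ZMod p}, 2 * z = 0 → z = 0 := fun hz =>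
    (mul_eq_zero.mp hz).resolve_left T.two_ne'
  simp only [excB₁, Set.mem_ofPred_eq, excB₁Roots,
    List.mem_cons, List.not_mem_nil, or_false, exists_eq_or_imp, exists_eq_left, eisEval]
  rw [key _ _ fun e1 e2 => e1, key _ _ fun e1 e2 => e2,
    key _ _ fun e1 e2 => c3 (by linear_combination e1 + 2 * e2),
    key _ _ fun e1 e2 => c3 (by linear_combination 2 * e1 + e2),
    key _ _ fun e1 e2 => c3 (by linear_combination e1 + 2 * e2),
    key _ _ fun e1 e2 => by linear_combination e1 + e2, key _ _ fun e1 e2 => c2 e2]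
  push_cast
  refine or_congr ?_ (or_congr ?_ (or_congr ?_ (or_congr ?_ (or_congr ?_ (or_congr ?_ ?_))))) <;>
    constructor <;> intro e <;> first | linear_combination e | linear_combination -e

theorem mem_excB₂_iff (T : TraceCoords A B s θ η) {m₀ m₁ : ZMod p} (h : m₀ ≠ 0) :
    s ∈ excB₂ m₀ m₁ ↔ ∃ q ∈ excB₂Roots, eisEval s q.1 * m₀ = eisEval s q.2 * m₁ := by
  have key : ∀ a b : ZMod p, (b = 0 → a = 0 → m₀ = 0) → ((b ≠ 0 ∧ s = a / b) ↔ s * b = a) := by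
    intro a b hab
    constructor
    · rintro ⟨hb, e⟩
      exact (eq_div_iff hb).mp e
    · intro e
      have hb : b ≠ 0 := fun hb => h (hab hb (by rw [← e, hb, mul_zero]))
      exact ⟨hb, (eq_div_iff hb).mpr e⟩
  have c3 : ∀ {z : ZMod p}, 3 * z = 0 → z = 0 := fun hz =>
    (mul_eq_zero.mp hz).resolve_left T.three_ne'
  have c2 : ∀ {z : ZMod p}, 2 * z = 0 → z = 0 := fun hz =>
    (mul_eq_zero.mp hz).resolve_left T.two_ne'
  simp only [excB₂, Set.mem_ofPred_eq, excB₂Roots,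
    List.mem_cons, List.not_mem_nil, or_false, exists_eq_or_imp, exists_eq_left, eisEval]
  rw [key _ _ fun e1 e2 => by linear_combination -e1 - e2,
    key _ _ fun e1 e2 => by linear_combination -e1 - e2,
    key _ _ fun e1 e2 => c3 (by linear_combination e1 + 2 * e2),
    key _ _ fun e1 e2 => c3 (by linear_combination 2 * e1 + e2),
    key _ _ fun e1 e2 => by linear_combination -e1,
    key _ _ fun e1 e2 => c2 (by linear_combination -e1)]
  push_cast
  refine or_congr ?_ (or_congr ?_ (or_congr ?_ (or_congr ?_ (or_congr ?_ ?_)))) <;>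
    constructor <;> intro e <;> linear_combination e

/-- Membership in each set fixes the ratio m₀/m₁ as a quotient of small Eisenstein integers. The
lists are compatible only at the primitive cube roots of unity, so t² + t + 1 is the only polynomial
of ℛ that step 2 needs. -/
theorem norm_eq_zero_of_mem_excB (T : TraceCoords A B s θ η) {m₀ m₁ : ZMod p} (h₀ : m₀ ≠ 0)
    (h₁ : m₁ ≠ 0) (h : s ∈ excB₁ m₀ m₁ ∩ excB₂ m₀ m₁) : m₀ ^ 2 + m₀ * m₁ + m₁ ^ 2 = 0 := by
  obtain ⟨q, hq, e⟩ := (T.mem_excB₁_iff h₁).mp h.1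
  obtain ⟨r, hr, e'⟩ := (T.mem_excB₂_iff h₀).mp h.2
  have key : ∀ q ∈ excB₁Roots, ∀ r ∈ excB₂Roots, eisSmall (q.det r) = true ∨
      (eisSmall q.1 = true ∧
        eisMul q.2 q.2 + eisMul q.2 q.1 + eisMul q.1 q.1 = 0) := by decide
  rcases key q hq r hr with h2 | ⟨h2, h3⟩
  · exact (T.not_both_of_det h₀ h2 e e').elim
  · have h4 := congrArg (eisEval s) h3
    rw [eisEval_add, eisEval_add, eisEval_mul T.quad, eisEval_mul T.quad, eisEval_mul T.quad,
      eisEval_zero] at h4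
    have h5 := T.eisEval_ne_zero h2
    refine (mul_eq_zero.mp ?_).resolve_left (pow_ne_zero 2 h5)
    linear_combination (eisEval s q.1 * m₀ + eisEval s q.2 * m₁ + eisEval s q.1 * m₁) * e +
      m₁ ^ 2 * h4

theorem hasLine_precompA (T : TraceCoords A B s θ η) {h : Option (TLine F)}
    (hh : HasLine θ η 1 h) {x : ZMod p} (hx : x ∈ excA₁ s ∪ excA₂ s) :
    HasLine θ η (x * (1 - s)) (precompA A B s h x) := by
  have h1 : s - 1 ≠ 0 := by
    have := T.eisEval_ne_zero (x := (-1, 1)) (by decide)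
    intro h; apply this; simp only [eisEval]; push_cast; linear_combination h
  have h2 : 1 - s ≠ 0 := by rwa [← neg_sub, neg_ne_zero]
  have hx0 : x ≠ 0 := by
    rintro rfl
    obtain ⟨q, hq, e⟩ := (T.mem_excA_iff 0).mp hx
    have key : ∀ q ∈ excARoots, eisSmall q.2 = true := by decide
    rw [mul_zero] at e
    exact T.eisEval_ne_zero (key q hq) e.symm
  rw [precompA, if_pos hx]
  refine T.hasLine_alg1 h2 ?_ hx0
  have := T.hasLine_neg (mul_ne_zero h1 one_ne_zero) (T.hasLine_alg1 one_ne_zero hh h1)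
  rwa [mul_one, neg_sub] at this

theorem hasLine_precompR (T : TraceCoords A B s θ η) {h : Option (TLine F)}
    (hh : HasLine θ η 1 h) {α : ZMod p} (hα : α ∈ excRoots p) (h0 : s + α ≠ 0) :
    HasLine θ η (s + α) (precompR A B s h α) := by
  rw [precompR, if_pos hα]
  have := T.hasLine_alg1 one_ne_zero hh h0
  rwa [mul_one] at this

theorem goodCall_oneSub_fst (T : TraceCoords A B s θ η) {x : ZMod p}
    (hx : x ∉ excA₁ s ∪ excA₂ s) (h : CallAllowed s x (x + 1) (s - 1)) (h0 : x + s ≠ 0) :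
    GoodCall s s x (x + 1) (s - 1) := by
  obtain ⟨h1, h2, h3, h4, h5, h6⟩ := h
  rw [T.mem_excA_iff] at hx
  refine ⟨h1, h2, h3, h4, by rwa [add_comm], by ring, h5, h6, Or.inr (Or.inr ?_)⟩
  -- Besides 𝒜, coincidences occur at x = 0 and x = -s, which the nonvanishing conditions exclude.
  have := T.noCoincidence_of_covered (x := x) (y := 1) one_ne_zero (L := excARoots ++
    [((1, 0), (0, 0)), ((1, 0), (0, -1))]) (by
      intro q hq e
      rcases List.mem_append.mp hq with hq | hq
      · exact hx ⟨q, hq, by rw [e, mul_one]⟩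
      · simp only [List.mem_cons, List.not_mem_nil, or_false] at hq
        rcases hq with rfl | rfl <;> simp [eisEval] at e
        · exact h2 e
        · exact h0 (by rw [e]; ring))
    ((0, 0), (0, 1)) ((1, 0), (0, 0)) ((1, 0), (1, 0)) ((0, 0), (-1, 1)) (by decide)
  intro j hj k' hk' l hl e
  apply this j hj k' hk' l hl
  simp only [EisForm.eval, eisEval]
  push_cast
  linear_combination e

theorem goodCall_oneSub_snd (T : TraceCoords A B s θ η) {x : ZMod p}
    (hx : x ∉ excA₁ s ∪ excA₂ s) (h : CallAllowed x (-(s * x)) (-(s * (x + 1))) (x + s)) :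
    GoodCall s x (-(s * x)) (-(s * (x + 1))) (x + s) := by
  obtain ⟨h1, h2, h3, h4, h5, h6⟩ := h
  have hs1 : 1 - s ≠ 0 := by
    have := T.eisEval_ne_zero (x := (1, -1)) (by decide)
    intro h; apply this; simp only [eisEval]; push_cast; linear_combination h
  rw [T.mem_excA_iff] at hx
  refine ⟨h1, h2, h3, h4, ?_, by ring, h5, h6, Or.inr (Or.inr ?_)⟩
  · rw [show x + -(s * x) = (1 - s) * x by ring]
    exact mul_ne_zero hs1 h1
  have := T.noCoincidence_of_covered (x := x) (y := 1) one_ne_zero (L := excARoots ++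
    [((1, 0), (0, 0)), ((1, 0), (0, -1))]) (by
      intro q hq e
      rcases List.mem_append.mp hq with hq | hq
      · exact hx ⟨q, hq, by rw [e, mul_one]⟩
      · simp only [List.mem_cons, List.not_mem_nil, or_false] at hq
        rcases hq with rfl | rfl <;> simp [eisEval] at e
        · exact h1 e
        · exact h4 (by rw [e]; ring))
    ((1, 0), (0, 0)) ((0, -1), (0, 0)) ((0, -1), (0, -1)) ((1, 0), (0, 1)) (by decide)
  intro j hj k' hk' l hl e
  apply this j hj k' hk' l hl
  simp only [EisForm.eval, eisEval]
  push_cast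
  linear_combination e

theorem hasLine_oneSubLine (T : TraceCoords A B s θ η) {h : Option (TLine F)}
    (hh : HasLine θ η 1 h) {x : ZMod p} (hx : OneSubAllowed s x) :
    HasLine θ η ((1 - s) * x) (oneSubLine A B s h x) := by
  rw [oneSubLine]
  split_ifs with hA
  · rw [mul_comm]
    exact T.hasLine_precompA hh hA
  · obtain ⟨c1, c2⟩ := hx hA
    have hx0 := c1.2.1
    have hx1 := c1.2.2.1
    have hxs := c2.2.2.2.1
    have l1 := T.hasLine_alg1 one_ne_zero hh hx0
    have l2 := T.hasLine_alg1_snd hh hx0 hx1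
    rw [mul_one] at l1
    have h1A : (1 : ZMod p) ∈ excA₁ s ∪ excA₂ s := by simp [excA₂]
    have hs1 : s - 1 ≠ 0 := c1.2.2.2.1
    have l3 := T.hasLine_neg (by rwa [one_mul, ← neg_sub, neg_ne_zero])
      (T.hasLine_precompA hh h1A)
    rw [one_mul, neg_sub] at l3
    have l4 := T.hasLine_mul one_ne_zero hh
    rw [mul_one] at l4
    have l5 := T.hasLine_subalg (T.goodCall_oneSub_fst hA c1 hxs) l4 l1 l2 l3
    rw [add_comm] at l5
    -- The line of -xP also serves for its conjugate -sxP, and similarly for x + 1.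
    have l6 := T.hasLine_mul (neg_ne_zero.mpr hx0) (T.hasLine_neg hx0 l1)
    have l7 := T.hasLine_mul (neg_ne_zero.mpr hx1) (T.hasLine_neg hx1 l2)
    rw [mul_neg] at l6 l7
    have := T.hasLine_subalg (T.goodCall_oneSub_snd hA c2) l1 l6 l7 l5
    convert this using 1
    ring

theorem goodCall_frob_fst (T : TraceCoords A B s θ η) {m₀ m₁ : ZMod p}
    (hB : s ∉ excB₁ m₀ m₁) (h2 : 2 * m₀ + m₁ ≠ 0) (h0 : m₀ ≠ 0) (h1 : m₁ ≠ 0)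
    (hn : m₀ + s * m₁ ≠ 0)
    (h : CallAllowed m₀ (s * m₁) (s * (m₀ + m₁)) ((1 - s) * m₀)) :
    GoodCall s m₀ (s * m₁) (s * (m₀ + m₁)) ((1 - s) * m₀) := by
  obtain ⟨ha, hb, hc, hd, hab, hcd⟩ := h
  rw [T.mem_excB₁_iff h1] at hB
  refine ⟨ha, hb, hc, hd, hn, by ring, hab, hcd, Or.inr (Or.inr ?_)⟩
  have := T.noCoincidence_of_covered (x := m₀) (y := m₁) h1 (L := excB₁Roots ++
    [((1, 0), (0, 0)), ((2, 0), (-1, 0))]) (by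
      intro q hq e
      rcases List.mem_append.mp hq with hq | hq
      · exact hB ⟨q, hq, e⟩
      · simp only [List.mem_cons, List.not_mem_nil, or_false] at hq
        rcases hq with rfl | rfl <;> simp [eisEval] at e
        · exact h0 e
        · exact h2 (by rw [e]; ring))
    ((1, 0), (0, 0)) ((0, 0), (0, 1)) ((0, 1), (0, 1)) ((1, -1), (0, 0)) (by decide)
  intro j hj k' hk' l hl e
  apply this j hj k' hk' l hl
  simp only [EisForm.eval, eisEval]
  push_cast
  linear_combination e

/-- The coincidences of this call have ratios in ℬ₂, or m₀ = 0, or m₀ = -2m₁. The call is made only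
when m₀/m₁ is -1/2 or comes from ℬ₁ but not from ℬ₂, and determinants show that the two kinds of
ratio never agree. -/
theorem goodCall_frob_snd (T : TraceCoords A B s θ η) {m₀ m₁ : ZMod p}
    (hB : s ∉ excB₁ m₀ m₁ ∩ excB₂ m₀ m₁) (h2 : ¬(s ∉ excB₁ m₀ m₁ ∧ 2 * m₀ + m₁ ≠ 0))
    (h0 : m₀ ≠ 0) (h1 : m₁ ≠ 0) (hn : m₀ + s * m₁ ≠ 0)
    (h : CallAllowed m₀ (s * m₁) (m₀ + m₁) ((s - 1) * m₁)) :
    GoodCall s m₀ (s * m₁) (m₀ + m₁) ((s - 1) * m₁) := by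
  obtain ⟨ha, hb, hc, hd, hab, hcd⟩ := h
  refine ⟨ha, hb, hc, hd, hn, by ring, hab, hcd, Or.inr (Or.inr ?_)⟩
  have k1 : ∀ q ∈ excB₂Roots ++ [((1, 0), (0, 0)), ((1, 0), (-2, 0))],
      eisSmall (EisForm.det q ((2, 0), (-1, 0))) = true := by decide
  have k2 : ∀ r ∈ excB₁Roots, eisSmall (EisForm.det ((1, 0), (-2, 0)) r) = true := by decide
  have := T.noCoincidence_of_covered (x := m₀) (y := m₁) h1 (L := excB₂Roots ++
    [((1, 0), (0, 0)), ((1, 0), (-2, 0))]) (by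
      intro q hq e
      by_cases h3 : 2 * m₀ + m₁ = 0
      · refine T.not_both_of_det h0 (k1 q hq) e ?_
        simp only [eisEval]
        push_cast
        linear_combination h3
      have hB1 : s ∈ excB₁ m₀ m₁ := by
        by_contra hB1
        exact h2 ⟨hB1, h3⟩
      rcases List.mem_append.mp hq with hq | hq
      · exact hB ⟨hB1, (T.mem_excB₂_iff h0).mpr ⟨q, hq, e⟩⟩
      · simp only [List.mem_cons, List.not_mem_nil, or_false] at hq
        rcases hq with rfl | rfl
        · simp [eisEval] at e
          exact h0 e
        · obtain ⟨r, hr, e'⟩ := (T.mem_excB₁_iff h1).mp hB1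
          exact T.not_both_of_det h0 (k2 r hr) e e')
    ((1, 0), (0, 0)) ((0, 0), (0, 1)) ((1, 0), (1, 0)) ((0, 0), (-1, 1)) (by decide)
  intro j hj k' hk' l hl e
  apply this j hj k' hk' l hl
  simp only [EisForm.eval, eisEval]
  push_cast
  linear_combination e

/-- Correctness of the Frobenius reduction. -/
theorem hasLine_alg2 (T : TraceCoords A B s θ η) {h : TLine F} (hh : OnLine θ η 1 h)
    {m m₀ m₁ : ZMod p} (hm : m ≠ 0) (hdec : foldResidue m = m₀ + s * m₁)
    (hall : DecompAllowed s m₀ m₁) : HasLine θ η m (alg2 A B s h m m₀ m₁) := by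
  have hh' : HasLine θ η 1 (some h) := ⟨h, rfl, hh⟩
  have hne : foldResidue m ≠ 0 := by
    rw [foldResidue]; split_ifs
    · exact neg_ne_zero.mpr hm
    · exact hm
  have hn := hne
  rw [hdec] at hn
  suffices hs : ∀ o, HasLine θ η (foldResidue m) o →
      HasLine θ η m (if m.val > (p - 1) / 2 then neg o else o) by
    rw [alg2]
    refine hs _ ?_
    rw [hdec]
    dsimp only
    by_cases h0 : m₀ = 0
    · rw [if_pos h0]
      have h1 : m₁ ≠ 0 := fun e => hn (by rw [h0, e]; ring)
      have := T.hasLine_mul (mul_ne_zero h1 one_ne_zero) (T.hasLine_alg1 one_ne_zero hh' h1)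
      rwa [mul_one, ← zero_add (s * m₁), ← h0] at this
    rw [if_neg h0]
    by_cases h1 : m₁ = 0
    · rw [if_pos h1]
      rw [show m₀ + s * m₁ = m₀ * 1 by rw [h1]; ring]
      exact T.hasLine_alg1 one_ne_zero hh' h0
    rw [if_neg h1]
    by_cases h2 : s ∈ excB₁ m₀ m₁ ∩ excB₂ m₀ m₁
    · rw [if_pos h2]
      have hnorm := T.norm_eq_zero_of_mem_excB h0 h1 h2
      -- The ladder is run from the precomputed point (s + m₀/m₁)P with multiplier m₁.
      have e : m₁ * (s + m₀ / m₁) = m₀ + s * m₁ := by field_simp; ring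
      have hne : s + m₀ / m₁ ≠ 0 := right_ne_zero_of_mul (a := m₁) (by rwa [e])
      rw [← e]
      refine T.hasLine_alg1 hne (T.hasLine_precompR hh' ?_ hne) h1
      refine ⟨X ^ 2 + X + 1, by simp [excPolys], ?_⟩
      simp only [eval_add, eval_pow, eval_X, eval_one]
      field_simp
      linear_combination hnorm
    rw [if_neg h2]
    by_cases h3 : s ∉ excB₁ m₀ m₁ ∧ 2 * m₀ + m₁ ≠ 0
    · rw [if_pos h3]
      obtain ⟨c1, c2⟩ := (hall h0 h1 h2).1 h3
      have l0 := T.hasLine_alg1 one_ne_zero hh' h0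
      have l1 := T.hasLine_alg1 one_ne_zero hh' h1
      have h01 : m₀ + m₁ ≠ 0 := right_ne_zero_of_mul c2.2.2.1
      have l2 := T.hasLine_alg1 one_ne_zero hh' h01
      rw [mul_one] at l0 l1 l2
      exact T.hasLine_subalg (T.goodCall_frob_fst h3.1 h3.2 h0 h1 hn c2) l0 (T.hasLine_mul h1 l1)
        (T.hasLine_mul h01 l2) (T.hasLine_oneSubLine hh' c1)
    · rw [if_neg h3]
      obtain ⟨c1, c2⟩ := (hall h0 h1 h2).2 h3
      have l0 := T.hasLine_alg1 one_ne_zero hh' h0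
      have l1 := T.hasLine_alg1 one_ne_zero hh' h1
      have h01 : m₀ + m₁ ≠ 0 := c2.2.2.1
      have l2 := T.hasLine_alg1 one_ne_zero hh' h01
      rw [mul_one] at l0 l1 l2
      have hs1 : (1 - s) * m₁ ≠ 0 := by
        rw [← neg_sub, neg_mul, neg_ne_zero]; exact c2.2.2.2.1
      have l3 := T.hasLine_neg hs1 (T.hasLine_oneSubLine hh' c1)
      rw [← neg_mul, neg_sub] at l3
      exact T.hasLine_subalg (T.goodCall_frob_snd h2 h3 h0 h1 hn c2) l0 (T.hasLine_mul h1 l1) l2 l3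
  intro o ho
  rw [foldResidue] at ho hne
  split_ifs at ho hne ⊢
  · have := T.hasLine_neg hne ho
    rwa [neg_neg] at this
  · exact ho

end TraceCoords

/-! ### Counting the decompositions that are not allowed -/

/-- The residues `x ∉ excA₁ s ∪ excA₂ s` for which `OneSubAllowed s x` may fail. -/
def oneSubBad : List (ℤ × ℤ) := [(-1, 0), (-2, 1), (0, -1), (-2, -2)]

theorem ncard_le_length {α : Type*} {S : Set α} (l : List α) (h : ∀ x ∈ S, x ∈ l) :
    S.ncard ≤ l.length := by
  classical
  refine (Set.ncard_le_ncard (t := (l.toFinset : Set α)) (fun x hx => by simpa using h x hx)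
    (Finset.finite_toSet _)).trans ?_
  rw [Set.ncard_coe_finset]
  exact List.toFinset_card_le l

namespace TraceCoords

variable {F K : Type*} [Field F] [Fintype F] [Field K] [Algebra F K] {A B : F}
  {p : ℕ} [Fact p.Prime] {s : ZMod p} {θ η : ZMod p → K}

theorem mem_oneSubBad (T : TraceCoords A B s θ η) {x : ZMod p} (hx : x ≠ 0)
    (h : ¬ OneSubAllowed s x) : ∃ c ∈ oneSubBad, x = eisEval s c := by
  by_contra! hc
  refine h fun hA => ?_
  simp only [oneSubBad, List.mem_cons, List.not_mem_nil, or_false, forall_eq_or_imp, forall_eq,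
    eisEval] at hc
  push_cast at hc
  obtain ⟨c1, c2, c3, c4⟩ := hc
  have hs1 : s - 1 ≠ 0 := by
    have := T.eisEval_ne_zero (x := (-1, 1)) (by decide)
    intro h; apply this; simp only [eisEval]; push_cast; linear_combination h
  have hs2 : s + 1 ≠ 0 := by
    have := T.eisEval_ne_zero (x := (1, 1)) (by decide)
    intro h; apply this; simp only [eisEval]; push_cast; linear_combination h
  have hxs : s ≠ x := by
    rintro rfl
    exact hA (by simp [excA₁])
  have hx1 : x + 1 ≠ 0 := fun e => c1 (by linear_combination e)
  refine ⟨⟨T.s_ne_zero, hx, hx1, hs1, hxs, fun e => c2 (by linear_combination e)⟩,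
    hx, neg_ne_zero.mpr (mul_ne_zero T.s_ne_zero hx),
    neg_ne_zero.mpr (mul_ne_zero T.s_ne_zero hx1), fun e => c3 (by linear_combination e),
    fun e => ?_, fun e => c4 ?_⟩
  · exact mul_ne_zero hs2 hx (by linear_combination e)
  · apply mul_left_cancel₀ hs2
    linear_combination -e + 2 * T.quad

/-- The three quotients `m₀ / m₁` with `s ∈ excB₁ m₀ m₁` and `s ∉ excB₂ m₀ m₁`, and `-1 / 2`. -/
theorem ratio_of_excB (T : TraceCoords A B s θ η) {m₀ m₁ : ZMod p} (h₀ : m₀ ≠ 0) (h₁ : m₁ ≠ 0)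
    (hB : s ∉ excB₁ m₀ m₁ ∩ excB₂ m₀ m₁) (h2 : ¬(s ∉ excB₁ m₀ m₁ ∧ 2 * m₀ + m₁ ≠ 0)) :
    ∃ q ∈ ([((3, 0), (1, 2)), ((3, 0), (-2, -1)), ((3, 0), (-1, 1)), ((2, 0), (-1, 0))] :
      List EisForm), eisEval s q.1 * m₀ = eisEval s q.2 * m₁ := by
  by_cases h3 : 2 * m₀ + m₁ = 0
  · refine ⟨((2, 0), (-1, 0)), by simp, ?_⟩
    simp only [eisEval]
    push_cast
    linear_combination h3
  have hB1 : s ∈ excB₁ m₀ m₁ := by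
    by_contra hB1
    exact h2 ⟨hB1, h3⟩
  obtain ⟨q, hq, e⟩ := (T.mem_excB₁_iff h₁).mp hB1
  -- The seven entries give only five ratios: s and s², which also occur for ℬ₂, and the three
  -- listed here.
  have key : ∀ q ∈ excB₁Roots, eisSmall q.1 = true ∧
      ((∃ r ∈ excB₂Roots, EisForm.det r q = 0) ∨
        ∃ r ∈ ([((3, 0), (1, 2)), ((3, 0), (-2, -1)), ((3, 0), (-1, 1)), ((2, 0), (-1, 0))] :
          List EisForm), EisForm.det r q = 0) := by decide
  obtain ⟨hq0, hq1⟩ := key q hq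
  have transfer : ∀ r : EisForm, EisForm.det r q = 0 →
      eisEval s r.1 * m₀ = eisEval s r.2 * m₁ := by
    intro r hr
    have hr' := congrArg (eisEval s) hr
    rw [EisForm.det, eisEval_sub, eisEval_mul T.quad, eisEval_mul T.quad, eisEval_zero] at hr'
    apply mul_left_cancel₀ (T.eisEval_ne_zero hq0)
    linear_combination eisEval s r.1 * e + m₁ * hr'
  rcases hq1 with ⟨r, hr, hr'⟩ | ⟨r, hr, hr'⟩
  · exact absurd ⟨hB1, (T.mem_excB₂_iff h₀).mpr ⟨r, hr, transfer r hr'⟩⟩ hB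
  · exact ⟨r, hr, transfer r hr'⟩

theorem not_decompAllowed_cases (T : TraceCoords A B s θ η) {m₀ m₁ : ZMod p}
    (h : ¬ DecompAllowed s m₀ m₁) :
    ((∃ c ∈ oneSubBad, m₀ = eisEval s c) ∨ m₀ + m₁ = 0 ∨ m₀ = s * m₁ ∨
      s * m₁ = (1 - 2 * s) * m₀) ∨
    ((∃ c ∈ oneSubBad, m₁ = eisEval s c) ∧
      ∃ q ∈ ([((3, 0), (1, 2)), ((3, 0), (-2, -1)), ((3, 0), (-1, 1)), ((2, 0), (-1, 0))] :
        List EisForm), eisEval s q.1 * m₀ = eisEval s q.2 * m₁) := by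
  simp only [DecompAllowed, Classical.not_imp] at h
  obtain ⟨h0, h1, hB, h⟩ := h
  by_cases h2 : s ∉ excB₁ m₀ m₁ ∧ 2 * m₀ + m₁ ≠ 0
  · left
    by_contra! hc
    obtain ⟨c1, c2, c3, c4⟩ := hc
    have hs1 : 1 - s ≠ 0 := by
      have := T.eisEval_ne_zero (x := (1, -1)) (by decide)
      intro h; apply this; simp only [eisEval]; push_cast; linear_combination h
    refine h ⟨fun _ => ⟨?_, h0, mul_ne_zero T.s_ne_zero h1, mul_ne_zero T.s_ne_zero c2,
      mul_ne_zero hs1 h0, c3, fun e => c4 (by linear_combination e)⟩, fun h3 => absurd h2 h3⟩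
    by_contra h4
    obtain ⟨c, hc, e⟩ := T.mem_oneSubBad h0 h4
    exact c1 c hc e
  · right
    obtain ⟨q, hq, e⟩ := T.ratio_of_excB h0 h1 hB h2
    refine ⟨?_, q, hq, e⟩
    by_contra hc
    have hs1 : s - 1 ≠ 0 := by
      have := T.eisEval_ne_zero (x := (-1, 1)) (by decide)
      intro h; apply this; simp only [eisEval]; push_cast; linear_combination h
    -- The ratios -1, s and s - 2 are those at which the last call degenerates; none of them is
    -- possible here, so only the auxiliary calls can fail.
    have key : ∀ q ∈ ([((3, 0), (1, 2)), ((3, 0), (-2, -1)), ((3, 0), (-1, 1)),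
        ((2, 0), (-1, 0))] : List EisForm), ∀ r ∈ ([((1, 0), (-1, 0)), ((1, 0), (0, 1)),
          ((1, 0), (-2, 1))] : List EisForm), eisSmall (q.det r) = true := by decide
    have hr := fun r hr => T.not_both_of_det h0 (key q hq r hr) e
    simp only [List.mem_cons, List.not_mem_nil, or_false, forall_eq_or_imp, forall_eq,
      eisEval] at hr
    push_cast at hr
    obtain ⟨c2, c3, c4⟩ := hr
    refine h ⟨fun h3 => absurd h3 h2, fun _ => ⟨?_, h0, mul_ne_zero T.s_ne_zero h1,
      fun e => c2 (by linear_combination e), mul_ne_zero hs1 h1,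
      fun e => c3 (by linear_combination e), fun e => c4 (by linear_combination e)⟩⟩
    by_contra h4
    exact hc (T.mem_oneSubBad h1 h4)

/-- At most ten decompositions are not allowed. -/
theorem ncard_not_decompAllowed_le (T : TraceCoords A B s θ η) (n : ZMod p) :
    {d : ZMod p × ZMod p | n = d.1 + s * d.2 ∧ ¬ DecompAllowed s d.1 d.2}.ncard ≤ 10 := by
  -- A condition d m₀ = r m₁ together with n = m₀ + sm₁ gives m₀ = rn / (r + sd).
  have root : ∀ q : EisForm, eisSmall (q.2 + eisMul (0, 1) q.1) = true → ∀ m₀ m₁ : ZMod p,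
      n = m₀ + s * m₁ → eisEval s q.1 * m₀ = eisEval s q.2 * m₁ →
      m₀ = eisEval s q.2 * n / eisEval s (q.2 + eisMul (0, 1) q.1) := by
    intro q hq m₀ m₁ hn e
    rw [eq_div_iff (T.eisEval_ne_zero hq), eisEval_add, eisEval_mul T.quad, hn]
    simp only [eisEval]
    simp only [eisEval] at e
    push_cast
    linear_combination s * e
  set u : EisForm → ZMod p := fun q => eisEval s q.2 * n / eisEval s (q.2 + eisMul (0, 1) q.1)
    with hu
  -- Four values of m₀, three degenerate ratios and four ratios from the second case make eleven
  -- candidates. The ratios -(2 + s)/3 and -1/2 cannot both occur with m₁ in `oneSubBad` for the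
  -- same n, so one of them can be dropped; q₀ is the one kept.
  have key : ∃ q₀ ∈ ([((3, 0), (-2, -1)), ((2, 0), (-1, 0))] : List EisForm),
      ∀ d : ZMod p × ZMod p, n = d.1 + s * d.2 → ¬ DecompAllowed s d.1 d.2 →
        d.1 ∈ oneSubBad.map (eisEval s) ++ ([((1, 0), (-1, 0)), ((1, 0), (0, 1)),
          ((1, -2), (0, 1)), ((3, 0), (1, 2)), ((3, 0), (-1, 1)), q₀] : List EisForm).map u := by
    have main : ∀ q₀ ∈ ([((3, 0), (-2, -1)), ((2, 0), (-1, 0))] : List EisForm),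
        (∀ d : ZMod p × ZMod p, n = d.1 + s * d.2 → (∃ c ∈ oneSubBad, d.2 = eisEval s c) →
          ∀ q ∈ ([((3, 0), (-2, -1)), ((2, 0), (-1, 0))] : List EisForm),
          eisEval s q.1 * d.1 = eisEval s q.2 * d.2 → q = q₀) →
        ∀ d : ZMod p × ZMod p, n = d.1 + s * d.2 → ¬ DecompAllowed s d.1 d.2 →
        d.1 ∈ oneSubBad.map (eisEval s) ++ ([((1, 0), (-1, 0)), ((1, 0), (0, 1)),
          ((1, -2), (0, 1)), ((3, 0), (1, 2)), ((3, 0), (-1, 1)), q₀] : List EisForm).map u := by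
      intro q₀ _ huniq d hn hd
      rw [List.mem_append]
      have use : ∀ q ∈ ([((1, 0), (-1, 0)), ((1, 0), (0, 1)),
          ((1, -2), (0, 1)), ((3, 0), (1, 2)), ((3, 0), (-1, 1)), q₀] : List EisForm),
          eisSmall (q.2 + eisMul (0, 1) q.1) = true →
          eisEval s q.1 * d.1 = eisEval s q.2 * d.2 →
          d.1 ∈ ([((1, 0), (-1, 0)), ((1, 0), (0, 1)),
          ((1, -2), (0, 1)), ((3, 0), (1, 2)), ((3, 0), (-1, 1)), q₀] : List EisForm).map u :=
        fun q hq hs' e => List.mem_map.mpr ⟨q, hq, (root q hs' _ _ hn e).symm⟩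
      rcases T.not_decompAllowed_cases hd with (⟨c, hc, e⟩ | e | e | e) | ⟨hc, q, hq, e⟩
      · exact Or.inl (List.mem_map.mpr ⟨c, hc, e.symm⟩)
      · refine Or.inr (use ((1, 0), (-1, 0)) (by simp) (by decide) ?_)
        simp only [eisEval]; push_cast; linear_combination e
      · refine Or.inr (use ((1, 0), (0, 1)) (by simp) (by decide) ?_)
        simp only [eisEval]; push_cast; linear_combination e
      · refine Or.inr (use ((1, -2), (0, 1)) (by simp) (by decide) ?_)
        simp only [eisEval]; push_cast; linear_combination -e
      · right
        have hu' := huniq d hn hc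
        simp only [List.mem_cons, List.not_mem_nil, or_false] at hq hu'
        rcases hq with rfl | rfl | rfl | rfl
        · exact use _ (by simp) (by decide) e
        · exact use _ (by simp [← hu' _ (Or.inl rfl) e]) (by decide) e
        · exact use _ (by simp) (by decide) e
        · exact use _ (by simp [← hu' _ (Or.inr rfl) e]) (by decide) e
    by_cases hex : ∃ d : ZMod p × ZMod p, n = d.1 + s * d.2 ∧
        (∃ c ∈ oneSubBad, d.2 = eisEval s c) ∧ eisEval s (3, 0) * d.1 = eisEval s (-2, -1) * d.2
    · obtain ⟨d', hn', ⟨c', hc', e'⟩, h'⟩ := hex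
      refine ⟨((3, 0), (-2, -1)), by simp, main _ (by simp) ?_⟩
      rintro d hn ⟨c, hc, e⟩ q hq h
      simp only [List.mem_cons, List.not_mem_nil, or_false] at hq
      rcases hq with rfl | rfl
      · rfl
      exfalso
      -- The two ratios give 6n = (6s - 3)c and 6n = (4s - 4)c', and these values never agree.
      have small : ∀ c ∈ oneSubBad, ∀ c' ∈ oneSubBad,
          eisSmall (eisMul (-3, 6) c - eisMul (-4, 4) c') = true := by decide
      refine T.eisEval_ne_zero (small c hc c' hc') ?_
      rw [eisEval_sub, eisEval_mul T.quad, eisEval_mul T.quad, ← e, ← e']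
      simp only [eisEval] at h h' ⊢
      push_cast at h h' ⊢
      linear_combination -3 * h + 2 * h' - 6 * hn + 6 * hn'
    · refine ⟨((2, 0), (-1, 0)), by simp, main _ (by simp) ?_⟩
      intro d hn hc q hq h
      simp only [List.mem_cons, List.not_mem_nil, or_false] at hq
      rcases hq with rfl | rfl
      · exact absurd ⟨d, hn, hc, h⟩ hex
      · rfl
  obtain ⟨q₀, -, hq₀⟩ := key
  refine (ncard_le_length ((oneSubBad.map (eisEval s) ++ ([((1, 0), (-1, 0)), ((1, 0), (0, 1)),
    ((1, -2), (0, 1)), ((3, 0), (1, 2)), ((3, 0), (-1, 1)), q₀] : List EisForm).map u).map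
      fun c => (c, (n - c) / s)) ?_).trans (by simp [oneSubBad])
  rintro ⟨m₀, m₁⟩ ⟨hn, hd⟩
  refine List.mem_map.mpr ⟨m₀, hq₀ (m₀, m₁) hn hd, ?_⟩
  rw [Prod.mk.injEq, div_eq_iff T.s_ne_zero]
  exact ⟨rfl, by rw [hn]; ring⟩

end TraceCoords

/-! ### Existence of small allowed decompositions -/

/-- A nontrivial relation `a + s b = 0` with small integers, by the pigeonhole principle. -/
theorem exists_small_relation {p : ℕ} [Fact p.Prime] (s : ZMod p) :
    ∃ a b : ℤ, (a : ZMod p) + s * b = 0 ∧ |a| ≤ Nat.sqrt p ∧ |b| ≤ Nat.sqrt p ∧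
      (a ≠ 0 ∨ b ≠ 0) := by
  set r := Nat.sqrt p with hr
  have hcard : (Finset.univ : Finset (ZMod p)).card <
      (Finset.range (r + 1) ×ˢ Finset.range (r + 1)).card := by
    rw [Finset.card_univ, ZMod.card, Finset.card_product, Finset.card_range]
    exact Nat.sqrt_lt'.mp (Nat.lt_succ_self _) |>.trans_eq (sq _)
  obtain ⟨x, hx, y, hy, hxy, e⟩ := Finset.exists_ne_map_eq_of_card_lt_of_maps_to hcard
    (f := fun x : ℕ × ℕ => (x.1 : ZMod p) + s * x.2) (fun _ _ => Finset.mem_coe.mpr (Finset.mem_univ _))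
  simp only [Finset.mem_product, Finset.mem_range] at hx hy
  refine ⟨x.1 - y.1, x.2 - y.2, ?_, ?_, ?_, ?_⟩
  · push_cast
    linear_combination e
  · rw [abs_le]; constructor <;> omega
  · rw [abs_le]; constructor <;> omega
  · by_contra! h
    exact hxy (Prod.ext (by omega) (by omega))

/-- The vectors are a + bω and ω(a + bω). The centre of the box is written in this basis with
rational coefficients, the determinant being the norm of a + bω. Rounding moves the two coordinates
by at most r and 3r/2, hence the side 3r. -/
theorem exists_int_combination {a b : ℤ} {r : ℕ} (ha : |a| ≤ r) (hb : |b| ≤ r)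
    (hab : a ≠ 0 ∨ b ≠ 0) (U V : ℤ) : ∃ i j : ℤ, U ≤ i * a - j * b ∧ i * a - j * b ≤ U + 3 * r ∧
      V ≤ i * b + j * (a - b) ∧ i * b + j * (a - b) ≤ V + 3 * r := by
  have hN : (0 : ℚ) < a ^ 2 - a * b + b ^ 2 := by
    have : (0 : ℤ) < a ^ 2 - a * b + b ^ 2 := by
      rcases hab with h | h
      · have := sq_pos_of_ne_zero h
        nlinarith [sq_nonneg (a - 2 * b)]
      · have := sq_pos_of_ne_zero h
        nlinarith [sq_nonneg (2 * a - b)]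
    exact_mod_cast this
  set N : ℚ := a ^ 2 - a * b + b ^ 2 with hNdef
  set u : ℚ := U + 3 / 2 * r with hu
  set v : ℚ := V + 3 / 2 * r with hv
  set t : ℚ := (u * (a - b) + v * b) / N with ht
  set w : ℚ := (v * a - u * b) / N with hw
  have e1 : t * a - w * b = u := by rw [ht, hw]; field_simp; rw [hNdef]; ring
  have e2 : t * b + w * (a - b) = v := by rw [ht, hw]; field_simp; rw [hNdef]; ring
  have hi := abs_sub_round t
  have hj := abs_sub_round w
  have ha' : |(a : ℚ)| ≤ r := by exact_mod_cast ha
  have hb' : |(b : ℚ)| ≤ r := by exact_mod_cast hb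
  have hab' : |(a : ℚ) - b| ≤ 2 * r := by
    have := abs_sub (a : ℚ) b
    linarith
  have prod : ∀ {x y c : ℚ}, |x| ≤ 1 / 2 → |y| ≤ c → |x * y| ≤ c / 2 := by
    intro x y c hx hy
    rw [abs_mul]
    nlinarith [abs_nonneg x, abs_nonneg y]
  have p1 := abs_le.mp (prod hi ha')
  have p2 := abs_le.mp (prod hj hb')
  have p3 := abs_le.mp (prod hi hb')
  have p4 := abs_le.mp (prod hj hab')
  refine ⟨round t, round w, ?_, ?_, ?_, ?_⟩
  all_goals
    rw [← Int.cast_le (R := ℚ)]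
    push_cast
    linarith

namespace TraceCoords

variable {F K : Type*} [Field F] [Fintype F] [Field K] [Algebra F K] {A B : F}
  {p : ℕ} [Fact p.Prime] {s : ZMod p} {θ η : ZMod p → K}

/-- The relations form a module over ℤ[ω], so n = n + s·0 can be translated by the combinations just
found. -/
theorem exists_decomposition_in_box (T : TraceCoords A B s θ η) (n : ZMod p) (U V : ℕ) :
    ∃ x y : ℕ, U ≤ x ∧ x ≤ U + 3 * Nat.sqrt p ∧ V ≤ y ∧ y ≤ V + 3 * Nat.sqrt p ∧
      n = (x : ZMod p) + s * (y : ZMod p) := by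
  obtain ⟨a, b, hab, ha, hb, hne⟩ := exists_small_relation s
  obtain ⟨i, j, h1, h2, h3, h4⟩ := exists_int_combination ha hb hne (U - n.val) V
  obtain ⟨x, hx⟩ := Int.eq_ofNat_of_zero_le (a := n.val + (i * a - j * b)) (by omega)
  obtain ⟨y, hy⟩ := Int.eq_ofNat_of_zero_le (a := i * b + j * (a - b)) (by omega)
  refine ⟨x, y, by omega, by omega, by omega, by omega, ?_⟩
  have hx' := congrArg (Int.cast (R := ZMod p)) hx
  have hy' := congrArg (Int.cast (R := ZMod p)) hy
  push_cast at hx' hy'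
  rw [ZMod.natCast_zmod_val] at hx'
  rw [← hx', ← hy']
  linear_combination (-(i : ZMod p) - s * j) * hab + j * b * T.quad

/-- Small allowed decompositions exist. -/
theorem exists_decompAllowed (T : TraceCoords A B s θ η) (n : ZMod p) :
    ∃ m₀ m₁ : ℕ, m₀ ≤ 16 * Nat.sqrt p ∧ m₁ ≤ 16 * Nat.sqrt p ∧
      n = (m₀ : ZMod p) + s * (m₁ : ZMod p) ∧ DecompAllowed s (m₀ : ZMod p) (m₁ : ZMod p) := by
  have hlarge := T.large
  set r := Nat.sqrt p with hr
  have hr1 : 1000 ≤ r := by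
    rw [hr, Nat.le_sqrt]; omega
  have hr2 : 16 * r < p := by
    have := Nat.sqrt_le p
    rw [← hr] at this
    nlinarith
  -- Boxes of side 3r with spacing 3r + 1 are disjoint, and a 4 × 4 array of them stays within 12r +
  -- 3 ≤ 16r. As 16r < p, decompositions from different boxes remain different modulo p, and sixteen
  -- exceed the ten that can fail.
  choose x y hx1 hx2 hy1 hy2 hxy using fun k : ℕ × ℕ =>
    T.exists_decomposition_in_box n ((3 * r + 1) * k.1) ((3 * r + 1) * k.2)
  rw [← hr] at hx2 hy2
  by_contra! hno
  have bound : ∀ k < 4, (3 * r + 1) * k + 3 * r ≤ 16 * r := by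
    intro k hk
    have : (3 * r + 1) * k ≤ (3 * r + 1) * 3 := Nat.mul_le_mul_left _ (by omega)
    omega
  have digit : ∀ {k l z : ℕ}, (3 * r + 1) * k ≤ z → z ≤ (3 * r + 1) * k + 3 * r →
      (3 * r + 1) * l ≤ z → z ≤ (3 * r + 1) * l + 3 * r → k = l := by
    intro k l z h1 h2 h3 h4
    rcases lt_trichotomy k l with h | h | h
    · have : (3 * r + 1) * (k + 1) ≤ (3 * r + 1) * l := Nat.mul_le_mul_left _ h
      rw [mul_add] at this
      omega
    · exact h
    · have : (3 * r + 1) * (l + 1) ≤ (3 * r + 1) * k := Nat.mul_le_mul_left _ h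
      rw [mul_add] at this
      omega
  set S : Finset (ℕ × ℕ) := Finset.range 4 ×ˢ Finset.range 4 with hS
  have hmem : ∀ k ∈ S, k.1 < 4 ∧ k.2 < 4 := fun k hk => by simpa [hS] using hk
  have hx : ∀ k ∈ S, x k ≤ 16 * r := fun k hk => (hx2 k).trans (bound _ (hmem k hk).1)
  have hy : ∀ k ∈ S, y k ≤ 16 * r := fun k hk => (hy2 k).trans (bound _ (hmem k hk).2)
  have hinj : Set.InjOn (fun k => ((x k : ZMod p), (y k : ZMod p))) S := by
    intro k hk l hl e
    rw [Prod.mk.injEq] at e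
    have ex : x k = x l := by
      by_contra hne
      exact natCast_ne_natCast ((hx k hk).trans_lt hr2) ((hx l hl).trans_lt hr2) hne e.1
    have ey : y k = y l := by
      by_contra hne
      exact natCast_ne_natCast ((hy k hk).trans_lt hr2) ((hy l hl).trans_lt hr2) hne e.2
    exact Prod.ext (digit (hx1 k) (hx2 k) (by rw [ex]; exact hx1 l) (by rw [ex]; exact hx2 l))
      (digit (hy1 k) (hy2 k) (by rw [ey]; exact hy1 l) (by rw [ey]; exact hy2 l))
  have hle := T.ncard_not_decompAllowed_le n
  have hsub : (fun k => ((x k : ZMod p), (y k : ZMod p))) '' S ⊆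
      {d : ZMod p × ZMod p | n = d.1 + s * d.2 ∧ ¬ DecompAllowed s d.1 d.2} := by
    rintro _ ⟨k, hk, rfl⟩
    exact ⟨hxy k, hno _ _ (hx k hk) (hy k hk) (hxy k)⟩
  have := Set.ncard_le_ncard hsub (Set.toFinite _)
  rw [hinj.ncard_image, Set.ncard_coe_finset, hS, Finset.card_product,
    Finset.card_range] at this
  omega

end TraceCoords

theorem mainTheorem1 {F K : Type*} [Field F] [Fintype F] [Field K] [DecidableEq K] [Algebra F K]
    (hchar2 : ringChar F ≠ 2) (hchar3 : ringChar F ≠ 3) (hdeg : Module.finrank F K = 3)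
    (A B : F) (hdisc : 4 * A ^ 3 + 27 * B ^ 2 ≠ 0)
    (p : ℕ) [Fact p.Prime] (hp : 10 ^ 6 < p)
    (P : CurvePoint K A B) (hgen : AddSubgroup.zmultiples P = traceZero K A B)
    (hcard : Nat.card (traceZero K A B) = p)
    (s : ZMod p) (hs : frobPoint A B P = s.val • P)
    (h : TLine F) (hh : IsTraceLine h P) (m : ZMod p) (hm : m ≠ 0) :
    (∃ m₀ m₁ : ℕ, (m₀ : ℝ) ≤ 16 * √(p : ℝ) ∧ (m₁ : ℝ) ≤ 16 * √(p : ℝ) ∧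
      foldResidue m = (m₀ : ZMod p) + s * (m₁ : ZMod p) ∧
      DecompAllowed s (m₀ : ZMod p) (m₁ : ZMod p)) ∧
    {d : ZMod p × ZMod p | foldResidue m = d.1 + s * d.2 ∧ ¬ DecompAllowed s d.1 d.2}.ncard ≤ 10 ∧
    ∀ m₀ m₁ : ZMod p, foldResidue m = m₀ + s * m₁ → DecompAllowed s m₀ m₁ →
      ∃ h' : TLine F, alg2 A B s h m m₀ m₁ = some h' ∧
        ∀ l : TLine F, IsTraceLine l (m.val • P) ↔ l = h' := by
  obtain ⟨hne, T⟩ := traceCoords hchar2 hchar3 hdeg p hp P hgen hcard s hs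
  refine ⟨?_, T.ncard_not_decompAllowed_le _, fun m₀ m₁ hdec hall => ?_⟩
  · obtain ⟨m₀, m₁, h0, h1, h2⟩ := T.exists_decompAllowed (foldResidue m)
    have hsqrt := Real.nat_sqrt_le_real_sqrt (a := p)
    refine ⟨m₀, m₁, ?_, ?_, h2⟩
    · have : (m₀ : ℝ) ≤ 16 * (Nat.sqrt p : ℝ) := by exact_mod_cast h0
      linarith
    · have : (m₁ : ℝ) ≤ 16 * (Nat.sqrt p : ℝ) := by exact_mod_cast h1
      linarith
  · have hP : (1 : ZMod p).val • P = P := by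
      have : Fact (1 < p) := ⟨(Fact.out : p.Prime).one_lt⟩
      rw [ZMod.val_one, one_smul]
    have hline : OnLine (fun u : ZMod p => xCoord (u.val • P)) (fun u => yCoord (u.val • P)) 1 h := by
      have := hh
      rw [← hP] at this
      exact (isTraceLine_iff (hne 1 one_ne_zero)).mp this
    obtain ⟨h', e, hl⟩ := T.hasLine_alg2 hline hm hdec hall
    refine ⟨h', e, fun l => ?_⟩
    rw [isTraceLine_iff (hne m hm)]
    constructor
    · exact fun hl' => T.onLine_unique hm hl' hl
    · rintro rfl
      exact hl
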